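/- **Definitions.** All C*-algebras are complex and unital; $\mathscr S(\mathfrak A)$ is the state space and $\mathfrak{sa}(\mathfrak A)$ the self-adjoint part of $\mathfrak A$. *Quantum metric spaces.* A $(2,0)$-quasi-Leibniz quantum compact metric space is a pair $(\mathfrak A,\mathsf L)$, where $\mathfrak A\neq 0$ is a unital C*-algebra and $\mathsf L$ is a seminorm on a dense subspace of $\mathfrak{sa}(\mathfrak A)$ (extended by $\infty$ to $\mathfrak{sa}(\mathfrak A)$), lower semicontinuous for the norm, such that $\mathsf L(a)=0$ exactly for $a\in\mathbb R1_{\mathfrak A}$, such that $$\max\left\{\mathsf L\left(\tfrac{ab+ba}{2}\right),\mathsf L\left(\tfrac{ab-ba}{2i}\right)\right\}\le 2\left(\|a\|\mathsf L(b)+\|b\|\mathsf L(a)\right)$$ whenever $\mathsf L(a),\mathsf L(b)<\infty$, and such that $\mathrm{mk}_{\mathsf L}(\varphi,\psi)=\sup\{|\varphi(a)-\psi(a)| : \mathsf L(a)\le 1\}$ is a (finite) metric on $\mathscr S(\mathfrak A)$ which induces the weak* topology. *Quantum propinquity.* A bridge from $\mathfrak A$ to $\mathfrak B$ is $\gamma=(\mathfrak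 D,\pi_{\mathfrak A},\pi_{\mathfrak B},\omega)$, where $\mathfrak D$ is a unital C*-algebra, $\pi_{\mathfrak A},\pi_{\mathfrak B}$ are unital *-monomorphisms of $\mathfrak A,\mathfrak B$ into $\mathfrak D$, and $\omega\in\mathfrak D$ is such that $\mathscr S_1(\mathfrak D|\omega)=\{\varphi\in\mathscr S(\mathfrak D):\varphi(1-\omega^*\omega)=\varphi(1-\omega\omega^*)=0\}$ is not empty. Its height is the larger of the Hausdorff distances, for $\mathrm{mk}_{\mathsf L_{\mathfrak A}}$ and $\mathrm{mk}_{\mathsf L_{\mathfrak B}}$, between $\mathscr S(\mathfrak A)$ and $\{\varphi\circ\pi_{\mathfrak A}:\varphi\in\mathscr S_1(\mathfrak D|\omega)\}$ and between $\mathscr S(\mathfrak B)$ and $\{\varphi\circ\pi_{\mathfrak B}:\varphi\in\mathscr S_1(\mathfrak D|\omega)\}$. Its reach is the Hausdorff distance between $\{a\in\mathfrak{sa}(\mathfrak A):\mathsf L_{\mathfrak A}(a)\le1\}$ and $\{b\in\mathfrak{sa}(\mathfrak B):\mathsf L_{\mathfrak B}(b)\le1\}$, where $a$ and $b$ are at distance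 $\|\pi_{\mathfrak A}(a)\omega-\omega\pi_{\mathfrak B}(b)\|_{\mathfrak D}$. Its length is the maximum of its height and its reach. The quantum propinquity between two $(2,0)$-quasi-Leibniz quantum compact metric spaces is the infimum, over all finite chains of bridges from one to the other through such spaces, of the sum of the lengths of the bridges; equivalently, it is the largest pseudo-distance on the class of these spaces that is dominated by the length of every bridge. *Effros–Shen algebras.* Let $\theta\in(0,1)\setminus\mathbb Q$ have continued fraction expansion $\theta=[0;r_1,r_2,\dots]$, and let $q_0=1$, $q_1=r_1$, $q_{n+1}=r_{n+1}q_n+q_{n-1}$. Let $\mathfrak{AF}_{\theta,0}=\mathbb C$ and $\mathfrak{AF}_{\theta,n}=M_{q_n}(\mathbb C)\oplus M_{q_{n-1}}(\mathbb C)$ for $n\ge1$, with the unital *-monomorphisms $\alpha_{\theta,0}:\mathbb C\to\mathfrak{AF}_{\theta,1}$ and $\alpha_{\theta,n}(a\oplus b)=\mathrm{diag}(a,\dots,a,b)\oplus a$, where $a$ occurs $r_{n+1}$ times on the diagonal, for $n\ge1$. Let $\mathfrak{AF}_\theta$ be the C*-inductive limit, with canonical maps $\alpha_\theta^n:\mathfrak{AF}_{\theta,n}\to\mathfrak{AF}_\theta$.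 **Theorem.** Let $k\in(0,\infty)$. 1. For every $\theta\in(0,1)\setminus\mathbb Q$ the algebra $\mathfrak{AF}_\theta$ is infinite dimensional and has exactly one tracial state $\sigma_\theta$, which is faithful, and for every $n\in\mathbb N$ there is exactly one conditional expectation $\mathbb E_n$ of $\mathfrak{AF}_\theta$ onto $\alpha_\theta^n(\mathfrak{AF}_{\theta,n})$ with $\sigma_\theta\circ\mathbb E_n=\sigma_\theta$. 2. For every $\theta\in(0,1)\setminus\mathbb Q$ the pair $(\mathfrak{AF}_\theta,\mathsf L_\theta^k)$, where $$\mathsf L_\theta^k(a)=\sup_{n\in\mathbb N}\ \left(\dim\mathfrak{AF}_{\theta,n}\right)^k\left\|a-\mathbb E_n(a)\right\|\qquad(a\in\mathfrak{sa}(\mathfrak{AF}_\theta)),$$ is a $(2,0)$-quasi-Leibniz quantum compact metric space. 3. The map $\theta\mapsto(\mathfrak{AF}_\theta,\mathsf L_\theta^k)$ is continuous from $(0,1)\setminus\mathbb Q$, with its topology as a subset of $\mathbb R$, to the class of $(2,0)$-quasi-Leibniz quantum compact metric spaces with the topology of the quantum propinquity. -/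

import Mathlib

open scoped NNReal ENNReal Topology ComplexOrder

universe u

/-! ## States, traces and conditional expectations -/

namespace QuantumMetric

section States

variable (A : Type u) [CStarAlgebra A]

/-- The state space of a unital C*-algebra, inside its dual with the weak* topology. -/
def stateSpace : Set (WeakDual ℂ A) :=
  {φ | φ 1 = 1 ∧ ∀ a : A, 0 ≤ φ (star a * a)}

variable {A}

/-- Tracial states. -/
def IsTracialState (τ : WeakDual ℂ A) : Prop :=
  τ ∈ stateSpace A ∧ ∀ a b : A, τ (a * b) = τ (b * a)

/-- Faithfulness of a positive functional. -/
def IsFaithful (τ : WeakDual ℂ A) : Prop :=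
  ∀ a : A, τ (star a * a) = 0 → a = 0

/-- `E` is a conditional expectation of `A` onto the C*-subalgebra `B`: a positive linear map
of norm one with range `B`, which is `B`-bilinear. -/
structure IsCondExp (B : StarSubalgebra ℂ A) (E : A →L[ℂ] A) : Prop where
  range_eq : Set.range E = (B : Set A)
  norm_eq : ‖E‖ = 1
  pos : ∀ a : A, ∃ b : A, E (star a * a) = star b * b
  bimodule : ∀ b ∈ B, ∀ c ∈ B, ∀ a : A, E (b * a * c) = b * E a * c

/-- `E` is a conditional expectation onto `B` which preserves the functional `μ`. -/
def IsPreservingCondExp (μ : WeakDual ℂ A) (B : StarSubalgebra ℂ A) (E : A →L[ℂ] A) : Prop :=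
  IsCondExp B E ∧ ∀ a : A, μ (E a) = μ a

/-- The conditional expectation onto `B` which preserves `μ` (meaningful when there is exactly
one such map). -/
noncomputable def condExp (μ : WeakDual ℂ A) (B : StarSubalgebra ℂ A) : A →L[ℂ] A :=
  Classical.epsilon (IsPreservingCondExp μ B)

/-- A nonzero unital C*-algebra has a state. -/
theorem stateSpace_nonempty [Nontrivial A] : (stateSpace A).Nonempty := by
  obtain ⟨f, hf, hf1⟩ := exists_dual_vector ℂ (1 : A) (by simp)
  have h1 : f 1 = 1 := by simpa using hf1
  have hle : ∀ x : A, ‖f x‖ ≤ ‖x‖ := fun x => by simpa [hf] using f.le_opNorm x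
  have him : ∀ a : A, IsSelfAdjoint a → (f a).im = 0 := by
    intro a ha
    have key : ∀ t : ℝ, ((f a).im + t) ^ 2 ≤ ‖a‖ ^ 2 + t ^ 2 := by
      intro t
      have e1 : star (a + ((t : ℂ) * Complex.I) • (1 : A)) * (a + ((t : ℂ) * Complex.I) • (1 : A))
          = a * a + ((t : ℂ) ^ 2) • (1 : A) := by
        simp only [star_add, ha.star_eq, star_smul, star_one, add_mul, mul_add, mul_smul_comm,
          smul_mul_assoc, mul_one, one_mul]
        have : star ((t : ℂ) * Complex.I) = -((t : ℂ) * Complex.I) := by simp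
        have h2 : ((t : ℂ) * Complex.I) * ((t : ℂ) * Complex.I) = -((t : ℂ) ^ 2) := by
          rw [mul_mul_mul_comm, Complex.I_mul_I]; ring
        rw [this, smul_add, smul_smul, neg_smul, mul_neg, h2, neg_neg]
        abel
      have e2 : ‖a + ((t : ℂ) * Complex.I) • (1 : A)‖ ^ 2 ≤ ‖a‖ ^ 2 + t ^ 2 := by
        rw [sq, ← CStarRing.norm_star_mul_self, e1]
        refine (norm_add_le _ _).trans ?_
        have h3 : ‖a * a‖ ≤ ‖a‖ ^ 2 := by rw [sq]; exact norm_mul_le _ _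
        have h4 : ‖((t : ℂ) ^ 2) • (1 : A)‖ = t ^ 2 := by
          rw [norm_smul]; simp
        linarith
      have e3 : f (a + ((t : ℂ) * Complex.I) • (1 : A)) = f a + (t : ℂ) * Complex.I := by
        simp [h1]
      have e4 := hle (a + ((t : ℂ) * Complex.I) • (1 : A))
      rw [e3] at e4
      have e5 : |(f a + (t : ℂ) * Complex.I).im| ≤ _ := Complex.abs_im_le_norm _
      have e6 : (f a + (t : ℂ) * Complex.I).im = (f a).im + t := by simp
      rw [e6] at e5
      calc ((f a).im + t) ^ 2 = |(f a).im + t| ^ 2 := (sq_abs _).symm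
        _ ≤ ‖a + ((t : ℂ) * Complex.I) • (1 : A)‖ ^ 2 := by
          gcongr; exact e5.trans e4
        _ ≤ _ := e2
    by_contra hne
    have := key ((‖a‖ ^ 2 + 1) / (2 * (f a).im))
    have h5 : 2 * (f a).im * ((‖a‖ ^ 2 + 1) / (2 * (f a).im)) = ‖a‖ ^ 2 + 1 := by
      field_simp
    nlinarith [sq_nonneg (f a).im]
  refine ⟨(f : A →L[ℂ] ℂ).toLinearMap.mkContinuous 1 (fun x => by simpa using hle x), h1, ?_⟩
  intro a
  change 0 ≤ f (star a * a)
  let _ := CStarAlgebra.spectralOrder A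
  have _ := CStarAlgebra.spectralOrderedRing A
  set p := star a * a with hp
  have hp0 : 0 ≤ p := star_mul_self_nonneg a
  have hpsa : IsSelfAdjoint p := IsSelfAdjoint.star_mul_self a
  have hb : ‖algebraMap ℝ A ‖p‖ - p‖ ≤ ‖p‖ := by
    have h6 : ‖algebraMap ℝ A ‖p‖ - p‖ ≤ ‖algebraMap ℝ A ‖p‖‖ :=
      CStarAlgebra.norm_le_norm_of_nonneg_of_le
        (sub_nonneg.2 hpsa.le_algebraMap_norm_self) (sub_le_self _ hp0)
    simpa using h6
  have hre : |((‖p‖ : ℂ) - f p).re| ≤ ‖p‖ := by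
    refine (Complex.abs_re_le_norm _).trans ?_
    have : f (algebraMap ℝ A ‖p‖ - p) = (‖p‖ : ℂ) - f p := by
      rw [map_sub, Algebra.algebraMap_eq_smul_one, ← Complex.coe_smul]
      simp [h1]
    rw [← this]
    exact (hle _).trans hb
  rw [Complex.nonneg_iff]
  refine ⟨?_, (him p hpsa).symm⟩
  have := (abs_le.1 hre).2
  simp at this
  linarith

end States

/-! ## Quasi-Leibniz quantum compact metric spaces -/

section LipNorms

variable {A : Type u} [CStarAlgebra A]

/-- The Jordan product `(ab + ba) / 2` of self-adjoint elements. -/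
noncomputable def jordan (a b : selfAdjoint A) : selfAdjoint A :=
  ⟨(2 : ℂ)⁻¹ • ((a : A) * b + b * a), by
    rw [selfAdjoint.mem_iff]
    simp [star_smul, a.2.star_eq, b.2.star_eq, add_comm]⟩

/-- The Lie product `(ab - ba) / 2i` of self-adjoint elements. -/
noncomputable def lie (a b : selfAdjoint A) : selfAdjoint A :=
  ⟨(2 * Complex.I)⁻¹ • ((a : A) * b - b * a), by
    rw [selfAdjoint.mem_iff, star_smul, star_sub, star_mul, star_mul, a.2.star_eq, b.2.star_eq]
    have : star ((2 * Complex.I)⁻¹ : ℂ) = -(2 * Complex.I)⁻¹ := by simp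
    rw [this, neg_smul, ← smul_neg, neg_sub]⟩

/-- The Monge-Kantorovich metric of an extended seminorm `L`. -/
noncomputable def mongeKantorovich (L : selfAdjoint A → ℝ≥0∞) (φ ψ : WeakDual ℂ A) : ℝ≥0∞ :=
  ⨆ (a : selfAdjoint A) (_ : L a ≤ 1), ‖φ (a : A) - ψ (a : A)‖ₑ

/-- `L` is a lower semicontinuous `(C, D)`-quasi-Leibniz Lip-norm on `A`. A seminorm defined on a
subspace of the self-adjoint part is extended by `∞` outside of it, so its domain is
`{a | L a ≠ ∞}`; the inequality `leibniz` makes the domain a Jordan-Lie subalgebra. -/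
structure IsLipNorm (C D : ℝ≥0) (L : selfAdjoint A → ℝ≥0∞) : Prop where
  smul : ∀ (r : ℝ) (a : selfAdjoint A), L (r • a) = ‖r‖ₑ * L a
  add_le : ∀ a b : selfAdjoint A, L (a + b) ≤ L a + L b
  dense_dom : Dense {a : selfAdjoint A | L a ≠ ∞}
  eq_zero_iff : ∀ a : selfAdjoint A, L a = 0 ↔ ∃ r : ℝ, a = r • (1 : selfAdjoint A)
  leibniz : ∀ a b : selfAdjoint A, L a ≠ ∞ → L b ≠ ∞ →
    max (L (jordan a b)) (L (lie a b)) ≤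
      C * (‖(a : A)‖ₑ * L b + ‖(b : A)‖ₑ * L a) + D * L a * L b
  mk_ne_top : ∀ φ ∈ stateSpace A, ∀ ψ ∈ stateSpace A, mongeKantorovich L φ ψ ≠ ∞
  /-- The metric `mongeKantorovich L` induces the weak* topology on the state space. -/
  mk_basis : ∀ φ ∈ stateSpace A,
    (𝓝[stateSpace A] φ).HasBasis (fun ε : ℝ≥0∞ => 0 < ε)
      (fun ε => {ψ | ψ ∈ stateSpace A ∧ mongeKantorovich L φ ψ < ε})
  lsc : LowerSemicontinuous L

end LipNorms

/-- The class of `(C, D)`-quasi-Leibniz quantum compact metric spaces. -/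
structure QQCMS (C D : ℝ≥0) : Type (u + 1) where
  carrier : Type u
  [cstar : CStarAlgebra carrier]
  [nontrivial : Nontrivial carrier]
  lip : selfAdjoint carrier → ℝ≥0∞
  isLipNorm : IsLipNorm C D lip

attribute [instance] QQCMS.cstar QQCMS.nontrivial

/-! ## Bridges -/

/-- The `1`-level set of an element of a unital C*-algebra. -/
def levelSet {D : Type u} [CStarAlgebra D] (ω : D) : Set (WeakDual ℂ D) :=
  {φ | φ ∈ stateSpace D ∧ φ (1 - star ω * ω) = 0 ∧ φ (1 - ω * star ω) = 0}

/-- Bridges between unital C*-algebras. -/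
structure Bridge (A B : Type u) [CStarAlgebra A] [CStarAlgebra B] : Type (u + 1) where
  carrier : Type u
  [cstar : CStarAlgebra carrier]
  left : A →⋆ₐ[ℂ] carrier
  right : B →⋆ₐ[ℂ] carrier
  left_injective : Function.Injective left
  right_injective : Function.Injective right
  pivot : carrier
  nonempty_levelSet : (levelSet pivot).Nonempty

attribute [instance] Bridge.cstar

/-- The Hausdorff distance between `S` and `T`, for distances between points of `S` and points
of `T` measured by `d`. -/
noncomputable def hausdorff {X Y : Type*} (d : X → Y → ℝ≥0∞) (S : Set X) (T : Set Y) : ℝ≥0∞ :=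
  max (⨆ x ∈ S, ⨅ y ∈ T, d x y) (⨆ y ∈ T, ⨅ x ∈ S, d x y)

/-- The image of a set of functionals under the dual map `φ ↦ φ ∘ π`. -/
def dualImage {A D : Type u} [CStarAlgebra A] [CStarAlgebra D] (π : A →⋆ₐ[ℂ] D)
    (S : Set (WeakDual ℂ D)) : Set (WeakDual ℂ A) :=
  {ψ | ∃ φ ∈ S, ∀ a : A, ψ a = φ (π a)}

namespace Bridge

variable {A B : Type u} [CStarAlgebra A] [CStarAlgebra B]

/-- The height of a bridge. -/
noncomputable def height (γ : Bridge A B) (LA : selfAdjoint A → ℝ≥0∞)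
    (LB : selfAdjoint B → ℝ≥0∞) : ℝ≥0∞ :=
  max (hausdorff (mongeKantorovich LA) (stateSpace A) (dualImage γ.left (levelSet γ.pivot)))
    (hausdorff (mongeKantorovich LB) (stateSpace B) (dualImage γ.right (levelSet γ.pivot)))

/-- The bridge seminorm of `(a, b)`. -/
noncomputable def seminorm (γ : Bridge A B) (a : A) (b : B) : ℝ≥0∞ :=
  ‖γ.left a * γ.pivot - γ.pivot * γ.right b‖ₑ

/-- The reach of a bridge: the Hausdorff distance for the bridge seminorm between the unit balls
of the Lip-norms. (These balls are stable under `b ↦ -b`, so it is immaterial whether `(a, b)` or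
`(a, 0) - (0, b) = (a, -b)` is put into the bridge seminorm.) -/
noncomputable def reach (γ : Bridge A B) (LA : selfAdjoint A → ℝ≥0∞)
    (LB : selfAdjoint B → ℝ≥0∞) : ℝ≥0∞ :=
  hausdorff (fun (a : selfAdjoint A) (b : selfAdjoint B) => γ.seminorm (a : A) (b : B))
    {a | LA a ≤ 1} {b | LB b ≤ 1}

/-- The length of a bridge. -/
noncomputable def length (γ : Bridge A B) (LA : selfAdjoint A → ℝ≥0∞)
    (LB : selfAdjoint B → ℝ≥0∞) : ℝ≥0∞ :=
  max (γ.height LA LB) (γ.reach LA LB)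

/-- The bridge from `A` to itself given by the identity maps and the pivot `1`. -/
noncomputable def refl (A : Type u) [CStarAlgebra A] [Nontrivial A] : Bridge A A where
  carrier := A
  left := StarAlgHom.id ℂ A
  right := StarAlgHom.id ℂ A
  left_injective := Function.injective_id
  right_injective := Function.injective_id
  pivot := 1
  nonempty_levelSet := by
    obtain ⟨φ, hφ⟩ := stateSpace_nonempty (A := A)
    exact ⟨φ, hφ, by simp, by simp⟩

end Bridge

/-! ## The quantum propinquity -/

section Propinquity

variable {C D : ℝ≥0}

/-- A trek: a finite path of bridges through spaces of the class. -/
inductive Trek (C D : ℝ≥0) : QQCMS.{u} C D → QQCMS.{u} C D → Type (u + 1)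
  | single {X Y : QQCMS.{u} C D} (γ : Bridge X.carrier Y.carrier) : Trek C D X Y
  | cons {X Y Z : QQCMS.{u} C D} (γ : Bridge X.carrier Y.carrier) (t : Trek C D Y Z) :
      Trek C D X Z

namespace Trek

/-- The length of a trek: the sum of the lengths of its bridges. -/
noncomputable def length {X Y : QQCMS.{u} C D} (t : Trek C D X Y) : ℝ≥0∞ :=
  match X, Y, t with
  | X, Y, single γ => γ.length X.lip Y.lip
  | X, _, cons (Y := Y) γ t => γ.length X.lip Y.lip + t.length

/-- Concatenation of treks. -/
def append {X Y Z : QQCMS.{u} C D} (s : Trek C D X Y) (t : Trek C D Y Z) : Trek C D X Z :=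
  match s with
  | single γ => cons γ t
  | cons γ s => cons γ (s.append t)

theorem length_append {X Y Z : QQCMS.{u} C D} (s : Trek C D X Y) (t : Trek C D Y Z) :
    (s.append t).length = s.length + t.length := by
  induction s with
  | single γ => rfl
  | cons γ s ih => simp only [append, length, ih, add_assoc]

end Trek

/-- The reversed bridge. -/
def Bridge.symm {A B : Type u} [CStarAlgebra A] [CStarAlgebra B] (γ : Bridge A B) :
    Bridge B A where
  carrier := γ.carrier
  left := γ.right
  right := γ.left
  left_injective := γ.right_injective
  right_injective := γ.left_injective
  pivot := star γ.pivot
  nonempty_levelSet := by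
    obtain ⟨φ, h1, h2, h3⟩ := γ.nonempty_levelSet
    exact ⟨φ, h1, by simpa using h3, by simpa using h2⟩

theorem levelSet_star {A : Type u} [CStarAlgebra A] (ω : A) :
    levelSet (star ω) = levelSet ω := by
  ext φ
  simp only [levelSet, star_star, Set.mem_ofPred_eq]
  tauto

theorem hausdorff_comm {X Y : Type*} (d : X → Y → ℝ≥0∞) (S : Set X) (T : Set Y) :
    hausdorff (fun y x => d x y) T S = hausdorff d S T :=
  max_comm _ _

theorem Bridge.length_symm {A B : Type u} [CStarAlgebra A] [CStarAlgebra B] (γ : Bridge A B)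
    (LA : selfAdjoint A → ℝ≥0∞) (LB : selfAdjoint B → ℝ≥0∞) :
    γ.symm.length LB LA = γ.length LA LB := by
  have h : γ.symm.height LB LA = γ.height LA LB := by
    unfold Bridge.height
    rw [max_comm]
    change max (hausdorff (mongeKantorovich LA) (stateSpace A)
        (dualImage γ.left (levelSet (star γ.pivot))))
      (hausdorff (mongeKantorovich LB) (stateSpace B)
        (dualImage γ.right (levelSet (star γ.pivot)))) = _
    rw [levelSet_star]
  have r : γ.symm.reach LB LA = γ.reach LA LB := by
    unfold Bridge.reach
    rw [← hausdorff_comm]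
    congr 1
    funext a b
    change ‖γ.right (b : B) * star γ.pivot - star γ.pivot * γ.left (a : A)‖ₑ =
      ‖γ.left (a : A) * γ.pivot - γ.pivot * γ.right (b : B)‖ₑ
    have e : γ.right (b : B) * star γ.pivot - star γ.pivot * γ.left (a : A) =
        -star (γ.left (a : A) * γ.pivot - γ.pivot * γ.right (b : B)) := by
      rw [star_sub, star_mul, star_mul, ← map_star, ← map_star, a.2.star_eq, b.2.star_eq, neg_sub]
    rw [e, enorm_neg, ← ofReal_norm, norm_star, ofReal_norm]
  rw [Bridge.length, Bridge.length, h, r]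

theorem Trek.exists_reverse {X Y : QQCMS.{u} C D} (t : Trek C D X Y) :
    ∃ s : Trek C D Y X, s.length = t.length := by
  induction t with
  | single γ => exact ⟨.single γ.symm, γ.length_symm _ _⟩
  | cons γ t ih =>
    obtain ⟨s, hs⟩ := ih
    refine ⟨s.append (.single γ.symm), ?_⟩
    rw [length_append, hs]
    change _ + γ.symm.length _ _ = γ.length _ _ + _
    rw [γ.length_symm, add_comm]

/-- The quantum propinquity: the infimum of the lengths of all treks, that is, the largest
pseudo-distance on the class which is dominated by the length of every bridge. -/
noncomputable def propinquity (X Y : QQCMS.{u} C D) : ℝ≥0∞ :=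
  ⨅ t : Trek C D X Y, t.length

theorem Bridge.length_refl (A : Type u) [CStarAlgebra A] [Nontrivial A]
    (L : selfAdjoint A → ℝ≥0∞) : (Bridge.refl A).length L L = 0 := by
  have haus : ∀ {X : Type u} (d : X → X → ℝ≥0∞) (S : Set X), (∀ x, d x x = 0) →
      hausdorff d S S = 0 := by
    intro X d S hd
    simp only [hausdorff, ← bot_eq_zero, max_eq_bot, iSup_eq_bot]
    refine ⟨fun x hx => ?_, fun x hx => ?_⟩ <;>
    · refine le_bot_iff.1 ((iInf₂_le x hx).trans ?_)
      simp [hd]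
  have hmk : ∀ φ, mongeKantorovich L φ φ = 0 := by
    intro φ
    simp [mongeKantorovich]
  have hl : dualImage (Bridge.refl A).left (levelSet (Bridge.refl A).pivot) = stateSpace A := by
    ext φ
    constructor
    · rintro ⟨ψ, hψ, h⟩
      have : φ = ψ := DFunLike.ext _ _ h
      rw [this]; exact hψ.1
    · intro h
      have h1 : φ (1 - star 1 * 1) = 0 := by simp
      have h2 : φ (1 - 1 * star 1) = 0 := by simp
      exact ⟨φ, ⟨h, h1, h2⟩, fun a => rfl⟩
  have hr : dualImage (Bridge.refl A).right (levelSet (Bridge.refl A).pivot) = stateSpace A := hl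
  rw [Bridge.length, Bridge.height, Bridge.reach, hl, hr, haus _ _ hmk, haus]
  · simp
  · intro a
    change ‖(a : A) * 1 - 1 * (a : A)‖ₑ = 0
    simp

/-- The class of `(C, D)`-quasi-Leibniz quantum compact metric spaces, with the pseudo-metric
(and the topology) given by the quantum propinquity. -/
noncomputable instance : PseudoEMetricSpace (QQCMS.{u} C D) where
  edist := propinquity
  edist_self X := by
    refine le_antisymm ((iInf_le _ (.single (Bridge.refl X.carrier))).trans ?_) zero_le
    exact (Bridge.length_refl X.carrier X.lip).le
  edist_comm := by
    have key : ∀ X Y : QQCMS.{u} C D, propinquity X Y ≤ propinquity Y X := fun X Y =>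
      le_iInf fun t => by
        obtain ⟨s, hs⟩ := t.exists_reverse
        exact (iInf_le _ s).trans hs.le
    exact fun X Y => le_antisymm (key X Y) (key Y X)
  edist_triangle X Y Z := by
    refine ENNReal.le_iInf_add_iInf fun s t => ?_
    rw [← Trek.length_append]
    exact iInf_le _ _

end Propinquity

/-! ## Inductive limits of sequences of C*-algebras -/

/-- An inductive sequence of unital C*-algebras with unital injective connecting *-morphisms. -/
structure InductiveSeq : Type (u + 1) where
  obj : ℕ → Type u
  [cstar : ∀ n, CStarAlgebra (obj n)]
  map : ∀ n, obj n →⋆ₐ[ℂ] obj (n + 1)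
  map_injective : ∀ n, Function.Injective (map n)

attribute [instance] InductiveSeq.cstar

namespace InductiveSeq

open Filter

variable (I : InductiveSeq.{u})

/-- Sequences `x` with `x (n + 1) = α n (x n)` for all large `n`. -/
def coherent : StarSubalgebra ℂ (∀ n, I.obj n) where
  carrier := {x | ∀ᶠ n in atTop, x (n + 1) = I.map n (x n)}
  mul_mem' {x y} hx hy := by
    filter_upwards [hx, hy] with n h1 h2
    simp [h1, h2]
  add_mem' {x y} hx hy := by
    filter_upwards [hx, hy] with n h1 h2
    simp [h1, h2]
  algebraMap_mem' r := Eventually.of_forall fun n => by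
    simp only [Pi.algebraMap_apply]
    exact ((I.map n).toAlgHom.commutes r).symm
  star_mem' {x} hx := by
    filter_upwards [hx] with n h
    simp [h, map_star]

/-- The *-algebra of eventually coherent sequences, whose completion for the seminorm
`x ↦ lim ‖x n‖` is the inductive limit. -/
def Pre : Type u := I.coherent

namespace Pre

noncomputable instance : Ring I.Pre := inferInstanceAs (Ring I.coherent)
noncomputable instance : StarRing I.Pre := inferInstanceAs (StarRing I.coherent)
noncomputable instance : Algebra ℂ I.Pre := inferInstanceAs (Algebra ℂ I.coherent)
instance : StarModule ℂ I.Pre := inferInstanceAs (StarModule ℂ I.coherent)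

variable {I}

/-- The terms of an eventually coherent sequence. -/
def term (x : I.Pre) (n : ℕ) : I.obj n := x.1 n

@[simp] theorem term_add (x y : I.Pre) (n : ℕ) : (x + y).term n = x.term n + y.term n := rfl
@[simp] theorem term_neg (x : I.Pre) (n : ℕ) : (-x).term n = -x.term n := rfl
@[simp] theorem term_sub (x y : I.Pre) (n : ℕ) : (x - y).term n = x.term n - y.term n := rfl
@[simp] theorem term_mul (x y : I.Pre) (n : ℕ) : (x * y).term n = x.term n * y.term n := rfl
@[simp] theorem term_zero (n : ℕ) : (0 : I.Pre).term n = 0 := rfl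
@[simp] theorem term_one (n : ℕ) : (1 : I.Pre).term n = 1 := rfl
@[simp] theorem term_star (x : I.Pre) (n : ℕ) : (star x).term n = star (x.term n) := rfl
@[simp] theorem term_smul (r : ℂ) (x : I.Pre) (n : ℕ) : (r • x).term n = r • x.term n := rfl

noncomputable instance : Norm I.Pre where
  norm x := limUnder atTop fun n => ‖x.term n‖

/-- The sequence `‖x n‖` is eventually constant, equal to its limit. -/
theorem eventually_norm (x : I.Pre) : ∀ᶠ n in atTop, ‖x.term n‖ = ‖x‖ := by
  obtain ⟨N, hN⟩ := eventually_atTop.1 (show ∀ᶠ n in atTop, _ from x.2)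
  have hc : ∀ n, N ≤ n → ‖x.term n‖ = ‖x.term N‖ := by
    intro n hn
    induction n, hn using Nat.le_induction with
    | base => rfl
    | succ n hn ih =>
      rw [← ih, ← NonUnitalStarAlgHom.norm_map (I.map n) (I.map_injective n) (x.term n)]
      exact congrArg norm (hN n hn)
  have he : ∀ᶠ n in atTop, ‖x.term n‖ = ‖x.term N‖ := eventually_atTop.2 ⟨N, hc⟩
  have hl : ‖x‖ = ‖x.term N‖ := (tendsto_nhds_of_eventually_eq he).limUnder_eq
  rw [hl]
  exact he

noncomputable instance : SeminormedRing I.Pre where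
  __ := (inferInstance : Ring I.Pre)
  __ := AddGroupSeminorm.toSeminormedAddCommGroup
    { toFun := fun x : I.Pre => ‖x‖
      map_zero' := by
        obtain ⟨n, hn⟩ := (eventually_norm (0 : I.Pre)).exists
        simpa using hn.symm
      add_le' := fun x y => by
        obtain ⟨n, h1, h2, h3⟩ :=
          ((eventually_norm x).and ((eventually_norm y).and (eventually_norm (x + y)))).exists
        rw [← h1, ← h2, ← h3]
        exact norm_add_le _ _
      neg' := fun x => by
        obtain ⟨n, h1, h2⟩ := ((eventually_norm x).and (eventually_norm (-x))).exists
        rw [← h1, ← h2]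
        exact norm_neg _ }
  norm_mul_le x y := by
    obtain ⟨n, h1, h2, h3⟩ :=
      ((eventually_norm x).and ((eventually_norm y).and (eventually_norm (x * y)))).exists
    rw [← h1, ← h2, ← h3]
    exact norm_mul_le _ _

noncomputable instance : NormedAlgebra ℂ I.Pre where
  norm_smul_le r x := by
    obtain ⟨n, h1, h2⟩ := ((eventually_norm x).and (eventually_norm (r • x))).exists
    rw [← h1, ← h2]
    exact norm_smul_le r (x.term n)

theorem norm_star' (x : I.Pre) : ‖star x‖ = ‖x‖ := by
  obtain ⟨n, h1, h2⟩ := ((eventually_norm x).and (eventually_norm (star x))).exists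
  rw [← h1, ← h2]
  exact norm_star _

theorem norm_star_mul_self' (x : I.Pre) : ‖star x * x‖ = ‖x‖ * ‖x‖ := by
  obtain ⟨n, h1, h2⟩ := ((eventually_norm x).and (eventually_norm (star x * x))).exists
  rw [← h1, ← h2]
  exact CStarRing.norm_star_mul_self

theorem isometry_star : Isometry (star : I.Pre → I.Pre) :=
  AddMonoidHomClass.isometry_of_norm (starAddEquiv : I.Pre ≃+ I.Pre) norm_star'

end Pre

/-- The inductive limit of an inductive sequence of C*-algebras. -/
def Limit : Type u := UniformSpace.Completion I.Pre

namespace Limit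

noncomputable instance : NormedRing I.Limit :=
  inferInstanceAs (NormedRing (UniformSpace.Completion I.Pre))

instance : CompleteSpace I.Limit :=
  inferInstanceAs (CompleteSpace (UniformSpace.Completion I.Pre))

noncomputable instance : Algebra ℂ I.Limit :=
  inferInstanceAs (Algebra ℂ (UniformSpace.Completion I.Pre))

noncomputable instance : NormedAlgebra ℂ I.Limit where
  norm_smul_le := fun r (x : UniformSpace.Completion I.Pre) => norm_smul_le r x

variable {I}

/-- The class in the limit of an eventually coherent sequence. -/
noncomputable def of (x : I.Pre) : I.Limit := UniformSpace.Completion.coe' x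

theorem norm_of (x : I.Pre) : ‖of x‖ = ‖x‖ := UniformSpace.Completion.norm_coe x
theorem of_add (x y : I.Pre) : of (x + y) = of x + of y := UniformSpace.Completion.coe_add x y
theorem of_sub (x y : I.Pre) : of (x - y) = of x - of y := UniformSpace.Completion.coe_sub x y
theorem of_mul (x y : I.Pre) : of (x * y) = of x * of y := UniformSpace.Completion.coe_mul x y
theorem of_zero : of (0 : I.Pre) = 0 := rfl
theorem of_one : of (1 : I.Pre) = 1 := rfl
theorem of_smul (r : ℂ) (x : I.Pre) : of (r • x) = r • of x :=
  UniformSpace.Completion.coe_smul r x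
theorem continuous_of : Continuous (of : I.Pre → I.Limit) :=
  UniformSpace.Completion.continuous_coe _
theorem denseRange_of : DenseRange (of : I.Pre → I.Limit) :=
  UniformSpace.Completion.denseRange_coe

/-- Sequences with eventually equal terms have the same class. -/
theorem of_eq_of {x y : I.Pre} (h : ∀ᶠ n in atTop, x.term n = y.term n) : of x = of y := by
  rw [← sub_eq_zero, ← of_sub, ← norm_eq_zero, norm_of]
  obtain ⟨n, h1, h2⟩ := (h.and (Pre.eventually_norm (x - y))).exists
  rw [← h2]
  simp [h1]

noncomputable instance : Star I.Limit where
  star := UniformSpace.Completion.map (star : I.Pre → I.Pre)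

theorem star_of (x : I.Pre) : star (of x) = of (star x) :=
  UniformSpace.Completion.map_coe Pre.isometry_star.uniformContinuous x

theorem continuous_star' : Continuous (star : I.Limit → I.Limit) :=
  UniformSpace.Completion.continuous_map

noncomputable instance : StarRing I.Limit where
  star_involutive x := by
    refine denseRange_of.induction_on (p := fun x => star (star x) = x) x
      (isClosed_eq (continuous_star'.comp continuous_star') continuous_id) fun a => ?_
    rw [star_of, star_of, star_star]
  star_mul x y := by
    refine denseRange_of.induction_on₂ (p := fun x y => star (x * y) = star y * star x)
      (isClosed_eq (continuous_star'.comp continuous_mul)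
        ((continuous_star'.comp continuous_snd).mul (continuous_star'.comp continuous_fst)))
      (fun a b => ?_) x y
    rw [← of_mul, star_of, star_of, star_of, star_mul, of_mul]
  star_add x y := by
    refine denseRange_of.induction_on₂ (p := fun x y => star (x + y) = star x + star y)
      (isClosed_eq (continuous_star'.comp continuous_add)
        ((continuous_star'.comp continuous_fst).add (continuous_star'.comp continuous_snd)))
      (fun a b => ?_) x y
    rw [← of_add, star_of, star_of, star_of, star_add, of_add]

instance : StarModule ℂ I.Limit where
  star_smul r x := by
    refine denseRange_of.induction_on (p := fun x => star (r • x) = star r • star x) x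
      (isClosed_eq (continuous_star'.comp (continuous_const_smul r))
        (continuous_star'.const_smul (star r))) fun a => ?_
    rw [← of_smul, star_of, star_of, star_smul, of_smul]

instance : CStarRing I.Limit where
  norm_mul_self_le x := by
    refine denseRange_of.induction_on (p := fun x => ‖x‖ * ‖x‖ ≤ ‖star x * x‖) x
      (isClosed_le (continuous_norm.mul continuous_norm)
        (continuous_norm.comp (continuous_star'.mul continuous_id))) fun a => ?_
    rw [star_of, ← of_mul, norm_of, norm_of, Pre.norm_star_mul_self']

noncomputable instance : CStarAlgebra I.Limit where

end Limit

/-- The connecting maps `α (m - 1) ∘ ⋯ ∘ α n`. -/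
def trans {n m : ℕ} (h : n ≤ m) : I.obj n →⋆ₐ[ℂ] I.obj m :=
  Nat.leRecOn (C := fun m => I.obj n →⋆ₐ[ℂ] I.obj m) h (fun {m} f => (I.map m).comp f)
    (StarAlgHom.id ℂ (I.obj n))

theorem trans_succ {n m : ℕ} (h : n ≤ m) (a : I.obj n) :
    I.trans (h.trans m.le_succ) a = I.map m (I.trans h a) := by
  unfold trans
  rw [Nat.leRecOn_succ h]
  rfl

/-- The coherent sequence `(0, …, 0, a, α n a, α (n + 1) (α n a), …)`. -/
def seqOf (n : ℕ) (a : I.obj n) : I.Pre :=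
  ⟨fun m => if h : n ≤ m then I.trans h a else 0, by
    refine eventually_atTop.2 ⟨n, fun m hm => ?_⟩
    simp only [hm, hm.trans m.le_succ, dif_pos]
    exact I.trans_succ hm a⟩

theorem seqOf_term {n m : ℕ} (h : n ≤ m) (a : I.obj n) :
    (I.seqOf n a).term m = I.trans h a :=
  dif_pos h

/-- The canonical *-morphism from the `n`-th algebra to the inductive limit. -/
noncomputable def ι (n : ℕ) : I.obj n →⋆ₐ[ℂ] I.Limit where
  toFun a := Limit.of (I.seqOf n a)
  map_one' := by
    rw [← Limit.of_one]
    refine Limit.of_eq_of (eventually_atTop.2 ⟨n, fun m hm => ?_⟩)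
    simp [I.seqOf_term hm]
  map_mul' a b := by
    rw [← Limit.of_mul]
    refine Limit.of_eq_of (eventually_atTop.2 ⟨n, fun m hm => ?_⟩)
    simp [I.seqOf_term hm]
  map_zero' := by
    rw [← Limit.of_zero]
    refine Limit.of_eq_of (eventually_atTop.2 ⟨n, fun m hm => ?_⟩)
    simp [I.seqOf_term hm]
  map_add' a b := by
    rw [← Limit.of_add]
    refine Limit.of_eq_of (eventually_atTop.2 ⟨n, fun m hm => ?_⟩)
    simp [I.seqOf_term hm]
  commutes' r := by
    rw [Algebra.algebraMap_eq_smul_one, Algebra.algebraMap_eq_smul_one, ← Limit.of_one,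
      ← Limit.of_smul]
    refine Limit.of_eq_of (eventually_atTop.2 ⟨n, fun m hm => ?_⟩)
    simp [I.seqOf_term hm]
  map_star' a := by
    rw [Limit.star_of]
    refine Limit.of_eq_of (eventually_atTop.2 ⟨n, fun m hm => ?_⟩)
    simp [I.seqOf_term hm, map_star]

theorem obj_nontrivial [Nontrivial (I.obj 0)] : ∀ n, Nontrivial (I.obj n)
  | 0 => inferInstance
  | n + 1 =>
    have := obj_nontrivial n
    (I.map_injective n).nontrivial

instance [Nontrivial (I.obj 0)] : Nontrivial I.Limit := by
  refine ⟨⟨Limit.of 1, Limit.of 0, fun h => ?_⟩⟩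
  have h1 : ‖(1 : I.Pre)‖ = 0 := by
    rw [← Limit.norm_of, h, Limit.of_zero, norm_zero]
  obtain ⟨n, hn⟩ := (Pre.eventually_norm (1 : I.Pre)).exists
  have := I.obj_nontrivial n
  rw [h1, Pre.term_one, norm_eq_zero] at hn
  exact one_ne_zero hn

/-- The conditional expectation onto the image of the `n`-th algebra which preserves `μ`. -/
noncomputable def expect (μ : WeakDual ℂ I.Limit) (n : ℕ) : I.Limit →L[ℂ] I.Limit :=
  condExp μ (I.ι n).range

/-- The Lip-norm `sup_n ‖a - E_n a‖ / β n` of an inductive sequence, a faithful tracial state `μ`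
of its limit and a null sequence `β` of positive numbers. -/
noncomputable def lipNorm (μ : WeakDual ℂ I.Limit) (β : ℕ → ℝ) (a : selfAdjoint I.Limit) : ℝ≥0∞ :=
  ⨆ n, ENNReal.ofReal (‖(a : I.Limit) - I.expect μ n a‖ / β n)

/-- The sequence `1 / dim(A_n) ^ k`. -/
noncomputable def dimSeq (k : ℝ) (n : ℕ) : ℝ :=
  1 / (Module.finrank ℂ (I.obj n) : ℝ) ^ k

end InductiveSeq

end QuantumMetric

/-! ## The Effros-Shen algebras -/

namespace EffrosShen

open QuantumMetric

/-- The coefficients `r_0, r_1, …` of the continued fraction expansion of `θ` (completed by zeros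
when the expansion terminates). -/
noncomputable def coeff (θ : ℝ) : ℕ → ℕ
  | 0 => ⌊θ⌋₊
  | n + 1 => ⌊((GenContFract.of θ).partDens.get? n).getD 0⌋₊

/-- The denominators of the convergents of the continued fraction expansion of `θ`. -/
noncomputable def q (θ : ℝ) : ℕ → ℕ
  | 0 => 1
  | 1 => coeff θ 1
  | n + 2 => coeff θ (n + 2) * q θ (n + 1) + q θ n

/-- The C*-algebra of `n × n` complex matrices, with the operator norm. -/
abbrev Mat (n : ℕ) : Type := CStarMatrix (Fin n) (Fin n) ℂ

/-- The algebras `ℂ` and `M(q_n) ⊕ M(q_{n-1})` for `n ≥ 1`. -/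
def obj (θ : ℝ) : ℕ → Type
  | 0 => ℂ
  | n + 1 => Mat (q θ (n + 1)) × Mat (q θ n)

noncomputable instance (θ : ℝ) : ∀ n, CStarAlgebra (obj θ n)
  | 0 => inferInstanceAs (CStarAlgebra ℂ)
  | n + 1 => inferInstanceAs (CStarAlgebra (Mat (q θ (n + 1)) × Mat (q θ n)))

/-- The indices of the blocks of a matrix with `r` diagonal blocks of size `m` followed by one of
size `n`, in this order. -/
def blockEquiv {r m n N : ℕ} (h : N = r * m + n) : (Fin r × Fin m) ⊕ Fin n ≃ Fin N :=
  ((Equiv.sumCongr finProdFinEquiv (Equiv.refl _)).trans finSumFinEquiv).trans (finCongr h.symm)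

/-- The block diagonal matrix `diag(a, …, a, b)`, with `r` copies of `a`. -/
def blockDiag {r m n N : ℕ} (h : N = r * m + n) (a : Matrix (Fin m) (Fin m) ℂ)
    (b : Matrix (Fin n) (Fin n) ℂ) : Matrix (Fin N) (Fin N) ℂ :=
  Matrix.reindex (blockEquiv h) (blockEquiv h)
    (Matrix.fromBlocks (Matrix.kronecker (1 : Matrix (Fin r) (Fin r) ℂ) a) 0 0 b)

section BlockDiag

variable {r m n N : ℕ} (h : N = r * m + n)

theorem blockDiag_one : blockDiag h 1 1 = 1 := by
  simp [blockDiag, Matrix.kronecker]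

theorem blockDiag_zero : blockDiag h 0 0 = 0 := by
  simp [blockDiag, Matrix.kronecker]

theorem blockDiag_add (a a' : Matrix (Fin m) (Fin m) ℂ) (b b' : Matrix (Fin n) (Fin n) ℂ) :
    blockDiag h (a + a') (b + b') = blockDiag h a b + blockDiag h a' b' := by
  ext i j
  obtain ⟨i, rfl⟩ := (blockEquiv h).surjective i
  obtain ⟨j, rfl⟩ := (blockEquiv h).surjective j
  rcases i with i | i <;> rcases j with j | j <;>
    simp [blockDiag, Matrix.kronecker, mul_add]

theorem blockDiag_mul (a a' : Matrix (Fin m) (Fin m) ℂ) (b b' : Matrix (Fin n) (Fin n) ℂ) :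
    blockDiag h (a * a') (b * b') = blockDiag h a b * blockDiag h a' b' := by
  have e : Matrix.kronecker (1 : Matrix (Fin r) (Fin r) ℂ) (a * a') =
      Matrix.kronecker (1 : Matrix (Fin r) (Fin r) ℂ) a *
        Matrix.kronecker (1 : Matrix (Fin r) (Fin r) ℂ) a' := by
    have := Matrix.mul_kronecker_mul (1 : Matrix (Fin r) (Fin r) ℂ)
      (1 : Matrix (Fin r) (Fin r) ℂ) a a'
    rwa [one_mul] at this
  simp only [blockDiag, Matrix.reindex_apply, Matrix.submatrix_mul_equiv,
    Matrix.fromBlocks_multiply, e]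
  simp

theorem blockDiag_smul (c : ℂ) (a : Matrix (Fin m) (Fin m) ℂ) (b : Matrix (Fin n) (Fin n) ℂ) :
    blockDiag h (c • a) (c • b) = c • blockDiag h a b := by
  ext i j
  obtain ⟨i, rfl⟩ := (blockEquiv h).surjective i
  obtain ⟨j, rfl⟩ := (blockEquiv h).surjective j
  rcases i with i | i <;> rcases j with j | j <;>
    simp [blockDiag, Matrix.kronecker, mul_left_comm]

theorem blockDiag_conjTranspose (a : Matrix (Fin m) (Fin m) ℂ) (b : Matrix (Fin n) (Fin n) ℂ) :
    blockDiag h a.conjTranspose b.conjTranspose = (blockDiag h a b).conjTranspose := by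
  ext i j
  obtain ⟨i, rfl⟩ := (blockEquiv h).surjective i
  obtain ⟨j, rfl⟩ := (blockEquiv h).surjective j
  rcases i with i | i <;> rcases j with j | j <;>
    simp only [blockDiag, Matrix.kronecker, Matrix.reindex_apply, Matrix.submatrix_apply,
      Matrix.conjTranspose_apply, Equiv.symm_apply_apply, Matrix.fromBlocks_apply₁₁,
      Matrix.fromBlocks_apply₁₂, Matrix.fromBlocks_apply₂₁, Matrix.fromBlocks_apply₂₂,
      Matrix.kroneckerMap_apply, Matrix.zero_apply, star_zero, Matrix.one_apply]
  by_cases hij : i.1 = j.1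
  · simp [hij]
  · simp [hij, Ne.symm hij]

end BlockDiag

/-- The unital *-morphism `a ⊕ b ↦ diag(a, …, a, b) ⊕ a`, with `r` copies of `a`. -/
noncomputable def embed {r m n N : ℕ} (h : N = r * m + n) :
    Mat m × Mat n →⋆ₐ[ℂ] Mat N × Mat m where
  toFun x := (CStarMatrix.ofMatrix
    (blockDiag h (CStarMatrix.ofMatrix.symm x.1) (CStarMatrix.ofMatrix.symm x.2)), x.1)
  map_one' := Prod.ext (blockDiag_one h) rfl
  map_mul' x y := Prod.ext (blockDiag_mul h x.1 y.1 x.2 y.2) rfl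
  map_zero' := Prod.ext (blockDiag_zero h) rfl
  map_add' x y := Prod.ext (blockDiag_add h x.1 y.1 x.2 y.2) rfl
  commutes' c := by
    rw [Algebra.algebraMap_eq_smul_one, Algebra.algebraMap_eq_smul_one]
    refine Prod.ext ((blockDiag_smul h c 1 1).trans ?_) rfl
    rw [blockDiag_one]
    rfl
  map_star' x := Prod.ext (blockDiag_conjTranspose h x.1 x.2) rfl

/-- The connecting maps of the Effros-Shen sequence. -/
noncomputable def map (θ : ℝ) : ∀ n, obj θ n →⋆ₐ[ℂ] obj θ (n + 1)
  | 0 => StarAlgHom.ofId ℂ (obj θ 1)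
  | n + 1 => embed (r := coeff θ (n + 2)) (m := q θ (n + 1)) (n := q θ n) (N := q θ (n + 2)) rfl

theorem blockDiag_injective_right {r m n N : ℕ} (h : N = r * m + n)
    {a : Matrix (Fin m) (Fin m) ℂ} {b b' : Matrix (Fin n) (Fin n) ℂ}
    (hb : blockDiag h a b = blockDiag h a b') : b = b' := by
  have := (Matrix.reindex (blockEquiv h) (blockEquiv h)).injective hb
  exact (Matrix.fromBlocks_inj.1 this).2.2.2

theorem map_injective (θ : ℝ) : ∀ n, Function.Injective (map θ n)
  | 0 => by
    have : Nontrivial (obj θ 1) := by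
      have : Nontrivial (Mat (q θ 0)) :=
        inferInstanceAs (Nontrivial (CStarMatrix (Fin 1) (Fin 1) ℂ))
      exact inferInstanceAs (Nontrivial (Mat (q θ 1) × Mat (q θ 0)))
    exact (algebraMap ℂ (obj θ 1)).injective
  | n + 1 => by
    rintro ⟨a, b⟩ ⟨a', b'⟩ hab
    obtain rfl : a = a' := congrArg Prod.snd hab
    exact Prod.ext rfl (blockDiag_injective_right (r := coeff θ (n + 2)) (m := q θ (n + 1))
      (n := q θ n) (N := q θ (n + 2)) rfl (a := a) (congrArg Prod.fst hab))

/-- The inductive sequence of the Effros-Shen algebra. -/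
noncomputable def seq (θ : ℝ) : InductiveSeq.{0} where
  obj := obj θ
  map := map θ
  map_injective := map_injective θ

/-- The Effros-Shen algebra `AF_θ`. -/
abbrev AF (θ : ℝ) : Type := (seq θ).Limit

instance (θ : ℝ) : Nontrivial ((seq θ).obj 0) := inferInstanceAs (Nontrivial ℂ)

/-- The tracial state `σ_θ` of `AF_θ` (meaningful when there is exactly one). -/
noncomputable def trace (θ : ℝ) : WeakDual ℂ (AF θ) :=
  Classical.epsilon IsTracialState

/-- The Lip-norm `L_θ^k` of `AF_θ`. -/
noncomputable def lip (k : ℝ) (θ : ℝ) : selfAdjoint (AF θ) → ℝ≥0∞ :=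
  (seq θ).lipNorm (trace θ) ((seq θ).dimSeq k)

/-- The irrational numbers in `(0, 1)`. -/
def irrationals : Set ℝ := {θ | 0 < θ ∧ θ < 1 ∧ Irrational θ}

/-- The quantum compact metric space `(AF_θ, L_θ^k)`. -/
noncomputable def space (k θ : ℝ) (h : IsLipNorm 2 0 (lip k θ)) : QQCMS.{0} 2 0 where
  carrier := AF θ
  lip := lip k θ
  isLipNorm := h

end EffrosShen

/-! A tracial state on `AF θ` is determined by its values on minimal projections of the matrix
summands. The connecting maps turn these values into a sequence with `c n = r_{n+1} c (n+1) + c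
(n+2)` and `c 0 = 1`. The difference of two such sequences is a multiple of its first term by
alternating factors of absolute value at least `1`, while positivity and normalization bound it by
`1 / q`. It therefore vanishes, and the only solution is `weight θ` (`eq_weight`, `tracialState_ι`).
The weights are positive, being products of iterates of the Gauss map, so the compatible traces
extend to one state that is faithful on every level (`existsUnique_isTracialState`).

A trace that is faithful on a finite dimensional subalgebra identifies it with its dual. The
expectation of `a` is the element that represents `x ↦ τ (a x)` (`exists_isExpectation`); it is
unique, and faithfulness on the levels passes to the limit.

For the Lip-norm, `1 - E n` has norm at most `2` and kills `E n a * E n b`, which gives the Leibniz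
constant `2`. Modulo scalars, the unit ball lies uniformly within `β n` of a bounded set in a finite
dimensional space, so the Monge-Kantorovich metric induces the weak* topology
(`IsExpectationSeq.isLipNorm`).

For continuity, finitely many partial quotients are locally constant at an irrational `θ₀`. For `θ`
near `θ₀` the two sequences thus share their first algebras and connecting maps, and only the
weights differ, by little. Expectations depend continuously on the trace
(`norm_sub_le_of_trace_mul`). Hence the bridge with pivot `1` from `AF θ` to the last common
algebra, carrying the Lip-norm of `θ₀`, is short: its height is `0` because states extend through
the expectation, and its reach is at most the tail `β N` plus an error that vanishes with the
difference of the traces (`Bridge.length_ofInjective_le`). The same finite dimensional space serves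
`θ` and `θ₀`, and the triangle inequality concludes. -/

namespace QuantumMetric

/-! ### Positivity and states in C*-algebras -/

section StateLemmas

variable {A : Type*} [CStarAlgebra A]

theorem exists_norm_sq_sub_star_mul_self (a : A) :
    ∃ b : A, ((‖a‖ : ℂ) ^ 2) • (1 : A) - star a * a = star b * b := by
  let _ := CStarAlgebra.spectralOrder A
  have _ := CStarAlgebra.spectralOrderedRing A
  rw [← CStarAlgebra.nonneg_iff_eq_star_mul_self, sub_nonneg]
  have h := (IsSelfAdjoint.star_mul_self a).le_algebraMap_norm_self
  rw [CStarRing.norm_star_mul_self, Algebra.algebraMap_eq_smul_one, ← Complex.coe_smul] at h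
  simpa [sq] using h

theorem norm_le_of_star_mul_self_add {x a c : A} {r : ℝ} (hr : 0 ≤ r)
    (h : star x * x + star a * a + star c * c = ((r : ℂ) ^ 2) • (1 : A)) : ‖x‖ ≤ r := by
  let _ := CStarAlgebra.spectralOrder A
  have _ := CStarAlgebra.spectralOrderedRing A
  have h1 : star x * x ≤ ((r : ℂ) ^ 2) • (1 : A) := by
    rw [← h, add_assoc]
    exact le_add_of_nonneg_right (add_nonneg (star_mul_self_nonneg a) (star_mul_self_nonneg c))
  have h2 := CStarAlgebra.norm_le_norm_of_nonneg_of_le (star_mul_self_nonneg x) h1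
  rw [CStarRing.norm_star_mul_self, norm_smul] at h2
  have h3 : ‖(1 : A)‖ ≤ 1 := by
    rcases subsingleton_or_nontrivial A with hA | hA
    · rw [Subsingleton.elim (1 : A) 0, norm_zero]; exact zero_le_one
    · exact (CStarRing.norm_one (E := A)).le
  have h4 : ‖(r : ℂ) ^ 2‖ = r ^ 2 := by simp
  rw [h4] at h2
  refine abs_le_of_sq_le_sq' ?_ hr |>.2
  nlinarith [sq_nonneg r]

/-- Apply the hypothesis to the square root `b` of the negative part of `x`, for which `x b² = -b⁴`.
In this form positivity can be tested with a faithful trace, without further functional calculus. -/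
theorem eq_star_mul_self_of_forall {x : A} (hx : IsSelfAdjoint x)
    (h : ∀ b : A, IsSelfAdjoint b → x * (star b * b) = -(b * b * star (b * b)) → b * b = 0) :
    ∃ y : A, x = star y * y := by
  let _ := CStarAlgebra.spectralOrder A
  have _ := CStarAlgebra.spectralOrderedRing A
  rw [← CStarAlgebra.nonneg_iff_eq_star_mul_self, ← CFC.negPart_eq_zero_iff x]
  have hn : 0 ≤ x⁻ := CFC.negPart_nonneg x
  set b := CFC.sqrt (x⁻)
  have hbb : b * b = x⁻ := CFC.sqrt_mul_sqrt_self (x⁻)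
  have hbs : IsSelfAdjoint b := (CFC.sqrt_nonneg (x⁻)).isSelfAdjoint
  rw [← hbb]
  refine h b hbs ?_
  rw [hbs.star_eq, hbb, hn.isSelfAdjoint.star_eq]
  nth_rw 1 [← CFC.posPart_sub_negPart x hx]
  rw [sub_mul, CFC.posPart_mul_negPart, zero_sub]

variable {φ : WeakDual ℂ A}

/-- Polarization: positivity at `a`, `a + 1` and `i a + 1` makes `φ (star a) + φ a` and `i (φ a - φ
(star a))` real. -/
theorem stateSpace.map_star (hφ : φ ∈ stateSpace A) (a : A) : φ (star a) = star (φ a) := by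
  have h1 := hφ.2 (a + 1)
  have h2 := hφ.2 (Complex.I • a + 1)
  have h0 := hφ.2 a
  have e1 : star (a + 1) * (a + 1) = star a * a + star a + a + 1 := by
    simp [add_mul, mul_add]; abel
  have e2 : star (Complex.I • a + 1) * (Complex.I • a + 1) =
      star a * a - Complex.I • star a + Complex.I • a + 1 := by
    simp [add_mul, mul_add, smul_smul]; abel
  rw [e1] at h1
  rw [e2] at h2
  simp only [map_add, map_sub, map_smul, hφ.1, smul_eq_mul] at h1 h2
  rw [Complex.nonneg_iff] at h0 h1 h2
  have i0 := h0.2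
  have i1 := h1.2
  have i2 := h2.2
  simp at i0 i1 i2
  refine Complex.ext ?_ ?_
  · simp; linarith
  · simp; linarith

/-- The variance `φ (|a - φ a|²)` is nonnegative, so `|φ a|² ≤ φ (a* a) ≤ ‖a‖²`. -/
theorem stateSpace.norm_le (hφ : φ ∈ stateSpace A) (a : A) : ‖φ a‖ ≤ ‖a‖ := by
  have h1 := hφ.2 (a - (φ a) • 1)
  have e1 : star (a - (φ a) • 1) * (a - (φ a) • 1) = star a * a - (φ a) • star a -
      star (φ a) • a + (φ a * star (φ a)) • (1 : A) := by
    simp [sub_mul, mul_sub, smul_sub, smul_smul]; abel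
  rw [e1] at h1
  obtain ⟨b, hb⟩ := exists_norm_sq_sub_star_mul_self a
  have h2 := hφ.2 b
  rw [← hb] at h2
  simp only [map_add, map_sub, map_smul, hφ.1, smul_eq_mul, stateSpace.map_star hφ] at h1 h2
  have h3 := add_nonneg h1 h2
  have e3 : φ (star a * a) - φ a * star (φ a) - star (φ a) * φ a + φ a * star (φ a) * 1 +
      ((‖a‖ : ℂ) ^ 2 * 1 - φ (star a * a)) = ((‖a‖ ^ 2 - ‖φ a‖ ^ 2 : ℝ) : ℂ) := by
    have := Complex.mul_conj' (φ a)
    rw [← starRingEnd_apply]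
    push_cast
    linear_combination -this
  rw [e3] at h3
  have h4 : 0 ≤ ‖a‖ ^ 2 - ‖φ a‖ ^ 2 := by exact_mod_cast h3
  exact (abs_le_of_sq_le_sq' (by linarith) (norm_nonneg a)).2

end StateLemmas

/-! ## Conditional expectations onto finite dimensional algebras -/

section Expectation

variable {A F : Type*} [CStarAlgebra A] [CStarAlgebra F]

/-- A *-homomorphism of C*-algebras as a continuous linear map. -/
noncomputable def homCLM (ι : F →⋆ₐ[ℂ] A) : F →L[ℂ] A :=
  ι.toAlgHom.toLinearMap.mkContinuous 1 fun x => by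
    rw [one_mul]; exact NonUnitalStarAlgHom.norm_apply_le ι x

@[simp] theorem homCLM_apply (ι : F →⋆ₐ[ℂ] A) (x : F) : homCLM ι x = ι x := rfl

/-- `P` is, up to the identification of `F` with its image, a conditional expectation of `A` onto
`F` which preserves `τ`. -/
structure IsExpectation (τ : WeakDual ℂ A) (ι : F →⋆ₐ[ℂ] A) (P : A →L[ℂ] F) : Prop where
  left_inv : ∀ x, P (ι x) = x
  bimodule : ∀ x a y, P (ι x * a * ι y) = x * P a * y
  pos : ∀ a, ∃ b, P (star a * a) = star b * b
  norm_le : ∀ a, ‖P a‖ ≤ ‖a‖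
  preserving : ∀ a, τ (ι (P a)) = τ a

variable {τ : WeakDual ℂ A} {ι : F →⋆ₐ[ℂ] A}

/-- Nondegeneracy of the trace pairing, by testing against `z = star (x - y)`. Identities between
expectations are later proved by pairing both sides with an arbitrary `z`. -/
theorem eq_of_trace_mul_eq (hf : ∀ x : F, τ (ι (star x * x)) = 0 → x = 0) {x y : F}
    (h : ∀ z, τ (ι (x * z)) = τ (ι (y * z))) : x = y := by
  have h1 := h (star (x - y))
  rw [← sub_eq_zero, ← map_sub, ← map_sub, ← sub_mul] at h1
  have := hf (star (x - y)) (by rwa [star_star])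
  rwa [star_eq_zero, sub_eq_zero] at this

/-- The trace pairing embeds `F` in its dual, and equality of dimensions makes this a bijection. `Q
a` is the preimage of `x ↦ τ (a ι x)`; its algebraic properties follow from uniqueness of the
representing element and traciality. -/
theorem exists_isExpectation [FiniteDimensional ℂ F] (hτ : IsTracialState τ)
    (hf : ∀ x : F, τ (ι (star x * x)) = 0 → x = 0) :
    ∃ P : A →L[ℂ] F, IsExpectation τ ι P := by
  let j : F →ₗ[ℂ] A := ι.toAlgHom.toLinearMap
  let t : A →ₗ[ℂ] ℂ := (τ : A →L[ℂ] ℂ).toLinearMap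
  let B : F →ₗ[ℂ] Module.Dual ℂ F := (LinearMap.mul ℂ F).compr₂ (t ∘ₗ j)
  let S : A →ₗ[ℂ] Module.Dual ℂ F := ((LinearMap.mul ℂ A).compr₂ t).compl₂ j
  have hB : Function.Injective B := fun x y hxy =>
    eq_of_trace_mul_eq hf fun z => LinearMap.congr_fun hxy z
  let e : F ≃ₗ[ℂ] Module.Dual ℂ F := B.linearEquivOfInjective hB Subspace.dual_finrank_eq.symm
  let Q : A →ₗ[ℂ] F := e.symm.toLinearMap ∘ₗ S
  have hQ : ∀ a x, τ (ι (Q a * x)) = τ (a * ι x) := fun a x => by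
    have : B (Q a) = S a := e.apply_symm_apply (S a)
    exact LinearMap.congr_fun this x
  have left_inv : ∀ x, Q (ι x) = x := fun x => eq_of_trace_mul_eq hf fun z => by
    rw [hQ, map_mul ι]
  have bimodule : ∀ x a y, Q (ι x * a * ι y) = x * Q a * y := fun x a y =>
    eq_of_trace_mul_eq hf fun z => by
      rw [hQ, mul_assoc, mul_assoc, hτ.2, mul_assoc, mul_assoc, ← map_mul, ← map_mul, ← hQ,
        mul_assoc x, mul_assoc x, map_mul ι x, hτ.2, ← map_mul]
      simp only [mul_assoc]
  have self_adj : ∀ a, Q (star a) = star (Q a) := fun a => eq_of_trace_mul_eq hf fun z => by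
    have h1 : star (Q a) * z = star (star z * Q a) := by simp
    have h2 : star a * ι z = star (ι (star z) * a) := by simp [← map_star]
    rw [hQ, h1, h2, stateSpace.map_star hτ.1, StarHomClass.map_star ι (star z * Q a), stateSpace.map_star hτ.1, map_mul ι,
      hτ.2, hτ.2 _ (ι (Q a)), ← map_mul ι, hQ]
  -- For `b` as in `eq_star_mul_self_of_forall`, the trace of `Q (a* a) b* b` is that of `a* a ι (b*
  -- b)`, hence nonnegative, and it is also minus the trace of a positive element. Both vanish, and
  -- faithfulness applies.
  have pos : ∀ a, ∃ b, Q (star a * a) = star b * b := fun a => by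
    refine eq_star_mul_self_of_forall ?_ fun b hb h => ?_
    · rw [IsSelfAdjoint, ← self_adj, star_mul, star_star]
    · have h1 := hQ (star a * a) (star b * b)
      have h2 : 0 ≤ τ (star a * a * ι (star b * b)) := by
        have := hτ.1.2 (a * ι (star b))
        rw [star_mul, ← map_star ι, star_star, mul_assoc, hτ.2] at this
        simpa only [map_mul, mul_assoc] using this
      rw [← h1, h, map_neg, map_neg] at h2
      have h3 := hτ.1.2 (ι (star (b * b)))
      rw [← map_star, star_star, ← map_mul] at h3
      have h4 : τ (ι (b * b * star (b * b))) = 0 := le_antisymm (by simpa using h2) h3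
      have := hf (star (b * b)) (by rwa [star_star])
      rwa [star_eq_zero] at this
  have hone : Q 1 = 1 := by simpa using left_inv 1
  have norm_le : ∀ a, ‖Q a‖ ≤ ‖a‖ := fun a => by
    obtain ⟨c, hc⟩ := exists_norm_sq_sub_star_mul_self a
    obtain ⟨c', hc'⟩ := pos c
    obtain ⟨d, hd⟩ := pos (a - ι (Q a))
    -- Kadison-Schwarz: `d* d = Q (a* a) - (Q a)* Q a` and `c'* c' = ‖a‖² - Q (a* a)`.
    refine norm_le_of_star_mul_self_add (a := d) (c := c') (norm_nonneg a) ?_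
    have e1 : star (a - ι (Q a)) * (a - ι (Q a)) = star a * a - ι 1 * star a * ι (Q a) -
        ι (star (Q a)) * a * ι 1 + ι (star (Q a) * Q a) := by
      simp [sub_mul, mul_sub, ← map_star]; abel
    rw [e1, map_add, map_sub, map_sub, bimodule, bimodule, left_inv, self_adj] at hd
    rw [← hc, map_sub, map_smul, hone] at hc'
    rw [← hd, ← hc']
    simp
  refine ⟨Q.mkContinuous 1 fun a => by simpa using norm_le a, left_inv, bimodule, pos, norm_le,
    fun a => ?_⟩
  have := hQ a 1
  simpa using this

namespace IsExpectation

variable {P : A →L[ℂ] F}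

theorem map_mul_right (hP : IsExpectation τ ι P) (a : A) (x : F) : P (a * ι x) = P a * x := by
  simpa using hP.bimodule 1 a x

theorem map_one (hP : IsExpectation τ ι P) : P 1 = 1 := by
  simpa using hP.left_inv 1

theorem trace_mul (hP : IsExpectation τ ι P) (a : A) (x : F) :
    τ (ι (P a * x)) = τ (a * ι x) := by
  rw [← hP.map_mul_right, hP.preserving]

theorem map_star (hP : IsExpectation τ ι P) (a : A) : P (star a) = star (P a) := by
  obtain ⟨b0, h0⟩ := hP.pos a
  obtain ⟨b1, h1⟩ := hP.pos (a + 1)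
  obtain ⟨b2, h2⟩ := hP.pos (Complex.I • a + 1)
  have e1 : star (a + 1) * (a + 1) = star a * a + star a + a + 1 := by
    simp [add_mul, mul_add]; abel
  have e2 : star (Complex.I • a + 1) * (Complex.I • a + 1) =
      star a * a - Complex.I • star a + Complex.I • a + 1 := by
    simp [add_mul, mul_add, smul_smul]; abel
  rw [e1] at h1
  rw [e2] at h2
  simp only [map_add, map_sub, map_smul, hP.map_one, h0] at h1 h2
  have s1 : star (P (star a)) + star (P a) = P (star a) + P a := by
    have := congrArg star h1
    rw [star_mul, star_star, ← h1] at this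
    simp only [star_add, star_mul, star_star, star_one] at this
    exact add_left_cancel (add_right_cancel (by simpa only [add_assoc] using this))
  have s2 : star (P (star a)) - star (P a) = P a - P (star a) := by
    have := congrArg star h2
    rw [star_mul, star_star, ← h2] at this
    simp only [star_add, star_sub, star_mul, star_star, star_one, star_smul] at this
    have h3 : Complex.I • (star (P (star a)) - star (P a)) =
        Complex.I • (P a - P (star a)) := by
      have h4 := add_right_cancel this
      simp only [Complex.star_def, Complex.conj_I, neg_smul, sub_neg_eq_add] at h4
      rw [smul_sub, smul_sub]
      rw [← sub_eq_zero] at h4 ⊢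
      rw [← h4]; abel
    exact smul_right_injective _ Complex.I_ne_zero h3
  have h5 : (2 : ℂ) • P (star a) = (2 : ℂ) • star (P a) := by
    rw [two_smul, two_smul, ← sub_eq_zero]
    rw [← sub_eq_zero] at s1 s2
    have := congrArg₂ (· - ·) s2 s1
    simp only [sub_zero] at this
    rw [← neg_eq_zero, ← neg_eq_zero, ← this]; abel
  exact smul_right_injective _ two_ne_zero h5

theorem isPreservingCondExp [Nontrivial F] (hP : IsExpectation τ ι P)
    {E : A →L[ℂ] A} (hE : ∀ a, E a = ι (P a)) : IsPreservingCondExp τ ι.range E := by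
  refine ⟨⟨?_, ?_, fun a => ?_, ?_⟩, fun a => by rw [hE, hP.preserving]⟩
  · ext a
    constructor
    · rintro ⟨b, rfl⟩
      exact ⟨P b, (hE b).symm⟩
    · rintro ⟨x, rfl⟩
      exact ⟨ι x, by rw [hE, hP.left_inv]; rfl⟩
  · refine le_antisymm (E.opNorm_le_bound zero_le_one fun a => ?_) ?_
    · rw [hE, one_mul]
      exact (NonUnitalStarAlgHom.norm_apply_le ι _).trans (hP.norm_le a)
    · have : Nontrivial A := ⟨⟨1, 0, fun h => one_ne_zero (α := F) (by
        rw [← hP.map_one, h, _root_.map_zero])⟩⟩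
      have h1 := E.le_opNorm 1
      rwa [hE, hP.map_one, _root_.map_one, CStarRing.norm_one, mul_one] at h1
  · obtain ⟨b, hb⟩ := hP.pos a
    exact ⟨ι b, by rw [hE, hb, _root_.map_mul, StarHomClass.map_star]⟩
  · rintro _ ⟨x, rfl⟩ _ ⟨y, rfl⟩ a
    rw [hE, hE]
    change ι (P (ι x * a * ι y)) = ι x * ι (P a) * ι y
    rw [hP.bimodule, _root_.map_mul, _root_.map_mul]

/-- Write `E a = ι y`. Right linearity over the range and invariance give `τ (ι (y z)) = τ (E (a ι
z)) = τ (a ι z)`, the relation that characterizes `P a`. -/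
theorem eq_of_isPreservingCondExp (hP : IsExpectation τ ι P)
    (hf : ∀ x : F, τ (ι (star x * x)) = 0 → x = 0) {E : A →L[ℂ] A}
    (hE : IsPreservingCondExp τ ι.range E) (a : A) : E a = ι (P a) := by
  have h1 : E a ∈ (ι.range : Set A) := hE.1.range_eq ▸ Set.mem_range_self a
  obtain ⟨y, hy⟩ := h1
  have hy' : ι y = E a := hy
  rw [← hy']
  congr 1
  refine eq_of_trace_mul_eq hf fun z => ?_
  have h2 := hE.1.bimodule 1 (one_mem _) (ι z) ⟨z, rfl⟩ a
  rw [one_mul, one_mul] at h2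
  rw [hP.trace_mul, ← hE.2 (a * ι z), h2, map_mul ι, hy']

theorem existsUnique_isPreservingCondExp [Nontrivial F] (hP : IsExpectation τ ι P)
    (hf : ∀ x : F, τ (ι (star x * x)) = 0 → x = 0) :
    ∃! E : A →L[ℂ] A, IsPreservingCondExp τ ι.range E := by
  refine ⟨(homCLM ι).comp P, hP.isPreservingCondExp fun a => rfl, fun E hE => ?_⟩
  ext a
  exact hP.eq_of_isPreservingCondExp hf hE a

theorem condExp_apply [Nontrivial F] (hP : IsExpectation τ ι P)
    (hf : ∀ x : F, τ (ι (star x * x)) = 0 → x = 0) (a : A) :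
    condExp τ ι.range a = ι (P a) :=
  hP.eq_of_isPreservingCondExp hf
    (Classical.epsilon_spec (hP.existsUnique_isPreservingCondExp hf).exists) a

end IsExpectation

end Expectation

end QuantumMetric

namespace QuantumMetric

/-! ## Lip-norms from sequences of conditional expectations -/

section ExpectationLipNorm

variable {A : Type u} [CStarAlgebra A]

/-- The extended seminorm `sup_n ‖a - E_n a‖ / β n`. -/
noncomputable def lipSup (E : ℕ → A →L[ℂ] A) (β : ℕ → ℝ) (a : selfAdjoint A) : ℝ≥0∞ :=
  ⨆ n, ENNReal.ofReal (‖(a : A) - E n a‖ / β n)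

/-- The properties of a sequence of conditional expectations that make `lipSup E β` a Lip-norm. -/
structure IsExpectationSeq (E : ℕ → A →L[ℂ] A) (β : ℕ → ℝ) : Prop where
  pos : ∀ n, 0 < β n
  map_one : ∀ n, E n 1 = 1
  norm_le : ∀ n a, ‖E n a‖ ≤ ‖a‖
  map_mul : ∀ n a b, E n (E n a * E n b) = E n a * E n b
  finite : ∀ n, FiniteDimensional ℂ (E n).range
  scalar : ∀ a, ∃ c : ℂ, E 0 a = c • (1 : A)
  dense : Dense {a : selfAdjoint A | ∃ m, ∀ n ≥ m, E n a = a}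
  approx : ∀ ε > 0, ∃ n, ∀ a, (∀ m, ‖a - E m a‖ ≤ β m) → ‖a - E n a‖ ≤ ε

variable {E : ℕ → A →L[ℂ] A} {β : ℕ → ℝ}

theorem lipSup_le_ofReal_iff (hβ : ∀ n, 0 < β n) {a : selfAdjoint A} {r : ℝ} (hr : 0 ≤ r) :
    lipSup E β a ≤ ENNReal.ofReal r ↔ ∀ n, ‖(a : A) - E n a‖ ≤ r * β n := by
  rw [lipSup, iSup_le_iff]
  refine forall_congr' fun n => ?_
  rw [ENNReal.ofReal_le_ofReal_iff hr, div_le_iff₀ (hβ n)]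

theorem lipSup_le_one_iff (hβ : ∀ n, 0 < β n) {a : selfAdjoint A} :
    lipSup E β a ≤ 1 ↔ ∀ n, ‖(a : A) - E n a‖ ≤ β n := by
  simpa using lipSup_le_ofReal_iff (E := E) hβ (a := a) zero_le_one

theorem exists_lipSup_le (hβ : ∀ n, 0 < β n) {a : selfAdjoint A} (h : lipSup E β a ≠ ∞) :
    ∃ r : ℝ, 0 < r ∧ ∀ n, ‖(a : A) - E n a‖ ≤ r * β n := by
  have h0 : 0 ≤ (lipSup E β a).toReal := ENNReal.toReal_nonneg
  -- Adding `1` keeps the constant strictly positive, so that one may later divide by it.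
  refine ⟨(lipSup E β a).toReal + 1, by linarith, ?_⟩
  rw [← lipSup_le_ofReal_iff hβ (by linarith)]
  refine (ENNReal.ofReal_toReal h).symm.le.trans (ENNReal.ofReal_le_ofReal (by linarith))

namespace IsExpectationSeq

theorem map_smul_one (hE : IsExpectationSeq E β) (n : ℕ) (c : ℂ) :
    E n (c • (1 : A)) = c • (1 : A) := by
  rw [map_smul, hE.map_one]

/-- Since `E n` fixes `E n a * E n b`, the defect is `1 - E n` applied to `a b - E n a * E n b`. The
factor `2` bounds the norm of `1 - E n`. -/
theorem norm_mul_sub_le (hE : IsExpectationSeq E β) (n : ℕ) (a b : A) :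
    ‖a * b - E n (a * b)‖ ≤ 2 * (‖a‖ * ‖b - E n b‖ + ‖b‖ * ‖a - E n a‖) := by
  have h1 : ‖a * b - E n a * E n b‖ ≤ ‖a‖ * ‖b - E n b‖ + ‖b‖ * ‖a - E n a‖ := by
    have e : a * b - E n a * E n b = a * (b - E n b) + (a - E n a) * E n b := by
      noncomm_ring
    rw [e]
    refine (norm_add_le _ _).trans (add_le_add (norm_mul_le _ _) ((norm_mul_le _ _).trans ?_))
    rw [mul_comm]
    gcongr
    exact hE.norm_le n b
  have e : a * b - E n (a * b) = (a * b - E n a * E n b) - E n (a * b - E n a * E n b) := by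
    rw [map_sub, hE.map_mul]; abel
  rw [e]
  refine (norm_sub_le _ _).trans ?_
  linarith [hE.norm_le n (a * b - E n a * E n b)]

/-- Coefficients of modulus `1 / 2` cover the Jordan and the Lie product at once. -/
theorem lipSup_le_of_norm_le (hE : IsExpectationSeq E β) {a b x : selfAdjoint A} {c d : ℂ}
    (hx : (x : A) = c • ((a : A) * b) + d • ((b : A) * a)) (hc : ‖c‖ = 1 / 2) (hd : ‖d‖ = 1 / 2) :
    lipSup E β x ≤ (2 : ℝ≥0) *
      (‖(a : A)‖ₑ * lipSup E β b + ‖(b : A)‖ₑ * lipSup E β a) := by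
  refine iSup_le fun n => ?_
  have h1 : ‖(x : A) - E n x‖ ≤ 2 * (‖(a : A)‖ * ‖(b : A) - E n b‖ +
      ‖(b : A)‖ * ‖(a : A) - E n a‖) := by
    have e : (x : A) - E n x = c • ((a : A) * b - E n (a * b)) +
        d • ((b : A) * a - E n (b * a)) := by
      rw [hx, map_add, map_smul, map_smul, smul_sub, smul_sub]; abel
    rw [e]
    refine (norm_add_le _ _).trans ?_
    rw [norm_smul, norm_smul, hc, hd]
    linarith [hE.norm_mul_sub_le n (a : A) b, hE.norm_mul_sub_le n (b : A) a]
  have h2 : ‖(x : A) - E n x‖ / β n ≤ 2 * (‖(a : A)‖ * (‖(b : A) - E n b‖ / β n) +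
      ‖(b : A)‖ * (‖(a : A) - E n a‖ / β n)) := by
    have := div_le_div_of_nonneg_right h1 (hE.pos n).le
    refine this.trans (le_of_eq ?_)
    ring
  have hβ := (hE.pos n).le
  refine (ENNReal.ofReal_le_ofReal h2).trans ?_
  rw [ENNReal.ofReal_mul zero_le_two, ENNReal.ofReal_add (by positivity) (by positivity),
    ENNReal.ofReal_mul (norm_nonneg _), ENNReal.ofReal_mul (norm_nonneg _), ofReal_norm,
    ofReal_norm]
  have h3 : ENNReal.ofReal 2 = ((2 : ℝ≥0) : ℝ≥0∞) := by simp
  rw [h3]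
  gcongr
  · exact le_iSup (fun n => ENNReal.ofReal (‖(b : A) - E n b‖ / β n)) n
  · exact le_iSup (fun n => ENNReal.ofReal (‖(a : A) - E n a‖ / β n)) n

theorem norm_sub_le_of_lipSup_le_one (hE : IsExpectationSeq E β) {a : selfAdjoint A}
    (ha : lipSup E β a ≤ 1) {φ ψ : WeakDual ℂ A} (hφ : φ ∈ stateSpace A) (hψ : ψ ∈ stateSpace A) :
    ‖φ (a : A) - ψ (a : A)‖ ≤ 2 * β 0 := by
  obtain ⟨c, hc⟩ := hE.scalar a
  have h := (lipSup_le_one_iff hE.pos).1 ha 0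
  rw [hc] at h
  have e : φ (a : A) - ψ (a : A) = φ ((a : A) - c • 1) - ψ ((a : A) - c • 1) := by
    simp [hφ.1, hψ.1]
  rw [e]
  refine (norm_sub_le _ _).trans ?_
  linarith [stateSpace.norm_le hφ ((a : A) - c • 1), stateSpace.norm_le hψ ((a : A) - c • 1)]

theorem mongeKantorovich_ne_top (hE : IsExpectationSeq E β) {φ ψ : WeakDual ℂ A}
    (hφ : φ ∈ stateSpace A) (hψ : ψ ∈ stateSpace A) :
    mongeKantorovich (lipSup E β) φ ψ ≠ ∞ := by
  refine ne_top_of_le_ne_top (ENNReal.ofReal_ne_top (r := 2 * β 0)) (iSup₂_le fun a ha => ?_)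
  rw [← ofReal_norm]
  exact ENNReal.ofReal_le_ofReal (hE.norm_sub_le_of_lipSup_le_one ha hφ hψ)

/-- Modulo scalars, which states do not distinguish, the unit ball is uniformly close to the ball of
radius `β 0` in the finite dimensional range of some `E n`. A finite net of that ball reduces the
supremum to finitely many weak* conditions. -/
theorem eventually_mongeKantorovich_lt (hE : IsExpectationSeq E β) {φ : WeakDual ℂ A}
    (hφ : φ ∈ stateSpace A) {ε : ℝ≥0∞} (hε : 0 < ε) :
    ∀ᶠ ψ in 𝓝[stateSpace A] φ, mongeKantorovich (lipSup E β) φ ψ < ε := by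
  obtain ⟨r, hr0, hr⟩ : ∃ r : ℝ, 0 < r ∧ ENNReal.ofReal r < ε := by
    obtain ⟨s, hs0, hs⟩ := ENNReal.lt_iff_exists_nnreal_btwn.1 hε
    exact ⟨s, by exact_mod_cast hs0, by simpa using hs⟩
  -- The final estimate costs five such shares: two for `a - E n a`, two for the net, one for the
  -- values at the net point.
  obtain ⟨n, hn⟩ := hE.approx (r / 8) (by positivity)
  have := hE.finite n
  have : ProperSpace (E n).range := FiniteDimensional.proper ℂ _
  obtain ⟨T, -, hTf, hT⟩ := (isCompact_closedBall (0 : (E n).range) (β 0)).finite_cover_balls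
    (show (0 : ℝ) < r / 8 by positivity)
  have hev : ∀ᶠ ψ in 𝓝[stateSpace A] φ, ∀ t ∈ T, ‖φ (t : A) - ψ (t : A)‖ < r / 8 := by
    rw [Filter.eventually_all_finite hTf]
    intro t _
    have h1 : Continuous fun ψ : WeakDual ℂ A => ‖φ (t : A) - ψ (t : A)‖ :=
      (continuous_const.sub (WeakDual.eval_continuous (t : A))).norm
    have h2 := (h1.tendsto φ).mono_left (nhdsWithin_le_nhds (s := stateSpace A))
    refine h2.eventually (gt_mem_nhds ?_)
    rw [sub_self, norm_zero]; positivity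
  filter_upwards [hev, self_mem_nhdsWithin] with ψ hψT hψ
  refine lt_of_le_of_lt (iSup₂_le fun a ha => ?_) hr
  rw [← ofReal_norm]
  refine ENNReal.ofReal_le_ofReal ?_
  rw [lipSup_le_one_iff hE.pos] at ha
  obtain ⟨c, hc⟩ := hE.scalar a
  have h0 := ha 0
  rw [hc] at h0
  have hna := hn a ha
  let v : (E n).range := ⟨E n ((a : A) - c • 1), ⟨_, rfl⟩⟩
  have hv : v ∈ Metric.closedBall (0 : (E n).range) (β 0) := by
    rw [mem_closedBall_zero_iff]
    exact (hE.norm_le n _).trans h0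
  obtain ⟨t, htT, ht⟩ := Set.mem_iUnion₂.1 (hT hv)
  rw [Metric.mem_ball, dist_eq_norm] at ht
  have ht' : ‖(v : A) - t‖ < r / 8 := ht
  have hv' : (v : A) = E n a - c • 1 := by
    change E n ((a : A) - c • 1) = _
    rw [map_sub, hE.map_smul_one]
  have hφv : φ (v : A) = φ (E n a) - c := by rw [hv']; simp [hφ.1]
  have hψv : ψ (v : A) = ψ (E n a) - c := by rw [hv']; simp [hψ.1]
  have e : φ (a : A) - ψ (a : A) = (φ ((a : A) - E n a) - ψ ((a : A) - E n a)) +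
      ((φ ((v : A) - t) - ψ ((v : A) - t)) + (φ (t : A) - ψ (t : A))) := by
    simp only [map_sub, hφv, hψv]
    ring
  rw [e]
  have h1 := norm_sub_le (φ ((a : A) - E n a)) (ψ ((a : A) - E n a))
  have h2 := norm_sub_le (φ ((v : A) - t)) (ψ ((v : A) - t))
  have h3 := hψT t htT
  refine (norm_add_le _ _).trans ?_
  have h4 := norm_add_le (φ ((v : A) - t) - ψ ((v : A) - t)) (φ (t : A) - ψ (t : A))
  linarith [stateSpace.norm_le hφ ((a : A) - E n a), stateSpace.norm_le hψ ((a : A) - E n a),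
    stateSpace.norm_le hφ ((v : A) - t), stateSpace.norm_le hψ ((v : A) - t)]

end IsExpectationSeq

theorem enorm_sub_le_mul_mongeKantorovich (hβ : ∀ n, 0 < β n) {a : selfAdjoint A} {r : ℝ}
    (hr : 0 < r) (ha : ∀ n, ‖(a : A) - E n a‖ ≤ r * β n) (φ ψ : WeakDual ℂ A) :
    ‖φ (a : A) - ψ (a : A)‖ₑ ≤ ENNReal.ofReal r * mongeKantorovich (lipSup E β) φ ψ := by
  have h1 : lipSup E β (r⁻¹ • a) ≤ 1 := by
    rw [lipSup_le_one_iff hβ]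
    intro n
    have e : ((r⁻¹ • a : selfAdjoint A) : A) - E n ((r⁻¹ • a : selfAdjoint A) : A) =
        r⁻¹ • ((a : A) - E n a) := by
      rw [selfAdjoint.val_smul, ContinuousLinearMap.map_smul_of_tower, smul_sub]
    rw [e, norm_smul, norm_inv, Real.norm_of_nonneg hr.le, inv_mul_le_iff₀ hr]
    exact ha n
  have h2 : ‖φ ((r⁻¹ • a : selfAdjoint A) : A) - ψ ((r⁻¹ • a : selfAdjoint A) : A)‖ₑ ≤
      mongeKantorovich (lipSup E β) φ ψ :=
    le_iSup₂ (f := fun (a : selfAdjoint A) (_ : lipSup E β a ≤ 1) =>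
      ‖φ (a : A) - ψ (a : A)‖ₑ) _ h1
  have e : φ (a : A) - ψ (a : A) = (r : ℂ) • (φ ((r⁻¹ • a : selfAdjoint A) : A) -
      ψ ((r⁻¹ • a : selfAdjoint A) : A)) := by
    rw [selfAdjoint.val_smul, ← Complex.coe_smul, map_smul, map_smul, ← smul_sub, smul_smul,
      ← Complex.ofReal_mul, mul_inv_cancel₀ hr.ne', Complex.ofReal_one, one_smul]
  rw [e, enorm_smul]
  have h3 : ‖(r : ℂ)‖ₑ = ENNReal.ofReal r := by
    rw [← ofReal_norm, Complex.norm_real, Real.norm_of_nonneg hr.le]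
  rw [h3]
  gcongr

/-- Metric convergence gives pointwise convergence on the domain of the seminorm, then on all
self-adjoint elements by density and contractivity of states, then everywhere through real and
imaginary parts. -/
theorem tendsto_eval_of_mongeKantorovich (hβ : ∀ n, 0 < β n)
    (hd : Dense {a : selfAdjoint A | lipSup E β a ≠ ∞}) {φ : WeakDual ℂ A}
    (hφ : φ ∈ stateSpace A) (a : A) :
    Filter.Tendsto (fun ψ : WeakDual ℂ A => ψ a)
      (Filter.comap (mongeKantorovich (lipSup E β) φ) (𝓝 0) ⊓ Filter.principal (stateSpace A))
      (𝓝 (φ a)) := by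
  set l := Filter.comap (mongeKantorovich (lipSup E β) φ) (𝓝 0) ⊓
    Filter.principal (stateSpace A)
  have hlS : ∀ᶠ ψ in l, ψ ∈ stateSpace A :=
    Filter.mem_inf_of_right (Filter.mem_principal_self _)
  have hmk : Filter.Tendsto (mongeKantorovich (lipSup E β) φ) l (𝓝 0) :=
    Filter.tendsto_comap.mono_left inf_le_left
  have dom : ∀ a : selfAdjoint A, lipSup E β a ≠ ∞ →
      Filter.Tendsto (fun ψ : WeakDual ℂ A => ψ (a : A)) l (𝓝 (φ (a : A))) := by
    intro a ha
    obtain ⟨r, hr, har⟩ := exists_lipSup_le hβ ha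
    rw [tendsto_iff_edist_tendsto_0]
    have h1 : Filter.Tendsto (fun ψ => ENNReal.ofReal r * mongeKantorovich (lipSup E β) φ ψ) l
        (𝓝 0) := by
      simpa using ENNReal.Tendsto.const_mul hmk (Or.inr ENNReal.ofReal_ne_top)
    refine tendsto_of_tendsto_of_tendsto_of_le_of_le tendsto_const_nhds h1
      (fun _ => zero_le) fun ψ => ?_
    change edist (ψ (a : A)) (φ (a : A)) ≤ _
    rw [edist_comm, edist_eq_enorm_sub]
    exact enorm_sub_le_mul_mongeKantorovich hβ hr har φ ψ
  have sa : ∀ a : selfAdjoint A,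
      Filter.Tendsto (fun ψ : WeakDual ℂ A => ψ (a : A)) l (𝓝 (φ (a : A))) := by
    intro a
    rw [Metric.tendsto_nhds]
    intro ε hε
    obtain ⟨b, hb, hab⟩ := hd.exists_dist_lt a (show (0 : ℝ) < ε / 3 by positivity)
    have hab' : ‖(a : A) - b‖ < ε / 3 := by
      have : dist a b = ‖(a : A) - b‖ := by rw [Subtype.dist_eq, dist_eq_norm]
      rwa [← this]
    filter_upwards [Metric.tendsto_nhds.1 (dom b hb) (ε / 3) (by positivity), hlS] with ψ h1 hψ
    rw [dist_eq_norm] at h1 ⊢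
    have e : ψ (a : A) - φ (a : A) = ψ ((a : A) - b) - φ ((a : A) - b) +
        (ψ (b : A) - φ (b : A)) := by
      simp only [map_sub]; ring
    rw [e]
    have h2 := norm_add_le (ψ ((a : A) - b) - φ ((a : A) - b)) (ψ (b : A) - φ (b : A))
    have h3 := norm_sub_le (ψ ((a : A) - b)) (φ ((a : A) - b))
    linarith [stateSpace.norm_le hφ ((a : A) - b), stateSpace.norm_le hψ ((a : A) - b)]
  have h := (sa (realPart a)).add ((sa (imaginaryPart a)).const_smul Complex.I)
  simpa only [← map_smul, ← map_add, realPart_add_I_smul_imaginaryPart] using h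

theorem IsExpectationSeq.isLipNorm [Nontrivial A] (hE : IsExpectationSeq E β) :
    IsLipNorm 2 0 (lipSup E β) := by
  have hd : Dense {a : selfAdjoint A | lipSup E β a ≠ ∞} := by
    -- An element fixed by `E n` for all `n ≥ m` has at most `m` nonzero terms in its supremum,
    -- which their sum bounds.
    refine hE.dense.mono ?_
    rintro a ⟨m, hm⟩
    have h0 : ∀ n, 0 ≤ ‖(a : A) - E n a‖ / β n := fun n =>
      div_nonneg (norm_nonneg _) (hE.pos n).le
    refine ne_top_of_le_ne_top (ENNReal.ofReal_ne_top
      (r := ∑ n ∈ Finset.range m, ‖(a : A) - E n a‖ / β n)) (iSup_le fun n => ?_)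
    refine ENNReal.ofReal_le_ofReal ?_
    rcases lt_or_ge n m with h | h
    · exact Finset.single_le_sum (f := fun n => ‖(a : A) - E n a‖ / β n)
        (fun i _ => h0 i) (Finset.mem_range.2 h)
    · rw [hm n h, sub_self, norm_zero, zero_div]
      exact Finset.sum_nonneg fun i _ => h0 i
  refine ⟨fun r a => ?_, fun a b => ?_, hd, fun a => ⟨fun h => ?_, ?_⟩, fun a b _ _ => ?_,
    fun φ hφ ψ hψ => hE.mongeKantorovich_ne_top hφ hψ, fun φ hφ => ?_, ?_⟩
  · rw [lipSup, lipSup, ENNReal.mul_iSup]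
    congr 1
    funext n
    have e : ((r • a : selfAdjoint A) : A) - E n ((r • a : selfAdjoint A) : A) =
        r • ((a : A) - E n a) := by
      rw [selfAdjoint.val_smul, ContinuousLinearMap.map_smul_of_tower, smul_sub]
    rw [e, norm_smul, mul_div_assoc, ENNReal.ofReal_mul (norm_nonneg _), ofReal_norm]
  · refine iSup_le fun n => ?_
    have e : ((a + b : selfAdjoint A) : A) - E n ((a + b : selfAdjoint A) : A) =
        ((a : A) - E n a) + ((b : A) - E n b) := by
      rw [AddSubgroup.coe_add, map_add]; abel
    have hβ := (hE.pos n).le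
    rw [e]
    refine (ENNReal.ofReal_le_ofReal (div_le_div_of_nonneg_right (norm_add_le _ _) hβ)).trans ?_
    rw [add_div, ENNReal.ofReal_add (by positivity) (by positivity)]
    exact add_le_add (le_iSup (fun n => ENNReal.ofReal (‖(a : A) - E n a‖ / β n)) n)
      (le_iSup (fun n => ENNReal.ofReal (‖(b : A) - E n b‖ / β n)) n)
  · have h0 := (lipSup_le_ofReal_iff hE.pos le_rfl).1 (by simpa using h.le) 0
    rw [zero_mul, norm_le_zero_iff, sub_eq_zero] at h0
    obtain ⟨c, hc⟩ := hE.scalar a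
    rw [hc] at h0
    have h1 := a.2.star_eq
    rw [h0, star_smul, star_one] at h1
    have h2 : star c = c := smul_left_injective ℂ (one_ne_zero (α := A)) h1
    refine ⟨c.re, Subtype.ext ?_⟩
    rw [selfAdjoint.val_smul, selfAdjoint.val_one, h0, ← Complex.coe_smul,
      Complex.conj_eq_iff_re.1 h2]
  · rintro ⟨r, rfl⟩
    refine le_antisymm ?_ zero_le
    rw [← ENNReal.ofReal_zero, lipSup_le_ofReal_iff hE.pos le_rfl]
    intro n
    rw [selfAdjoint.val_smul, selfAdjoint.val_one, ← Complex.coe_smul, hE.map_smul_one]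
    simp
  · rw [ENNReal.coe_zero, zero_mul, zero_mul, add_zero]
    refine max_le (hE.lipSup_le_of_norm_le (c := 2⁻¹) (d := 2⁻¹) (smul_add _ _ _) (by simp)
      (by simp)) (hE.lipSup_le_of_norm_le (c := (2 * Complex.I)⁻¹) (d := -(2 * Complex.I)⁻¹) ?_
      (by simp) (by simp))
    change (2 * Complex.I)⁻¹ • ((a : A) * b - b * a) = _
    rw [smul_sub, neg_smul, sub_eq_add_neg]
  -- Written as a comap of neighborhoods of `0`, the metric neighborhoods form a filter by
  -- construction, so no triangle inequality is needed. The two inclusions are the two preceding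
  -- convergence statements.
  · have key : 𝓝[stateSpace A] φ = Filter.comap (mongeKantorovich (lipSup E β) φ) (𝓝 0) ⊓
        Filter.principal (stateSpace A) := by
      refine le_antisymm (le_inf ?_ inf_le_right) (le_inf ?_ inf_le_right)
      · rw [← Filter.tendsto_iff_comap, ENNReal.tendsto_nhds_zero]
        exact fun ε hε => (hE.eventually_mongeKantorovich_lt hφ hε).mono fun _ h => h.le
      · refine Filter.tendsto_id'.1 (tendsto_iff_forall_eval_tendsto_topDualPairing.2
          fun a => ?_)
        exact tendsto_eval_of_mongeKantorovich hE.pos hd hφ a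
    rw [key]
    refine ((ENNReal.nhds_zero_basis.comap _).inf_principal _).congr (fun _ => Iff.rfl)
      fun ε _ => ?_
    ext ψ
    exact and_comm
  · refine lowerSemicontinuous_iSup fun n => Continuous.lowerSemicontinuous ?_
    exact ENNReal.continuous_ofReal.comp (((continuous_subtype_val.sub
      ((E n).continuous.comp continuous_subtype_val)).norm).div_const _)

end ExpectationLipNorm

end QuantumMetric

namespace QuantumMetric

/-! ### Canonical maps, functionals and expectations of an inductive limit -/

namespace InductiveSeq

open Filter

variable (I : InductiveSeq.{u})

theorem trans_self (n : ℕ) (a : I.obj n) : I.trans le_rfl a = a := by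
  unfold trans
  rw [Nat.leRecOn_self]
  rfl

theorem trans_injective {n m : ℕ} (h : n ≤ m) : Function.Injective (I.trans h) := by
  induction m, h using Nat.le_induction with
  | base => exact fun a b hab => by simpa only [trans_self] using hab
  | succ m hm ih => 
    intro a b hab
    rw [I.trans_succ hm, I.trans_succ hm] at hab
    exact ih (I.map_injective m hab)

theorem norm_ι (n : ℕ) (a : I.obj n) : ‖I.ι n a‖ = ‖a‖ := by
  change ‖Limit.of (I.seqOf n a)‖ = _
  rw [Limit.norm_of]
  obtain ⟨m, hm, h⟩ := ((Pre.eventually_norm (I.seqOf n a)).and (eventually_ge_atTop n)).exists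
  rw [← hm, I.seqOf_term h]
  exact NonUnitalStarAlgHom.norm_map (I.trans h) (I.trans_injective h) a

theorem ι_injective (n : ℕ) : Function.Injective (I.ι n) := fun a b hab => by
  rw [← sub_eq_zero, ← norm_eq_zero, ← I.norm_ι, map_sub, hab, sub_self, norm_zero]

theorem ι_trans {n m : ℕ} (h : n ≤ m) (a : I.obj n) : I.ι m (I.trans h a) = I.ι n a := by
  refine Limit.of_eq_of (eventually_atTop.2 ⟨m, fun k hk => ?_⟩)
  rw [I.seqOf_term hk, I.seqOf_term (h.trans hk)]
  induction k, hk using Nat.le_induction with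
  | base => rw [trans_self]
  | succ k hk ih => rw [I.trans_succ hk, ih, I.trans_succ (h.trans hk)]

theorem ι_map (n : ℕ) (a : I.obj n) : I.ι (n + 1) (I.map n a) = I.ι n a := by
  rw [← I.ι_trans n.le_succ, I.trans_succ le_rfl, trans_self]

theorem eventually_of_eq_ι (x : I.Pre) : ∀ᶠ n in atTop, Limit.of x = I.ι n (x.term n) := by
  obtain ⟨N, hN⟩ := eventually_atTop.1 (show ∀ᶠ n in atTop, _ from x.2)
  refine eventually_atTop.2 ⟨N, fun n hn => Limit.of_eq_of (eventually_atTop.2 ⟨n, fun m hm => ?_⟩)⟩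
  rw [I.seqOf_term hm]
  induction m, hm using Nat.le_induction with
  | base => rw [trans_self]
  | succ m hm ih => rw [I.trans_succ hm, ← ih]; exact hN m (hn.trans hm)

theorem exists_norm_sub_ι_lt (a : I.Limit) {ε : ℝ} (hε : 0 < ε) :
    ∃ n, ∃ x : I.obj n, ‖a - I.ι n x‖ < ε := by
  obtain ⟨x, hx⟩ := Limit.denseRange_of.exists_dist_lt a hε
  obtain ⟨n, hn⟩ := (I.eventually_of_eq_ι x).exists
  exact ⟨n, x.term n, by rwa [← hn, ← dist_eq_norm]⟩

/-- Taking real parts commutes with `ι n`, fixes `a` and is contractive, so the real part of any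
approximant will do. -/
theorem exists_selfAdjoint_norm_sub_ι_lt (a : selfAdjoint I.Limit) {ε : ℝ} (hε : 0 < ε) :
    ∃ n, ∃ x : selfAdjoint (I.obj n), ‖(a : I.Limit) - I.ι n x‖ < ε := by
  obtain ⟨n, x, hx⟩ := I.exists_norm_sub_ι_lt (a : I.Limit) hε
  refine ⟨n, realPart x, ?_⟩
  have e : (a : I.Limit) - I.ι n (realPart x : I.obj n) =
      (realPart ((a : I.Limit) - I.ι n x) : I.Limit) := by
    rw [map_sub, AddSubgroup.coe_sub, a.2.coe_realPart, realPart_apply_coe, realPart_apply_coe,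
      ← map_star, ← map_add, ← Complex.coe_smul, ← Complex.coe_smul, map_smul]
  rw [e]
  exact (realPart.norm_le _).trans_lt hx

theorem functional_ext {I : InductiveSeq.{u}} {φ ψ : WeakDual ℂ I.Limit}
    (h : ∀ n x, φ (I.ι n x) = ψ (I.ι n x)) : φ = ψ := by
  refine DFunLike.ext _ _ fun a => ?_
  refine Limit.denseRange_of.induction_on (p := fun a => φ a = ψ a) a
    (isClosed_eq (map_continuous φ) (map_continuous ψ)) fun x => ?_
  obtain ⟨n, hn⟩ := (I.eventually_of_eq_ι x).exists
  rw [hn, h]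

/-- A compatible sequence of contractive functionals extends to the limit. -/
theorem exists_functional (t : ∀ n, I.obj n →ₗ[ℂ] ℂ) (ht : ∀ n x, ‖t n x‖ ≤ ‖x‖)
    (hc : ∀ n x, t (n + 1) (I.map n x) = t n x) :
    ∃ τ : WeakDual ℂ I.Limit, ∀ n x, τ (I.ι n x) = t n x := by
  have hex : ∀ x : I.Pre, ∃ c, ∀ᶠ n in atTop, t n (x.term n) = c := by
    intro x
    obtain ⟨N, hN⟩ := eventually_atTop.1 (show ∀ᶠ n in atTop, _ from x.2)
    refine ⟨t N (x.term N), eventually_atTop.2 ⟨N, fun n hn => ?_⟩⟩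
    induction n, hn using Nat.le_induction with
    | base => rfl
    | succ n hn ih => rw [← ih, ← hc n]; exact congrArg (t (n + 1)) (hN n hn)
  choose f hf using hex
  let g : I.Pre →ₗ[ℂ] ℂ :=
    { toFun := f
      map_add' := fun x y => by
        obtain ⟨n, h1, h2, h3⟩ := ((hf x).and ((hf y).and (hf (x + y)))).exists
        rw [← h1, ← h2, ← h3, Pre.term_add, map_add]
      map_smul' := fun c x => by
        obtain ⟨n, h1, h2⟩ := ((hf x).and (hf (c • x))).exists
        rw [← h1, ← h2, Pre.term_smul, map_smul, RingHom.id_apply] }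
  let e : I.Pre →ₗ[ℂ] I.Limit :=
    { toFun := Limit.of
      map_add' := Limit.of_add
      map_smul' := Limit.of_smul }
  have hge : ∀ x, g.extendOfNorm e (Limit.of x) = f x := fun x => by
    refine LinearMap.extendOfNorm_eq (f := g) (e := e) Limit.denseRange_of ⟨1, fun x => ?_⟩ x
    obtain ⟨n, h1, h2⟩ := ((hf x).and (Pre.eventually_norm x)).exists
    change ‖f x‖ ≤ 1 * ‖Limit.of x‖
    rw [one_mul, Limit.norm_of, ← h1, ← h2]
    exact ht n _
  refine ⟨g.extendOfNorm e, fun n x => (hge (I.seqOf n x)).trans ?_⟩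
  obtain ⟨m, h1, hm⟩ := ((hf (I.seqOf n x)).and (eventually_ge_atTop n)).exists
  rw [← h1, I.seqOf_term hm]
  clear h1
  induction m, hm using Nat.le_induction with
  | base => rw [trans_self]
  | succ m hm ih => rw [I.trans_succ hm, hc, ih]

theorem isTracialState_of_forall {I : InductiveSeq.{u}} {τ : WeakDual ℂ I.Limit}
    (h1 : τ 1 = 1) (hp : ∀ n (x : I.obj n), 0 ≤ τ (I.ι n (star x * x)))
    (ht : ∀ n (x y : I.obj n), τ (I.ι n (x * y)) = τ (I.ι n (y * x))) : IsTracialState τ := by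
  have hcτ := map_continuous τ
  refine ⟨⟨h1, fun a => ?_⟩, fun a b => ?_⟩
  · refine Limit.denseRange_of.induction_on (p := fun a => 0 ≤ τ (star a * a)) a ?_ fun x => ?_
    · exact isClosed_Ici.preimage (hcτ.comp (continuous_star.mul continuous_id))
    · obtain ⟨n, hn⟩ := (I.eventually_of_eq_ι x).exists
      rw [hn, ← map_star, ← map_mul]
      exact hp n _
  · refine Limit.denseRange_of.induction_on₂ (p := fun a b => τ (a * b) = τ (b * a)) ?_
      (fun x y => ?_) a b
    · exact isClosed_eq (hcτ.comp (continuous_fst.mul continuous_snd))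
        (hcτ.comp (continuous_snd.mul continuous_fst))
    · obtain ⟨n, hn, hm⟩ := ((I.eventually_of_eq_ι x).and (I.eventually_of_eq_ι y)).exists
      rw [hn, hm, ← map_mul, ← map_mul, ht]

/-! ### The expectations of an inductive sequence of finite dimensional algebras -/

/-- `μ` is a tracial state which is faithful on every algebra of the sequence. -/
structure IsFaithfulTrace (μ : WeakDual ℂ I.Limit) : Prop where
  tracial : IsTracialState μ
  faithful : ∀ n (x : I.obj n), μ (I.ι n (star x * x)) = 0 → x = 0

variable {I} [hfin : ∀ n, FiniteDimensional ℂ (I.obj n)] [Nontrivial (I.obj 0)]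
  {μ : WeakDual ℂ I.Limit}

/-- The `μ`-preserving expectation onto the `n`-th algebra, with values in that algebra. -/
noncomputable def IsFaithfulTrace.proj (hμ : I.IsFaithfulTrace μ) (n : ℕ) : I.Limit →L[ℂ] I.obj n :=
  (exists_isExpectation hμ.tracial (hμ.faithful n)).choose

namespace IsFaithfulTrace

variable (hμ : I.IsFaithfulTrace μ)
include hμ

omit [Nontrivial (I.obj 0)] in
theorem isExpectation (n : ℕ) : IsExpectation μ (I.ι n) (hμ.proj n) :=
  (exists_isExpectation hμ.tracial (hμ.faithful n)).choose_spec

theorem existsUnique_isPreservingCondExp (n : ℕ) :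
    ∃! E : I.Limit →L[ℂ] I.Limit, IsPreservingCondExp μ (I.ι n).range E :=
  have := I.obj_nontrivial n
  (hμ.isExpectation n).existsUnique_isPreservingCondExp (hμ.faithful n)

theorem expect_apply (n : ℕ) (a : I.Limit) : I.expect μ n a = I.ι n (hμ.proj n a) :=
  have := I.obj_nontrivial n
  (hμ.isExpectation n).condExp_apply (hμ.faithful n) a

theorem norm_expect_le (n : ℕ) (a : I.Limit) : ‖I.expect μ n a‖ ≤ ‖a‖ := by
  rw [hμ.expect_apply, I.norm_ι]
  exact (hμ.isExpectation n).norm_le a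

theorem expect_ι {n m : ℕ} (h : n ≤ m) (x : I.obj n) : I.expect μ m (I.ι n x) = I.ι n x := by
  rw [← I.ι_trans h, hμ.expect_apply, (hμ.isExpectation m).left_inv]

/-- The tower property: a test element of level `n` is also one of level `m`, so both sides have the
same trace pairings as `a`. -/
theorem proj_expect {n m : ℕ} (h : n ≤ m) (a : I.Limit) :
    hμ.proj n (I.expect μ m a) = hμ.proj n a := by
  refine eq_of_trace_mul_eq (hμ.faithful n) fun z => ?_
  rw [(hμ.isExpectation n).trace_mul, (hμ.isExpectation n).trace_mul, hμ.expect_apply,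
    ← I.ι_trans h, ← map_mul, (hμ.isExpectation m).trace_mul]

theorem expect_expect {n m : ℕ} (h : n ≤ m) (a : I.Limit) :
    I.expect μ n (I.expect μ m a) = I.expect μ n a := by
  rw [hμ.expect_apply, hμ.proj_expect h, hμ.expect_apply]

theorem expect_expect_of_ge {n m : ℕ} (h : n ≤ m) (a : I.Limit) :
    I.expect μ m (I.expect μ n a) = I.expect μ n a := by
  rw [hμ.expect_apply n, hμ.expect_ι h]

/-- The expectations are contractions that eventually fix each element of the dense union of the
levels. -/
theorem tendsto_expect (a : I.Limit) : Tendsto (fun n => I.expect μ n a) atTop (𝓝 a) := by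
  rw [Metric.tendsto_atTop]
  intro ε hε
  obtain ⟨n, x, hx⟩ := I.exists_norm_sub_ι_lt a (half_pos hε)
  refine ⟨n, fun m hm => ?_⟩
  rw [dist_eq_norm, norm_sub_rev]
  have e : a - I.expect μ m a = (a - I.ι n x) - I.expect μ m (a - I.ι n x) := by
    rw [map_sub, hμ.expect_ι hm]; abel
  rw [e]
  refine (norm_sub_le _ _).trans_lt ?_
  linarith [hμ.norm_expect_le m (a - I.ι n x)]

/-- If `μ (a* a) = 0`, each expectation of `a* a` is positive of trace zero in a level where `μ` is
faithful. All of them vanish, and they converge to `a* a`. -/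
theorem isFaithful : IsFaithful μ := by
  intro a ha
  have h0 : ∀ n, I.expect μ n (star a * a) = 0 := by
    intro n
    obtain ⟨b, hb⟩ := (hμ.isExpectation n).pos a
    have h := (hμ.isExpectation n).preserving (star a * a)
    rw [ha, hb] at h
    rw [hμ.expect_apply, hb, hμ.faithful n b h, mul_zero, map_zero]
  have h1 := tendsto_nhds_unique (hμ.tendsto_expect (star a * a))
    (by simpa only [h0] using tendsto_const_nhds)
  exact CStarRing.star_mul_self_eq_zero_iff a |>.1 h1

theorem isExpectationSeq {β : ℕ → ℝ} (hβ : ∀ n, 0 < β n) (hβ0 : ∀ ε > 0, ∃ n, β n ≤ ε)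
    (h0 : ∀ x : I.obj 0, ∃ c : ℂ, x = c • (1 : I.obj 0)) : IsExpectationSeq (I.expect μ) β where
  pos := hβ
  map_one n := by rw [hμ.expect_apply, (hμ.isExpectation n).map_one, map_one]
  norm_le := hμ.norm_expect_le
  map_mul n a b := by
    rw [hμ.expect_apply n a, hμ.expect_apply n b, ← map_mul, hμ.expect_ι le_rfl]
  finite n := by
    have : (I.expect μ n).range ≤ (homCLM (I.ι n)).range := by
      rintro _ ⟨a, rfl⟩
      exact ⟨hμ.proj n a, (hμ.expect_apply n a).symm⟩
    exact Submodule.finiteDimensional_of_le this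
  scalar a := by
    obtain ⟨c, hc⟩ := h0 (hμ.proj 0 a)
    exact ⟨c, by rw [hμ.expect_apply, hc, map_smul, map_one]⟩
  dense := by
    rw [Metric.dense_iff]
    intro a r hr
    obtain ⟨n, x, hx⟩ := I.exists_selfAdjoint_norm_sub_ι_lt a hr
    refine ⟨⟨I.ι n x, x.2.map (I.ι n)⟩, ?_, n, fun m hm => hμ.expect_ι hm _⟩
    rwa [Metric.mem_ball, dist_comm, Subtype.dist_eq, dist_eq_norm]
  approx ε hε := by
    obtain ⟨n, hn⟩ := hβ0 ε hε
    exact ⟨n, fun a ha => (ha n).trans hn⟩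

/-- The restriction of the expectations to the `N`-th algebra. -/
noncomputable def restrictExpect (N n : ℕ) : I.obj N →L[ℂ] I.obj N :=
  (hμ.proj N).comp ((I.expect μ n).comp (homCLM (I.ι N)))

/-- The expectations of the limit leave the image of level `N` invariant: for `n ≤ N` by nesting of
the ranges, for `n ≥ N` because `E n` fixes it pointwise. -/
theorem ι_restrictExpect (N n : ℕ) (x : I.obj N) :
    I.ι N (hμ.restrictExpect N n x) = I.expect μ n (I.ι N x) := by
  change I.ι N (hμ.proj N (I.expect μ n (I.ι N x))) = _
  rw [← hμ.expect_apply]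
  rcases le_total n N with h | h
  · rw [hμ.expect_expect_of_ge h]
  · rw [hμ.expect_ι h, hμ.expect_ι le_rfl]

theorem restrictExpect_of_le {N n : ℕ} (h : N ≤ n) (x : I.obj N) :
    hμ.restrictExpect N n x = x :=
  I.ι_injective N (by rw [hμ.ι_restrictExpect, hμ.expect_ι h])

theorem isExpectationSeq_restrictExpect {β : ℕ → ℝ} (hβ : ∀ n, 0 < β n)
    (h0 : ∀ x : I.obj 0, ∃ c : ℂ, x = c • (1 : I.obj 0)) (N : ℕ) :
    IsExpectationSeq (hμ.restrictExpect N) β where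
  pos := hβ
  map_one n := I.ι_injective N (by
    rw [hμ.ι_restrictExpect, map_one, hμ.expect_apply, (hμ.isExpectation n).map_one, map_one])
  norm_le n x := by
    rw [← I.norm_ι, hμ.ι_restrictExpect, ← I.norm_ι N x]
    exact hμ.norm_expect_le n _
  map_mul n x y := I.ι_injective N (by
    rw [hμ.ι_restrictExpect, map_mul, hμ.ι_restrictExpect, hμ.ι_restrictExpect,
      hμ.expect_apply n (I.ι N x), hμ.expect_apply n (I.ι N y), ← map_mul, hμ.expect_ι le_rfl])
  finite n := inferInstance
  scalar x := by
    obtain ⟨c, hc⟩ := h0 (hμ.proj 0 (I.ι N x))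
    exact ⟨c, I.ι_injective N (by
      rw [hμ.ι_restrictExpect, hμ.expect_apply, hc, map_smul, map_smul, map_one, map_one])⟩
  dense := by
    convert dense_univ
    exact Set.eq_univ_of_forall fun x => ⟨N, fun n hn => hμ.restrictExpect_of_le hn _⟩
  approx ε hε := ⟨N, fun x _ => by
    rw [hμ.restrictExpect_of_le le_rfl, sub_self, norm_zero]; exact hε.le⟩

end IsFaithfulTrace

end InductiveSeq

end QuantumMetric

namespace QuantumMetric

/-! ## Bridges between an algebra and a finite dimensional subalgebra -/

theorem hausdorff_self {X : Type*} (d : X → X → ℝ≥0∞) (S : Set X) (hd : ∀ x, d x x = 0) :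
    hausdorff d S S = 0 := by
  simp only [hausdorff, ← bot_eq_zero, max_eq_bot, iSup_eq_bot]
  refine ⟨fun x hx => ?_, fun x hx => ?_⟩ <;>
  · refine le_bot_iff.1 ((iInf₂_le x hx).trans ?_)
    simp [hd]

theorem mongeKantorovich_self {A : Type*} [CStarAlgebra A] (L : selfAdjoint A → ℝ≥0∞)
    (φ : WeakDual ℂ A) : mongeKantorovich L φ φ = 0 := by
  simp [mongeKantorovich]

section

variable {A F : Type u} [CStarAlgebra A] [CStarAlgebra F]

theorem levelSet_one : levelSet (1 : A) = stateSpace A := by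
  ext φ
  simp [levelSet]

/-- The bridge from an algebra to a subalgebra with pivot `1`. -/
noncomputable def Bridge.ofInjective [Nontrivial A] (j : F →⋆ₐ[ℂ] A)
    (hj : Function.Injective j) : Bridge A F where
  carrier := A
  left := StarAlgHom.id ℂ A
  right := j
  left_injective := Function.injective_id
  right_injective := hj
  pivot := 1
  nonempty_levelSet := by
    rw [levelSet_one]
    exact stateSpace_nonempty

/-- With pivot `1` every state lies in the level set, and a state `φ` of `F` is the restriction of
the state `φ ∘ P` of `A`. -/
theorem Bridge.height_ofInjective [Nontrivial A] {j : F →⋆ₐ[ℂ] A} (hj : Function.Injective j)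
    {τ : WeakDual ℂ A} {P : A →L[ℂ] F} (hP : IsExpectation τ j P)
    (LA : selfAdjoint A → ℝ≥0∞) (LF : selfAdjoint F → ℝ≥0∞) :
    (Bridge.ofInjective j hj).height LA LF = 0 := by
  have h1 : dualImage (StarAlgHom.id ℂ A) (levelSet (1 : A)) = stateSpace A := by
    rw [levelSet_one]
    ext φ
    constructor
    · rintro ⟨ψ, hψ, h⟩
      rwa [show φ = ψ from DFunLike.ext _ _ h]
    · exact fun h => ⟨φ, h, fun _ => rfl⟩
  have h2 : dualImage j (levelSet (1 : A)) = stateSpace F := by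
    rw [levelSet_one]
    ext φ
    constructor
    · rintro ⟨ψ, hψ, h⟩
      refine ⟨by rw [h, map_one, hψ.1], fun x => ?_⟩
      rw [h, map_mul, map_star]
      exact hψ.2 _
    · intro h
      let ψ : WeakDual ℂ A := (show F →L[ℂ] ℂ from φ).comp P
      have hψ : ∀ a, ψ a = φ (P a) := fun a => rfl
      refine ⟨ψ, ⟨by rw [hψ, hP.map_one, h.1], fun a => ?_⟩, fun x => ?_⟩
      · obtain ⟨b, hb⟩ := hP.pos a
        rw [hψ, hb]
        exact h.2 b
      · rw [hψ, hP.left_inv]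
  change max (hausdorff (mongeKantorovich LA) (stateSpace A)
    (dualImage (StarAlgHom.id ℂ A) (levelSet (1 : A)))) (hausdorff (mongeKantorovich LF)
    (stateSpace F) (dualImage j (levelSet (1 : A)))) = 0
  rw [h1, h2, hausdorff_self _ _ (mongeKantorovich_self LA),
    hausdorff_self _ _ (mongeKantorovich_self LF), max_self]

variable {E : ℕ → A →L[ℂ] A} {β : ℕ → ℝ} {E' : ℕ → F →L[ℂ] F} {β' : ℕ → ℝ}

/-- An element which is nearly in the unit ball of `lipSup E β` is near the unit ball. -/
theorem IsExpectationSeq.exists_lipSup_le_one (hE : IsExpectationSeq E β) {a : selfAdjoint A}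
    {δ : ℝ} (hδ : 0 ≤ δ) (ha : ∀ n, ‖(a : A) - E n a‖ ≤ (1 + δ) * β n) :
    ∃ b : selfAdjoint A, lipSup E β b ≤ 1 ∧ ‖(a : A) - b‖ ≤ δ * β 0 := by
  obtain ⟨c, hc⟩ := hE.scalar a
  have h1δ : 0 < 1 + δ := by linarith
  set s : ℝ := (1 + δ)⁻¹
  have hs0 : 0 < s := inv_pos.2 h1δ
  have hs1 : s * (1 + δ) = 1 := inv_mul_cancel₀ h1δ.ne'
  -- The scalar must be real to stay among self-adjoint elements. Passing to real parts does not
  -- increase the distance.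
  have hre : ‖(a : A) - (c.re : ℂ) • (1 : A)‖ ≤ (1 + δ) * β 0 := by
    have h := ha 0
    rw [hc] at h
    refine le_trans ?_ h
    have e : (a : A) - (c.re : ℂ) • (1 : A) = (realPart ((a : A) - c • (1 : A)) : A) := by
      rw [map_sub, AddSubgroup.coe_sub, a.2.coe_realPart]
      congr 1
      rw [realPart_apply_coe, star_smul, star_one, ← add_smul, ← Complex.coe_smul, smul_smul]
      congr 1
      rw [Complex.star_def, Complex.add_conj]
      push_cast
      ring
    rw [e]
    exact realPart.norm_le ((a : A) - c • (1 : A))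
  -- Contract `a` toward its scalar part by `s = 1 / (1 + δ)`. The seminorm ignores scalars and is
  -- scaled by `s`; the displacement is at most `(1 - s) (1 + δ) β 0 = δ β 0`. Scaling toward `0`
  -- would involve `‖a‖`, which is not controlled.
  refine ⟨s • a + ((1 - s) * c.re) • (1 : selfAdjoint A), ?_, ?_⟩
  · rw [lipSup_le_one_iff hE.pos]
    intro n
    have e : ((s • a + ((1 - s) * c.re) • (1 : selfAdjoint A) : selfAdjoint A) : A) =
        (s : ℂ) • (a : A) + (((1 - s) * c.re : ℝ) : ℂ) • (1 : A) := by
      rw [AddSubgroup.coe_add, selfAdjoint.val_smul, selfAdjoint.val_smul, selfAdjoint.val_one,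
        Complex.coe_smul, Complex.coe_smul]
    rw [e, map_add, hE.map_smul_one, map_smul, add_sub_add_right_eq_sub, ← smul_sub, norm_smul,
      Complex.norm_real, Real.norm_of_nonneg hs0.le]
    calc s * ‖(a : A) - E n a‖ ≤ s * ((1 + δ) * β n) := by gcongr; exact ha n
      _ = β n := by rw [← mul_assoc, hs1, one_mul]
  · have e : (a : A) - ((s • a + ((1 - s) * c.re) • (1 : selfAdjoint A) : selfAdjoint A) : A) =
        ((1 - s : ℝ) : ℂ) • ((a : A) - (c.re : ℂ) • (1 : A)) := by
      rw [AddSubgroup.coe_add, selfAdjoint.val_smul, selfAdjoint.val_smul, selfAdjoint.val_one,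
        ← Complex.coe_smul, ← Complex.coe_smul]
      push_cast
      module
    have h1s : 1 - s = s * δ := by linarith
    rw [e, norm_smul, Complex.norm_real, h1s, Real.norm_of_nonneg (by positivity)]
    calc s * δ * ‖(a : A) - (c.re : ℂ) • (1 : A)‖ ≤ s * δ * ((1 + δ) * β 0) := by gcongr
      _ = s * (1 + δ) * (δ * β 0) := by ring
      _ = δ * β 0 := by rw [hs1, one_mul]

/-- The length of the bridge from `A` to a subalgebra `F` on which the expectations of `A` and
those given on `F` are close. -/
theorem Bridge.length_ofInjective_le [Nontrivial A] (hE : IsExpectationSeq E β)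
    (hE' : IsExpectationSeq E' β') {j : F →⋆ₐ[ℂ] A} (hj : Function.Injective j)
    {τ : WeakDual ℂ A} {P : A →L[ℂ] F} (hP : IsExpectation τ j P) {N : ℕ} {η : ℝ} (hη : 0 ≤ η)
    (hββ' : ∀ n ≤ N, β n = β' n) (hjP : ∀ a, j (P a) = E N a)
    (hle : ∀ n ≤ N, ∀ a, E n (E N a) = E n a) (hge : ∀ n ≤ N, ∀ a, E N (E n a) = E n a)
    (hEN : ∀ n ≥ N, ∀ x, E n (j x) = j x) (hE'N : ∀ n ≥ N, ∀ x, E' n x = x)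
    (hclose : ∀ n ≤ N, ∀ x, ‖E n (j x) - j (E' n x)‖ ≤ η * β n * ‖x‖) :
    (Bridge.ofInjective j hj).length (lipSup E β) (lipSup E' β') ≤
      ENNReal.ofReal (β N + η * β 0 * β 0) := by
  have hβ0 := (hE.pos 0).le
  have hβ00 : β' 0 = β 0 := (hββ' 0 (Nat.zero_le _)).symm
  have hδ : 0 ≤ η * β 0 := by positivity
  have hnorm : ∀ x, ‖j x‖ = ‖x‖ := NonUnitalStarAlgHom.norm_map j hj
  -- Above level `N` the expectations on `F` are the identity. Below, subtracting the scalar `E 0 (j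
  -- x)` replaces `‖x‖` by at most `β 0`, so the closeness error becomes `η β 0 β n`, proportional
  -- to `β n`.
  have fwd : ∀ x : F, (∀ n, ‖j x - E n (j x)‖ ≤ β n) →
      ∀ n, ‖x - E' n x‖ ≤ (1 + η * β 0) * β' n := by
    intro x hx n
    rcases lt_or_ge N n with h | h
    · rw [hE'N n h.le, sub_self, norm_zero]
      have := (hE'.pos n).le
      positivity
    · obtain ⟨c, hc⟩ := hE.scalar (j x)
      have h0 := hx 0
      rw [hc, ← map_one j, ← map_smul, ← map_sub, hnorm] at h0
      have h1 := hclose n h (x - c • 1)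
      have e : x - E' n x = (x - c • 1) - E' n (x - c • 1) := by
        rw [map_sub, hE'.map_smul_one]; abel
      have e2 : j (x - c • 1) - E n (j (x - c • 1)) = j x - E n (j x) := by
        rw [map_sub, map_smul, map_one, map_sub, hE.map_smul_one]; abel
      rw [e, ← hnorm, map_sub j, ← hββ' n h]
      have h2 := norm_add_le (j (x - c • 1) - E n (j (x - c • 1)))
        (E n (j (x - c • 1)) - j (E' n (x - c • 1)))
      rw [sub_add_sub_cancel, e2] at h2
      have h3 : η * β n * ‖x - c • (1 : F)‖ ≤ η * β n * β 0 := by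
        have := (hE.pos n).le
        gcongr
      linarith [hx n]
  have bwd : ∀ x : F, (∀ n, ‖x - E' n x‖ ≤ β' n) →
      ∀ n, ‖j x - E n (j x)‖ ≤ (1 + η * β 0) * β n := by
    intro x hx n
    rcases lt_or_ge N n with h | h
    · rw [hEN n h.le, sub_self, norm_zero]
      have := (hE.pos n).le
      positivity
    · obtain ⟨c, hc⟩ := hE'.scalar x
      have h0 := hx 0
      rw [hc, hβ00] at h0
      have h1 := hclose n h (x - c • 1)
      have e : j x - E n (j x) = j (x - c • 1) - E n (j (x - c • 1)) := by
        rw [map_sub, map_smul, map_one, map_sub, hE.map_smul_one]; abel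
      have e2 : j (x - c • 1) - j (E' n (x - c • 1)) = j (x - E' n x) := by
        rw [← map_sub, map_sub (E' n), hE'.map_smul_one]; congr 1; abel
      rw [e]
      have h2 := norm_sub_le (j (x - c • 1) - j (E' n (x - c • 1)))
        (E n (j (x - c • 1)) - j (E' n (x - c • 1)))
      rw [sub_sub_sub_cancel_right, e2, hnorm] at h2
      have h3 : η * β n * ‖x - c • (1 : F)‖ ≤ η * β n * β 0 := by
        have := (hE.pos n).le
        gcongr
      have h4 := hx n
      rw [← hββ' n h] at h4
      linarith
  rw [Bridge.length, Bridge.height_ofInjective hj hP]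
  refine max_le zero_le ?_
  have hsem : ∀ (a : A) (x : F), (Bridge.ofInjective j hj).seminorm a x =
      ENNReal.ofReal ‖a - j x‖ := fun a x => by
    change ‖a * 1 - 1 * j x‖ₑ = _
    rw [mul_one, one_mul, ofReal_norm]
  rw [Bridge.reach, hausdorff]
  refine max_le (iSup₂_le fun a ha => ?_) (iSup₂_le fun x hx => ?_)
  · have ha' := (lipSup_le_one_iff hE.pos).1 ha
    -- Projecting costs `β N` and stays in the unit ball of the restricted seminorm, because `E N`
    -- is contractive and compatible with `E n`. The correction into the ball of `F` costs a further
    -- `η β 0 β 0`.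
    let x : selfAdjoint F := ⟨P a, by
      rw [selfAdjoint.mem_iff, ← hP.map_star, a.2.star_eq]⟩
    have hx : ∀ n, ‖j x - E n (j x)‖ ≤ β n := fun n => by
      rcases lt_or_ge N n with h | h
      · rw [hEN n h.le, sub_self, norm_zero]
        exact (hE.pos n).le
      · have e : j x - E n (j x) = E N ((a : A) - E n a) := by
          change j (P a) - E n (j (P a)) = _
          rw [hjP, hle n h, map_sub, hge n h]
        rw [e]
        exact (hE.norm_le N _).trans (ha' n)
    obtain ⟨y, hy, hxy⟩ := hE'.exists_lipSup_le_one hδ (fwd x hx)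
    refine (iInf₂_le y hy).trans ?_
    rw [hsem]
    refine ENNReal.ofReal_le_ofReal ?_
    have e : (a : A) - j y = ((a : A) - E N a) + j ((x : F) - y) := by
      rw [map_sub]
      change _ = _ + (j (P a) - _)
      rw [hjP]; abel
    rw [e]
    refine (norm_add_le _ _).trans ?_
    rw [hnorm, ← hβ00] at *
    exact add_le_add (ha' N) hxy
  · have hx' := (lipSup_le_one_iff hE'.pos).1 hx
    obtain ⟨a, ha, hxa⟩ := hE.exists_lipSup_le_one (a := ⟨j x, x.2.map j⟩) hδ (bwd x hx')
    refine (iInf₂_le a ha).trans ?_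
    rw [hsem, norm_sub_rev]
    refine ENNReal.ofReal_le_ofReal (hxa.trans ?_)
    linarith [(hE.pos N).le]

end

/-! ## Dependence of expectations on the trace -/

section Perturbation

variable {F G : Type*} [CStarAlgebra F] [CStarAlgebra G]

/-- Compactness of the unit sphere makes faithfulness quantitative, and homogeneity of degree two
extends the bound to all `x`. -/
theorem exists_mul_norm_sq_le [FiniteDimensional ℂ G] (t : G →ₗ[ℂ] ℂ)
    (ht : ∀ x, t (x * star x) = 0 → x = 0) :
    ∃ c : ℝ, 0 < c ∧ ∀ x, c * ‖x‖ ^ 2 ≤ ‖t (x * star x)‖ := by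
  have : ProperSpace G := FiniteDimensional.proper ℂ G
  have hcont : Continuous fun x : G => ‖t (x * star x)‖ :=
    ((LinearMap.continuous_of_finiteDimensional t).comp
      (continuous_id.mul continuous_star)).norm
  rcases (Metric.sphere (0 : G) 1).eq_empty_or_nonempty with h | h
  · refine ⟨1, one_pos, fun x => ?_⟩
    rcases eq_or_ne x 0 with rfl | hx
    · simp
    · have : ((‖x‖⁻¹ : ℝ) : ℂ) • x ∈ Metric.sphere (0 : G) 1 := by
        rw [mem_sphere_zero_iff_norm, norm_smul, Complex.norm_real, norm_inv, norm_norm,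
          inv_mul_cancel₀ (norm_ne_zero_iff.2 hx)]
      rw [h] at this
      exact this.elim
  · obtain ⟨x₀, hx₀, hmin⟩ := (isCompact_sphere (0 : G) 1).exists_isMinOn h hcont.continuousOn
    refine ⟨‖t (x₀ * star x₀)‖, norm_pos_iff.2 fun h0 => ?_, fun x => ?_⟩
    · rw [mem_sphere_zero_iff_norm, ht x₀ h0, norm_zero] at hx₀
      exact zero_ne_one hx₀
    · rcases eq_or_ne x 0 with rfl | hx
      · simp
      · have hx' := norm_pos_iff.2 hx
        have h1 : ((‖x‖⁻¹ : ℝ) : ℂ) • x ∈ Metric.sphere (0 : G) 1 := by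
          rw [mem_sphere_zero_iff_norm, norm_smul, Complex.norm_real, norm_inv, norm_norm,
            inv_mul_cancel₀ hx'.ne']
        have h2 : ‖t (x₀ * star x₀)‖ ≤ _ := hmin h1
        have e : (((‖x‖⁻¹ : ℝ) : ℂ) • x) * star (((‖x‖⁻¹ : ℝ) : ℂ) • x) =
            (((‖x‖ ^ 2)⁻¹ : ℝ) : ℂ) • (x * star x) := by
          rw [star_smul, smul_mul_smul_comm]
          congr 1
          simp [sq]
        beta_reduce at h2
        rw [e, map_smul, norm_smul, Complex.norm_real, norm_inv, norm_pow, norm_norm,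
          le_inv_mul_iff₀ (by positivity)] at h2
        linarith

/-- With `d = P y - P₀ y`, the defining relations give `t₀ (T (d d*)) = (t₀ - t) (T (P y d*) - y T
d*)`, since `t` vanishes on that argument. Hence `c ‖d‖² ≤ 2 κ ‖y‖ ‖d‖`, and one factor `‖d‖`
cancels. -/
theorem norm_sub_le_of_trace_mul {T : G →⋆ₐ[ℂ] F} {t t₀ : F → ℂ}
    (hsub₀ : ∀ x y, t₀ (x - y) = t₀ x - t₀ y) (hsub : ∀ x y, t (x - y) = t x - t y)
    {P P₀ : F → G} {c κ : ℝ} (hc : 0 < c) (hcx : ∀ x, c * ‖x‖ ^ 2 ≤ ‖t₀ (T (x * star x))‖)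
    (hκ : 0 ≤ κ) (htt : ∀ y, ‖t₀ y - t y‖ ≤ κ * ‖y‖)
    (hP : ∀ y z, t (T (P y * z)) = t (y * T z)) (hP₀ : ∀ y z, t₀ (T (P₀ y * z)) = t₀ (y * T z))
    (hPn : ∀ y, ‖P y‖ ≤ ‖y‖) (y : F) : ‖P y - P₀ y‖ ≤ 2 * κ / c * ‖y‖ := by
  set d := P y - P₀ y with hd
  have e1 : t₀ (T (d * star d)) =
      t₀ (T (P y * star d) - y * T (star d)) - t (T (P y * star d) - y * T (star d)) := by
    nth_rw 1 [hd]
    rw [sub_mul, map_sub, hsub₀, hsub₀, hsub, hP, hP₀]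
    ring
  have h1 : ‖T (P y * star d) - y * T (star d)‖ ≤ 2 * (‖y‖ * ‖d‖) := by
    refine (norm_sub_le _ _).trans ?_
    have h2 : ‖T (P y * star d)‖ ≤ ‖y‖ * ‖d‖ :=
      (NonUnitalStarAlgHom.norm_apply_le T _).trans ((norm_mul_le _ _).trans (by
        rw [norm_star]; gcongr; exact hPn y))
    have h3 : ‖y * T (star d)‖ ≤ ‖y‖ * ‖d‖ := (norm_mul_le _ _).trans (by
      gcongr
      exact (NonUnitalStarAlgHom.norm_apply_le T _).trans (norm_star d).le)
    linarith
  have h2 := hcx d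
  rw [e1] at h2
  have h3 : c * ‖d‖ ^ 2 ≤ κ * (2 * (‖y‖ * ‖d‖)) :=
    h2.trans ((htt _).trans (mul_le_mul_of_nonneg_left h1 hκ))
  rcases (norm_nonneg d).eq_or_lt with h | h
  · rw [← h]; positivity
  · rw [div_mul_eq_mul_div, le_div_iff₀ hc]
    have : ‖d‖ * (‖d‖ * c) ≤ ‖d‖ * (2 * κ * ‖y‖) := by linarith
    exact le_of_mul_le_mul_left this h

end Perturbation

end QuantumMetric

/-! ## Continued fractions of irrational numbers -/

namespace EffrosShen

open Filter

theorem coeff_fract (v : ℝ) (n : ℕ) : coeff (Int.fract v) (n + 1) = coeff v (n + 1) := by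
  have h : (GenContFract.of (Int.fract v)).s = (GenContFract.of v).s := by
    by_cases hv : Int.fract v = 0
    · obtain ⟨z, rfl⟩ : ∃ z : ℤ, v = z := ⟨⌊v⌋, by
        have := Int.floor_add_fract v; rw [hv, add_zero] at this; exact this.symm⟩
      have h0 := GenContFract.of_s_of_int ℝ z
      have h1 := GenContFract.of_s_of_int ℝ 0
      rw [Int.fract_intCast, h0]
      simpa using h1
    · refine Stream'.Seq.ext fun n => ?_
      cases n with
      | zero =>
        have h1 := GenContFract.of_s_head hv
        have h2 := GenContFract.of_s_head (v := Int.fract v) (by rwa [Int.fract_fract])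
        rw [Int.fract_fract] at h2
        exact h2.trans h1.symm
      | succ n => rw [GenContFract.of_s_succ, GenContFract.of_s_succ, Int.fract_fract]
  simp only [coeff, GenContFract.partDens, h]

/-- The Gauss map shifts the expansion. Facts about all coefficients then follow by induction with
`v` varying. -/
theorem coeff_add_two (v : ℝ) (n : ℕ) : coeff v (n + 2) = coeff (Int.fract v)⁻¹ (n + 1) := by
  simp only [coeff, GenContFract.partDens, Stream'.Seq.map_get?, GenContFract.of_s_succ]

theorem coeff_one {v : ℝ} (hv : Int.fract v ≠ 0) : coeff v 1 = ⌊((⌊(Int.fract v)⁻¹⌋ : ℤ) : ℝ)⌋₊ := by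
  have h1 : (GenContFract.of v).s.get? 0 = _ := GenContFract.of_s_head hv
  simp only [coeff, GenContFract.partDens, Stream'.Seq.map_get?, h1, Option.map_some,
    Option.getD_some]

theorem irrational_fract {v : ℝ} (hv : Irrational v) : Irrational (Int.fract v) := by
  have := hv.sub_intCast ⌊v⌋
  rwa [Int.self_sub_floor] at this

theorem fract_ne_zero_of_irrational {v : ℝ} (hv : Irrational v) : Int.fract v ≠ 0 :=
  (irrational_fract hv).ne_zero

theorem eventually_mem_Ioo_floor {v : ℝ} (hv : Irrational v) :
    ∀ᶠ w in 𝓝 v, w ∈ Set.Ioo (⌊v⌋ : ℝ) (⌊v⌋ + 1) :=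
  Ioo_mem_nhds ((Int.floor_le v).lt_of_ne fun h => hv.ne_int _ h.symm) (Int.lt_floor_add_one v)

theorem eventually_floor_eq {v : ℝ} (hv : Irrational v) : ∀ᶠ w in 𝓝 v, ⌊w⌋ = ⌊v⌋ :=
  (eventually_mem_Ioo_floor hv).mono fun _ hw => Int.floor_eq_iff.2 ⟨hw.1.le, hw.2⟩

theorem continuousAt_fract {v : ℝ} (hv : Irrational v) : ContinuousAt Int.fract v := by
  have : (fun w : ℝ => w - ⌊v⌋) =ᶠ[𝓝 v] Int.fract := (eventually_floor_eq hv).mono fun w hw => by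
    rw [← Int.self_sub_floor, hw]
  exact (continuousAt_id.sub continuousAt_const).congr this

theorem continuousAt_inv_fract {v : ℝ} (hv : Irrational v) :
    ContinuousAt (fun w => (Int.fract w)⁻¹) v :=
  (continuousAt_fract hv).inv₀ (fract_ne_zero_of_irrational hv)

/-- The coefficients of the continued fraction are locally constant at irrational numbers. -/
theorem eventually_coeff_succ_eq (n : ℕ) : ∀ {v : ℝ}, Irrational v →
    ∀ᶠ w in 𝓝 v, coeff w (n + 1) = coeff v (n + 1) := by
  induction n with
  | zero =>
    intro v hv
    -- Nearby `w` may be rational, so a nonzero fractional part has to be secured separately.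
    filter_upwards [(continuousAt_fract hv).eventually_ne (fract_ne_zero_of_irrational hv),
      (continuousAt_inv_fract hv).eventually (eventually_floor_eq (irrational_fract hv).inv)]
      with w h1 h2
    rw [coeff_one h1, coeff_one (fract_ne_zero_of_irrational hv), h2]
  | succ n ih =>
    intro v hv
    filter_upwards [(continuousAt_inv_fract hv).eventually (ih (irrational_fract hv).inv)] with w hw
    rw [coeff_add_two, hw, coeff_add_two]

theorem fract_inv_mem {θ : ℝ} (hθ : θ ∈ irrationals) : Int.fract θ⁻¹ ∈ irrationals := by
  have h := irrational_fract hθ.2.2.inv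
  exact ⟨(Int.fract_nonneg _).lt_of_ne h.ne_zero.symm, Int.fract_lt_one _, h⟩

theorem fract_eq {θ : ℝ} (hθ : θ ∈ irrationals) : Int.fract θ = θ :=
  Int.fract_eq_self.2 ⟨hθ.1.le, hθ.2.1⟩

theorem coeff_one_eq {θ : ℝ} (hθ : θ ∈ irrationals) : (coeff θ 1 : ℝ) = ⌊θ⁻¹⌋ := by
  rw [coeff_one (fract_ne_zero_of_irrational hθ.2.2), fract_eq hθ]
  have h : 0 ≤ ⌊θ⁻¹⌋ := Int.floor_nonneg.2 (inv_nonneg.2 hθ.1.le)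
  lift ⌊θ⁻¹⌋ to ℕ using h with m
  simp

theorem coeff_add_two_eq {θ : ℝ} (hθ : θ ∈ irrationals) (n : ℕ) :
    coeff θ (n + 2) = coeff (Int.fract θ⁻¹) (n + 1) := by
  rw [coeff_add_two, fract_eq hθ, coeff_fract]

theorem one_le_coeff (n : ℕ) : ∀ {θ : ℝ}, θ ∈ irrationals → 1 ≤ coeff θ (n + 1) := by
  induction n with
  | zero =>
    intro θ hθ
    have h : (1 : ℝ) ≤ coeff θ 1 := by
      rw [coeff_one_eq hθ]
      have : (1 : ℤ) ≤ ⌊θ⁻¹⌋ := Int.le_floor.2 (by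
        rw [Int.cast_one]; exact (one_le_inv₀ hθ.1).2 hθ.2.1.le)
      exact_mod_cast this
    exact_mod_cast h
  | succ n ih =>
    intro θ hθ
    rw [coeff_add_two_eq hθ]
    exact ih (fract_inv_mem hθ)

theorem le_q {θ : ℝ} (hθ : θ ∈ irrationals) (n : ℕ) : n ≤ q θ n ∧ 1 ≤ q θ n := by
  induction n using Nat.twoStepInduction with
  | zero => exact ⟨zero_le_one, le_rfl⟩
  | one => exact ⟨one_le_coeff 0 hθ, one_le_coeff 0 hθ⟩
  | more n h1 h2 =>
    have h3 : 1 * q θ (n + 1) ≤ coeff θ (n + 2) * q θ (n + 1) :=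
      Nat.mul_le_mul_right _ (one_le_coeff (n + 1) hθ)
    have h4 : q θ (n + 2) = coeff θ (n + 2) * q θ (n + 1) + q θ n := rfl
    rw [one_mul] at h3
    constructor <;> omega

/-- The values of the trace of `AF_θ` on minimal projections. -/
noncomputable def weight (θ : ℝ) : ℕ → ℝ
  | 0 => 1
  | 1 => θ
  | n + 2 => weight θ n - coeff θ (n + 1) * weight θ (n + 1)

/-- Iterated, this writes a weight as a product of iterates of `θ` under the Gauss map, and so shows
the positivity that the subtractive recursion hides. -/
theorem weight_succ (n : ℕ) {θ : ℝ} (hθ : θ ∈ irrationals) :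
    weight θ (n + 1) = θ * weight (Int.fract θ⁻¹) n := by
  induction n using Nat.twoStepInduction with
  | zero => simp [weight]
  | one =>
    change 1 - (coeff θ 1 : ℝ) * θ = θ * Int.fract θ⁻¹
    rw [coeff_one_eq hθ, ← Int.self_sub_floor, mul_sub, mul_inv_cancel₀ hθ.1.ne', mul_comm θ]
  | more n h1 h2 =>
    change weight θ (n + 1) - coeff θ (n + 2) * weight θ (n + 2) =
      θ * (weight (Int.fract θ⁻¹) n - coeff (Int.fract θ⁻¹) (n + 1) * weight (Int.fract θ⁻¹) (n + 1))
    rw [h1, h2, coeff_add_two_eq hθ]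
    ring

theorem weight_pos (n : ℕ) : ∀ {θ : ℝ}, θ ∈ irrationals → 0 < weight θ n := by
  induction n with
  | zero => exact fun _ => one_pos
  | succ n ih =>
    intro θ hθ
    rw [weight_succ n hθ]
    exact mul_pos hθ.1 (ih (fract_inv_mem hθ))

theorem weight_add_two (θ : ℝ) (n : ℕ) :
    weight θ n = coeff θ (n + 1) * weight θ (n + 1) + weight θ (n + 2) := by
  simp [weight]

/-- The value of the trace at the unit. It is conserved because the recursions of `weight` and `q`
are dual to each other. -/
theorem weight_mul_q (θ : ℝ) (n : ℕ) :
    weight θ (n + 1) * q θ (n + 1) + weight θ (n + 2) * q θ n = 1 := by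
  induction n with
  | zero => simp [weight, q]; ring
  | succ n ih =>
    rw [← ih, weight_add_two θ (n + 1)]
    have h4 : q θ (n + 2) = coeff θ (n + 2) * q θ (n + 1) + q θ n := rfl
    rw [h4]
    push_cast
    ring

theorem tendsto_weight {θ : ℝ} (hθ : Irrational θ) (n : ℕ) :
    Tendsto (fun η => weight η n) (𝓝 θ) (𝓝 (weight θ n)) := by
  induction n using Nat.twoStepInduction with
  | zero => exact tendsto_const_nhds
  | one => exact tendsto_id
  | more n h1 h2 =>
    refine (h1.sub (h2.const_mul (coeff θ (n + 1) : ℝ))).congr' ?_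
    filter_upwards [eventually_coeff_succ_eq n hθ] with η hη
    change _ = weight η n - coeff η (n + 1) * weight η (n + 1)
    rw [hη]

/-- A nonnegative solution of the recursion for the weights is determined by its first value. -/
theorem eq_weight {θ : ℝ} (hθ : θ ∈ irrationals) {c : ℕ → ℝ} (hc0 : c 0 = 1) (hc : ∀ n, 0 ≤ c n)
    (hrec : ∀ n, c n = coeff θ (n + 1) * c (n + 1) + c (n + 2))
    (hle : ∀ n, c (n + 1) * q θ (n + 1) ≤ 1) (n : ℕ) : c n = weight θ n := by
  set D : ℕ → ℝ := fun n => c n - weight θ n with hD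
  have hDrec : ∀ n, D (n + 2) = D n - coeff θ (n + 1) * D (n + 1) := fun n => by
    simp only [hD]
    linear_combination weight_add_two θ n - hrec n
  -- Since `D 0 = 0`, the recursion makes `D` a multiple of `D 1`. The signs alternate, so the
  -- contributions add up in absolute value and the factor stays at least `1`.
  have key : ∀ n, ∃ P Q : ℝ, 0 ≤ P ∧ 1 ≤ Q ∧ D n = -(-1) ^ n * P * D 1 ∧
      D (n + 1) = (-1) ^ n * Q * D 1 := by
    intro n
    induction n with
    | zero => exact ⟨0, 1, le_rfl, le_rfl, by simp [hD, hc0, weight], by simp⟩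
    | succ n ih =>
      obtain ⟨P, Q, hP, hQ, h1, h2⟩ := ih
      have hr : (1 : ℝ) ≤ coeff θ (n + 1) := by exact_mod_cast one_le_coeff n hθ
      refine ⟨Q, P + coeff θ (n + 1) * Q, by linarith, by nlinarith, ?_, ?_⟩
      · rw [h2, pow_succ]; ring
      · rw [hDrec, h1, h2, pow_succ]; ring
  -- Both `c (n + 1)` and the weight lie in `[0, 1 / q]`, so their difference is at most `1 / q ≤ 1
  -- / (n + 1)`.
  have hsmall : ∀ n : ℕ, |D 1| ≤ 1 / ((n : ℝ) + 1) := by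
    intro n
    obtain ⟨P, Q, hP, hQ, h1, h2⟩ := key n
    have h3 : |D 1| ≤ |D (n + 1)| := by
      rw [h2, abs_mul, abs_mul, abs_pow, abs_neg, abs_one, one_pow, one_mul,
        abs_of_nonneg (by linarith : (0 : ℝ) ≤ Q)]
      nlinarith [abs_nonneg (D 1)]
    refine h3.trans ?_
    have hq : ((n : ℝ) + 1) ≤ q θ (n + 1) := by exact_mod_cast (le_q hθ (n + 1)).1
    have hw := weight_mul_q θ n
    have hw2 := mul_nonneg (weight_pos (n + 2) hθ).le (Nat.cast_nonneg (α := ℝ) (q θ n))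
    have hw1 := weight_pos (n + 1) hθ
    rw [le_div_iff₀ (by positivity)]
    calc |D (n + 1)| * ((n : ℝ) + 1) ≤ |D (n + 1)| * q θ (n + 1) := by gcongr
      _ = |D (n + 1) * q θ (n + 1)| := by rw [abs_mul, Nat.abs_cast]
      _ ≤ 1 := by
        have h5 := mul_nonneg (hc (n + 1)) (Nat.cast_nonneg (α := ℝ) (q θ (n + 1)))
        have h6 := mul_nonneg hw1.le (Nat.cast_nonneg (α := ℝ) (q θ (n + 1)))
        simp only [hD]
        rw [sub_mul, abs_le]
        constructor <;> linarith [hle n]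
  have hD1 : D 1 = 0 := by
    have h := ge_of_tendsto' tendsto_one_div_add_atTop_nhds_zero_nat hsmall
    exact abs_nonpos_iff.1 h
  obtain ⟨P, Q, -, -, h1, -⟩ := key n
  rw [hD1, mul_zero] at h1
  exact sub_eq_zero.1 h1

end EffrosShen

/-! ## The trace of the Effros-Shen algebras -/

namespace EffrosShen

open QuantumMetric Filter

/-- The unnormalized trace of a matrix, as a functional on the C*-algebra of matrices. -/
noncomputable def matTrace (m : ℕ) : Mat m →ₗ[ℂ] ℂ :=
  Matrix.traceLinearMap (Fin m) ℂ ℂ ∘ₗ (CStarMatrix.ofMatrixₗ (R := ℂ)).symm.toLinearMap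

theorem matTrace_mul_comm {m : ℕ} (a b : Mat m) : matTrace m (a * b) = matTrace m (b * a) :=
  Matrix.trace_mul_comm (CStarMatrix.ofMatrix.symm a) (CStarMatrix.ofMatrix.symm b)

theorem matTrace_one (m : ℕ) : matTrace m 1 = m := by
  have := Matrix.trace_one (n := Fin m) (R := ℂ)
  rw [Fintype.card_fin] at this
  exact this

theorem matTrace_star_mul_self_nonneg {m : ℕ} (a : Mat m) : 0 ≤ matTrace m (star a * a) :=
  (Matrix.posSemidef_conjTranspose_mul_self (CStarMatrix.ofMatrix.symm a)).trace_nonneg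

theorem matTrace_star_mul_self_eq_zero {m : ℕ} {a : Mat m} (h : matTrace m (star a * a) = 0) :
    a = 0 :=
  Matrix.trace_conjTranspose_mul_self_eq_zero_iff (A := CStarMatrix.ofMatrix.symm a) |>.1 h

theorem norm_matTrace_le {m : ℕ} (a : Mat m) : ‖matTrace m a‖ ≤ m * ‖a‖ := by
  have h : ‖∑ i : Fin m, a i i‖ ≤ ∑ _i : Fin m, ‖a‖ :=
    norm_sum_le_of_le _ fun i _ => CStarMatrix.norm_entry_le_norm
  rw [Finset.sum_const, Finset.card_univ, Fintype.card_fin, nsmul_eq_mul] at h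
  exact h

theorem trace_blockDiag {r m n N : ℕ} (h : N = r * m + n) (a : Matrix (Fin m) (Fin m) ℂ)
    (b : Matrix (Fin n) (Fin n) ℂ) : (blockDiag h a b).trace = r * a.trace + b.trace := by
  have h1 : (blockDiag h a b).trace = (Matrix.fromBlocks
      (Matrix.kronecker (1 : Matrix (Fin r) (Fin r) ℂ) a) 0 0 b).trace := by
    simp only [Matrix.trace, blockDiag, Matrix.reindex_apply, Matrix.diag_apply,
      Matrix.submatrix_apply]
    exact Fintype.sum_equiv (blockEquiv h).symm _ _ fun _ => rfl
  have h2 := Matrix.trace_kronecker (1 : Matrix (Fin r) (Fin r) ℂ) a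
  rw [Matrix.trace_one, Fintype.card_fin] at h2
  rw [h1, ← h2]
  simp [Matrix.trace, Fintype.sum_sum_type]

/-- The weighted trace of a pair of matrices. -/
noncomputable def pairTrace (m n : ℕ) (c d : ℂ) : Mat m × Mat n →ₗ[ℂ] ℂ :=
  c • (matTrace m ∘ₗ LinearMap.fst ℂ _ _) + d • (matTrace n ∘ₗ LinearMap.snd ℂ _ _)

theorem pairTrace_apply {m n : ℕ} (c d : ℂ) (p : Mat m × Mat n) :
    pairTrace m n c d p = c * matTrace m p.1 + d * matTrace n p.2 := rfl

theorem pairTrace_mul_comm {m n : ℕ} (c d : ℂ) (p p' : Mat m × Mat n) :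
    pairTrace m n c d (p * p') = pairTrace m n c d (p' * p) := by
  rw [pairTrace_apply, pairTrace_apply, Prod.fst_mul, Prod.snd_mul, matTrace_mul_comm p.1,
    matTrace_mul_comm p.2]
  rfl

/-- The connecting map acts on weights by `(c, d) ↦ (r c + d, c)`, which is the source of the
recursion for the trace. -/
theorem pairTrace_embed {r m n N : ℕ} (h : N = r * m + n) (c d : ℂ) (p : Mat m × Mat n) :
    pairTrace N m c d (embed h p) = pairTrace m n (r * c + d) c p := by
  have h1 : matTrace N (embed h p).1 = r * matTrace m p.1 + matTrace n p.2 :=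
    trace_blockDiag h _ _
  have h2 : (embed h p).2 = p.1 := rfl
  rw [pairTrace_apply, pairTrace_apply, h1, h2]
  ring

theorem norm_pairTrace_le {m n : ℕ} (c d : ℂ) (p : Mat m × Mat n) :
    ‖pairTrace m n c d p‖ ≤ (‖c‖ * m + ‖d‖ * n) * ‖p‖ := by
  rw [pairTrace_apply]
  refine (norm_add_le _ _).trans ?_
  rw [norm_mul, norm_mul, add_mul, mul_assoc, mul_assoc]
  gcongr
  · exact (norm_matTrace_le _).trans (by gcongr; exact norm_fst_le p)
  · exact (norm_matTrace_le _).trans (by gcongr; exact norm_snd_le p)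

theorem pairTrace_nonneg {m n : ℕ} {c d : ℝ} (hc : 0 ≤ c) (hd : 0 ≤ d) (p : Mat m × Mat n) :
    0 ≤ pairTrace m n c d (star p * p) := by
  rw [pairTrace_apply]
  exact add_nonneg (mul_nonneg (Complex.zero_le_real.2 hc) (matTrace_star_mul_self_nonneg p.1))
    (mul_nonneg (Complex.zero_le_real.2 hd) (matTrace_star_mul_self_nonneg p.2))

theorem eq_zero_of_pairTrace {m n : ℕ} {c d : ℝ} (hc : 0 < c) (hd : 0 < d) {p : Mat m × Mat n}
    (h : pairTrace m n c d (star p * p) = 0) : p = 0 := by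
  have h1 := mul_nonneg (Complex.zero_le_real.2 hc.le) (matTrace_star_mul_self_nonneg p.1)
  have h2 := mul_nonneg (Complex.zero_le_real.2 hd.le) (matTrace_star_mul_self_nonneg p.2)
  have h3 := (add_eq_zero_iff_of_nonneg h1 h2).1 h
  have hc' : (c : ℂ) ≠ 0 := Complex.ofReal_ne_zero.2 hc.ne'
  have hd' : (d : ℂ) ≠ 0 := Complex.ofReal_ne_zero.2 hd.ne'
  exact Prod.ext (matTrace_star_mul_self_eq_zero ((mul_eq_zero.1 h3.1).resolve_left hc'))
    (matTrace_star_mul_self_eq_zero ((mul_eq_zero.1 h3.2).resolve_left hd'))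

/-- The matrix unit at the first diagonal place. -/
noncomputable def cornerUnit (m : ℕ) [NeZero m] : Mat m :=
  CStarMatrix.ofMatrix (Matrix.single 0 0 1)

theorem star_cornerUnit_mul_self (m : ℕ) [NeZero m] :
    star (cornerUnit m) * cornerUnit m = cornerUnit m := by
  have : (Matrix.single (0 : Fin m) (0 : Fin m) (1 : ℂ)).conjTranspose * Matrix.single 0 0 1 =
      Matrix.single 0 0 1 := by
    rw [Matrix.conjTranspose_single, Matrix.single_mul_single_same, star_one, one_mul]
  exact this

theorem matTrace_cornerUnit (m : ℕ) [NeZero m] : matTrace m (cornerUnit m) = 1 :=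
  Matrix.trace_single_eq_same (0 : Fin m) (1 : ℂ)

/-- From `e_ij = e_i0 e_0j`, traciality gives `g e_ij = g (e_0j e_i0)`, which is `g e_00` if `i = j`
and `0` otherwise. -/
theorem eq_matTrace_of_tracial {m : ℕ} [NeZero m] (g : Mat m →ₗ[ℂ] ℂ)
    (hg : ∀ a b, g (a * b) = g (b * a)) (a : Mat m) : g a = g (cornerUnit m) * matTrace m a := by
  let f : Matrix (Fin m) (Fin m) ℂ →ₗ[ℂ] ℂ := g ∘ₗ (CStarMatrix.ofMatrixₗ (R := ℂ)).toLinearMap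
  have hf : ∀ a b, f (a * b) = f (b * a) := fun a b =>
    hg (CStarMatrix.ofMatrix a) (CStarMatrix.ofMatrix b)
  obtain ⟨s, hs⟩ : ∃ s, s = f (Matrix.single 0 0 1) := ⟨_, rfl⟩
  have hunit : ∀ i j (z : ℂ), f (Matrix.single i j z) = if i = j then s * z else 0 := by
    intro i j z
    have h1 : Matrix.single i j z = Matrix.single i 0 z * Matrix.single (0 : Fin m) j 1 := by
      rw [Matrix.single_mul_single_same, mul_one]
    rw [h1, hf]
    split_ifs with hij
    · subst hij
      rw [Matrix.single_mul_single_same, one_mul]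
      have : Matrix.single (0 : Fin m) (0 : Fin m) z = z • Matrix.single 0 0 1 := by
        rw [Matrix.smul_single, smul_eq_mul, mul_one]
      rw [this, map_smul, smul_eq_mul, mul_comm, hs]
    · rw [Matrix.single_mul_single_of_ne (h := fun h => hij h.symm), map_zero]
  have hfa : ∀ a : Matrix (Fin m) (Fin m) ℂ, f a = s * a.trace := by
    intro a
    conv_lhs => rw [Matrix.matrix_eq_sum_single a]
    simp only [map_sum, hunit, Finset.sum_ite_eq, Finset.mem_univ, if_true, Matrix.trace,
      Matrix.diag_apply, Finset.mul_sum]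
  refine (hfa (CStarMatrix.ofMatrix.symm a)).trans ?_
  rw [hs]
  rfl

theorem eq_pairTrace_of_tracial {m n : ℕ} [NeZero m] [NeZero n] (g : Mat m × Mat n →ₗ[ℂ] ℂ)
    (hg : ∀ a b, g (a * b) = g (b * a)) (p : Mat m × Mat n) :
    g p = pairTrace m n (g (cornerUnit m, 0)) (g (0, cornerUnit n)) p := by
  have h1 := eq_matTrace_of_tracial (g ∘ₗ LinearMap.inl ℂ (Mat m) (Mat n)) (fun a b => by
    have := hg (a, 0) (b, 0)
    simpa using this) p.1
  have h2 := eq_matTrace_of_tracial (g ∘ₗ LinearMap.inr ℂ (Mat m) (Mat n)) (fun a b => by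
    have := hg (0, a) (0, b)
    simpa using this) p.2
  have h3 : g p = g (p.1, 0) + g (0, p.2) := by
    rw [← map_add]; simp
  rw [h3, pairTrace_apply]
  exact congrArg₂ (· + ·) h1 h2

/-! ### The trace of `AF_θ` -/

instance finiteDimensional_mat (m : ℕ) : FiniteDimensional ℂ (Mat m) :=
  Module.Finite.equiv (CStarMatrix.ofMatrixₗ (R := ℂ) : Matrix (Fin m) (Fin m) ℂ ≃ₗ[ℂ] Mat m)

theorem finrank_mat (m : ℕ) : Module.finrank ℂ (Mat m) = m * m := by
  have e := (CStarMatrix.ofMatrixₗ (R := ℂ) : Matrix (Fin m) (Fin m) ℂ ≃ₗ[ℂ] Mat m).finrank_eq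
  rw [← e, Module.finrank_matrix]
  simp

instance finiteDimensional_obj (θ : ℝ) : ∀ n, FiniteDimensional ℂ ((seq θ).obj n)
  | 0 => inferInstanceAs (FiniteDimensional ℂ ℂ)
  | n + 1 => inferInstanceAs (FiniteDimensional ℂ (Mat (q θ (n + 1)) × Mat (q θ n)))

theorem finrank_obj_zero (θ : ℝ) : Module.finrank ℂ ((seq θ).obj 0) = 1 :=
  Module.finrank_self ℂ

theorem finrank_obj_succ (θ : ℝ) (n : ℕ) : Module.finrank ℂ ((seq θ).obj (n + 1)) =
    q θ (n + 1) * q θ (n + 1) + q θ n * q θ n := by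
  have : Module.finrank ℂ (Mat (q θ (n + 1)) × Mat (q θ n)) = _ := Module.finrank_prod
  rw [finrank_mat, finrank_mat] at this
  exact this

/-- The restriction of the trace of `AF_θ` to the algebras of its inductive sequence. -/
noncomputable def objTrace (θ : ℝ) : ∀ n, (seq θ).obj n →ₗ[ℂ] ℂ
  | 0 => (LinearMap.id : ℂ →ₗ[ℂ] ℂ)
  | n + 1 => pairTrace (q θ (n + 1)) (q θ n) (weight θ (n + 1)) (weight θ (n + 2))

theorem objTrace_one (θ : ℝ) : ∀ n, objTrace θ n 1 = 1
  | 0 => rfl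
  | n + 1 => by
    change (weight θ (n + 1) : ℂ) * matTrace _ 1 + (weight θ (n + 2) : ℂ) * matTrace _ 1 = 1
    rw [matTrace_one, matTrace_one]
    exact_mod_cast weight_mul_q θ n

theorem objTrace_map (θ : ℝ) : ∀ n x, objTrace θ (n + 1) ((seq θ).map n x) = objTrace θ n x
  | 0, x => by
    have h : (seq θ).map 0 x = (show ℂ from x) • (1 : (seq θ).obj 1) :=
      Algebra.algebraMap_eq_smul_one (A := obj θ 1) (show ℂ from x)
    rw [h, map_smul, objTrace_one, smul_eq_mul, mul_one]
    rfl
  | n + 1, x => by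
    refine (pairTrace_embed (r := coeff θ (n + 2)) (m := q θ (n + 1)) (n := q θ n)
      (N := q θ (n + 2)) rfl (weight θ (n + 2)) (weight θ (n + 3)) x).trans ?_
    change _ = pairTrace (q θ (n + 1)) (q θ n) (weight θ (n + 1)) (weight θ (n + 2)) x
    rw [weight_add_two θ (n + 1)]
    push_cast
    rfl

theorem objTrace_mul_comm (θ : ℝ) : ∀ n x y, objTrace θ n (x * y) = objTrace θ n (y * x)
  | 0, x, y => mul_comm (show ℂ from x) (show ℂ from y)
  | _ + 1, x, y => pairTrace_mul_comm _ _ x y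

variable {θ : ℝ}

theorem norm_objTrace_le (hθ : θ ∈ irrationals) : ∀ n x, ‖objTrace θ n x‖ ≤ ‖x‖
  | 0, _ => le_rfl
  | n + 1, x => by
    refine (norm_pairTrace_le (m := q θ (n + 1)) (n := q θ n) _ _ x).trans (le_of_eq ?_)
    rw [Complex.norm_real, Complex.norm_real, Real.norm_of_nonneg (weight_pos (n + 1) hθ).le,
      Real.norm_of_nonneg (weight_pos (n + 2) hθ).le, weight_mul_q, one_mul]
    rfl

theorem objTrace_nonneg (hθ : θ ∈ irrationals) : ∀ n x, 0 ≤ objTrace θ n (star x * x)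
  | 0, x => star_mul_self_nonneg (show ℂ from x)
  | n + 1, x => pairTrace_nonneg (m := q θ (n + 1)) (n := q θ n) (weight_pos (n + 1) hθ).le
      (weight_pos (n + 2) hθ).le x

theorem eq_zero_of_objTrace (hθ : θ ∈ irrationals) :
    ∀ n x, objTrace θ n (star x * x) = 0 → x = 0
  | 0, x => fun h => (CStarRing.star_mul_self_eq_zero_iff (show ℂ from x)).1 h
  | n + 1, _ => fun h => eq_zero_of_pairTrace (m := q θ (n + 1)) (n := q θ n)
      (weight_pos (n + 1) hθ) (weight_pos (n + 2) hθ) h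

theorem neZero_q (hθ : θ ∈ irrationals) (n : ℕ) : NeZero (q θ n) :=
  ⟨(Nat.lt_of_lt_of_le zero_lt_one (le_q hθ n).2).ne'⟩

/-- On each level the state is a weighted trace. Compatibility with the connecting maps gives the
recursion, and positivity with normalization gives the bounds, so that `eq_weight` identifies the
weights. -/
theorem tracialState_ι (hθ : θ ∈ irrationals) {σ : WeakDual ℂ (AF θ)} (hσ : IsTracialState σ) :
    ∀ n x, σ ((seq θ).ι n x) = objTrace θ n x := by
  have := neZero_q hθ
  let g : ∀ n, Mat (q θ (n + 1)) × Mat (q θ n) →ₗ[ℂ] ℂ := fun n =>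
    (σ : AF θ →L[ℂ] ℂ).toLinearMap ∘ₗ ((seq θ).ι (n + 1)).toAlgHom.toLinearMap
  have hmul : ∀ m (x y : (seq θ).obj m), σ ((seq θ).ι m (x * y)) = σ ((seq θ).ι m (y * x)) :=
    fun m x y => by rw [map_mul ((seq θ).ι m), map_mul ((seq θ).ι m), hσ.2]
  have hnonneg : ∀ m (x : (seq θ).obj m), 0 ≤ σ ((seq θ).ι m (star x * x)) := fun m x => by
    rw [map_mul, map_star]; exact hσ.1.2 _
  have hg : ∀ n x y, g n (x * y) = g n (y * x) := fun n x y => hmul (n + 1) x y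
  have hpos : ∀ n x, 0 ≤ g n (star x * x) := fun n x => hnonneg (n + 1) x
  have hone : ∀ n, g n 1 = 1 := fun n => by
    have h := hσ.1.1
    rw [← map_one ((seq θ).ι (n + 1))] at h
    exact h
  have hgmap : ∀ n x, g (n + 1) (embed (r := coeff θ (n + 2)) (N := q θ (n + 2)) rfl x) = g n x :=
    fun n x => congrArg σ ((seq θ).ι_map (n + 1) x)
  set c : ℕ → ℂ := fun n => g n (cornerUnit _, 0)
  set d : ℕ → ℂ := fun n => g n (0, cornerUnit _)
  have hgc : ∀ n x, g n x = pairTrace _ _ (c n) (d n) x := fun n x =>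
    eq_pairTrace_of_tracial (g n) (hg n) x
  have hc0 : ∀ n, 0 ≤ c n := fun n => by
    have := hpos n (cornerUnit _, 0)
    have e : star ((cornerUnit (q θ (n + 1)), 0) : Mat (q θ (n + 1)) × Mat (q θ n)) *
        (cornerUnit (q θ (n + 1)), 0) = (cornerUnit (q θ (n + 1)), 0) :=
      Prod.ext (star_cornerUnit_mul_self _) (mul_zero _)
    rwa [e] at this
  have hd0 : ∀ n, 0 ≤ d n := fun n => by
    have := hpos n (0, cornerUnit _)
    have e : star ((0, cornerUnit (q θ n)) : Mat (q θ (n + 1)) × Mat (q θ n)) *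
        (0, cornerUnit (q θ n)) = (0, cornerUnit (q θ n)) :=
      Prod.ext (mul_zero _) (star_cornerUnit_mul_self _)
    rwa [e] at this
  have hsum : ∀ n, c n * q θ (n + 1) + d n * q θ n = 1 := fun n => by
    have h := hone n
    rw [hgc, pairTrace_apply, Prod.fst_one, Prod.snd_one, matTrace_one, matTrace_one] at h
    exact h
  -- Evaluate the compatibility relation at the corner units of the two summands.
  have hrec : ∀ n, c n = coeff θ (n + 2) * c (n + 1) + d (n + 1) ∧ d n = c (n + 1) := fun n => by
    have h : ∀ x, pairTrace _ _ (coeff θ (n + 2) * c (n + 1) + d (n + 1)) (c (n + 1)) x = g n x :=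
      fun x => (pairTrace_embed (r := coeff θ (n + 2)) (N := q θ (n + 2)) rfl (c (n + 1))
        (d (n + 1)) x).symm.trans ((hgc (n + 1) _).symm.trans (hgmap n x))
    have h1 := h (cornerUnit _, 0)
    have h2 := h (0, cornerUnit _)
    rw [pairTrace_apply, matTrace_cornerUnit, map_zero, mul_one, mul_zero, add_zero] at h1
    rw [pairTrace_apply, matTrace_cornerUnit, map_zero, mul_one, mul_zero, zero_add] at h2
    exact ⟨h1.symm, h2.symm⟩
  have hre : ∀ n, ((c n).re : ℂ) = c n := fun n =>
    Complex.ext rfl (Complex.nonneg_iff.1 (hc0 n)).2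
  have hdre : ∀ n, ((d n).re : ℂ) = d n := fun n =>
    Complex.ext rfl (Complex.nonneg_iff.1 (hd0 n)).2
  have hd0' : ∀ n, 0 ≤ (d n).re := fun n => (Complex.nonneg_iff.1 (hd0 n)).1
  have hsum' : ∀ n, (c n).re * q θ (n + 1) + (d n).re * q θ n = 1 := fun n => by
    have h := hsum n
    rw [← hre, ← hdre] at h
    exact_mod_cast h
  -- The functional `g n` lives on level `n + 1`, so a leading `1`, the value at level `0`, aligns
  -- the indices: `c n` is `C (n + 1)` and `d n` is `C (n + 2)`.
  let C : ℕ → ℝ := fun n => match n with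
    | 0 => 1
    | n + 1 => (c n).re
  have hdC : ∀ n, (d n).re = C (n + 2) := fun n => by rw [(hrec n).2]
  have hC := eq_weight hθ (c := C) rfl (fun n => by
      cases n with
      | zero => exact zero_le_one
      | succ n => exact (Complex.nonneg_iff.1 (hc0 n)).1) (fun n => by
      cases n with
      | zero =>
        -- The first recursion step is the normalization at level one, as `q 0 = 1` and `q 1` is the
        -- first coefficient.
        have h := hsum' 0
        rw [hdC] at h
        change (1 : ℝ) = coeff θ 1 * (c 0).re + C 2
        rw [← h, mul_comm]
        simp [q]
      | succ n =>
        have h := (hrec n).1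
        rw [← hre, ← hre (n + 1), ← hdre] at h
        change (c n).re = coeff θ (n + 2) * (c (n + 1)).re + C (n + 3)
        rw [← hdC (n + 1)]
        exact_mod_cast h) (fun n => by
      have h := hsum' n
      have := mul_nonneg (hd0' n) (Nat.cast_nonneg (α := ℝ) (q θ n))
      change (c n).re * _ ≤ 1
      linarith)
  have hsucc : ∀ n x, σ ((seq θ).ι (n + 1) x) = objTrace θ (n + 1) x := fun n x => by
    have h1 : c n = (weight θ (n + 1) : ℝ) := by rw [← hC (n + 1), ← hre]
    have h2 : d n = (weight θ (n + 2) : ℝ) := by rw [← hC (n + 2), ← hdC, hdre]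
    exact (hgc n x).trans (congrArg₂ (fun u v => pairTrace _ _ u v x) h1 h2)
  intro n x
  rw [← (seq θ).ι_map, hsucc, objTrace_map]

theorem existsUnique_isTracialState (hθ : θ ∈ irrationals) :
    ∃! τ : WeakDual ℂ (AF θ), IsTracialState τ := by
  obtain ⟨σ, hσ⟩ := (seq θ).exists_functional (objTrace θ) (norm_objTrace_le hθ) (objTrace_map θ)
  refine ⟨σ, InductiveSeq.isTracialState_of_forall ?_ (fun n x => ?_) (fun n x y => ?_),
    fun σ' hσ' => InductiveSeq.functional_ext fun n x => ?_⟩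
  · rw [← map_one ((seq θ).ι 0), hσ, objTrace_one]
  · rw [hσ]; exact objTrace_nonneg hθ n x
  · rw [hσ, hσ, objTrace_mul_comm]
  · rw [tracialState_ι hθ hσ', hσ]

theorem isTracialState_trace (hθ : θ ∈ irrationals) : IsTracialState (trace θ) :=
  Classical.epsilon_spec (existsUnique_isTracialState hθ).exists

theorem trace_ι (hθ : θ ∈ irrationals) (n : ℕ) (x : (seq θ).obj n) :
    trace θ ((seq θ).ι n x) = objTrace θ n x :=
  tracialState_ι hθ (isTracialState_trace hθ) n x

theorem isFaithfulTrace_trace (hθ : θ ∈ irrationals) : (seq θ).IsFaithfulTrace (trace θ) where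
  tracial := isTracialState_trace hθ
  faithful n x h := eq_zero_of_objTrace hθ n x (by rwa [trace_ι hθ] at h)

theorem le_finrank_obj (hθ : θ ∈ irrationals) (n : ℕ) :
    n ≤ Module.finrank ℂ ((seq θ).obj n) ∧ 1 ≤ Module.finrank ℂ ((seq θ).obj n) := by
  cases n with
  | zero => exact ⟨Nat.zero_le _, (finrank_obj_zero θ).ge⟩
  | succ n =>
    rw [finrank_obj_succ]
    have h1 := le_q hθ (n + 1)
    have h2 : 1 * q θ (n + 1) ≤ q θ (n + 1) * q θ (n + 1) := Nat.mul_le_mul_right _ h1.2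
    constructor <;> omega

theorem not_finiteDimensional (hθ : θ ∈ irrationals) : ¬ FiniteDimensional ℂ (AF θ) := by
  intro hfd
  obtain ⟨n, hn⟩ : ∃ n, n = Module.finrank ℂ (AF θ) + 1 := ⟨_, rfl⟩
  have h1 : Module.finrank ℂ ((seq θ).obj n) ≤ Module.finrank ℂ (AF θ) := LinearMap.finrank_le_finrank_of_injective
    (f := ((seq θ).ι n).toAlgHom.toLinearMap) ((seq θ).ι_injective n)
  have h2 := (le_finrank_obj hθ n).1
  omega

/-! ### The Lip-norms -/

variable {k : ℝ}

theorem dimSeq_pos (hθ : θ ∈ irrationals) (n : ℕ) : 0 < (seq θ).dimSeq k n := by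
  have h : (0 : ℝ) < Module.finrank ℂ ((seq θ).obj n) := by
    exact_mod_cast (le_finrank_obj hθ n).2
  exact one_div_pos.2 (Real.rpow_pos_of_pos h k)

/-- The index is a successor so that the chosen level is a pair of matrix algebras, where the traces
are compared through their weights. -/
theorem exists_dimSeq_le (hk : 0 < k) (hθ : θ ∈ irrationals) {ε : ℝ} (hε : 0 < ε) :
    ∃ n, (seq θ).dimSeq k (n + 1) ≤ ε := by
  obtain ⟨n, hn⟩ := (((tendsto_rpow_atTop hk).comp tendsto_natCast_atTop_atTop).eventually_ge_atTop
    (1 / ε)).exists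
  refine ⟨n, ?_⟩
  have h1 : (n : ℝ) ^ k ≤ (Module.finrank ℂ ((seq θ).obj (n + 1)) : ℝ) ^ k :=
    Real.rpow_le_rpow (Nat.cast_nonneg n)
      (by exact_mod_cast n.le_succ.trans (le_finrank_obj hθ (n + 1)).1) hk.le
  have h2 : (0 : ℝ) < 1 / ε := one_div_pos.2 hε
  exact (one_div_le hε (h2.trans_le (hn.trans h1))).1 (hn.trans h1)

theorem exists_eq_smul_one (θ : ℝ) (x : (seq θ).obj 0) :
    ∃ c : ℂ, x = c • (1 : (seq θ).obj 0) :=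
  ⟨(show ℂ from x), (mul_one (show ℂ from x)).symm⟩

theorem isExpectationSeq_expect (hk : 0 < k) (hθ : θ ∈ irrationals) :
    IsExpectationSeq ((seq θ).expect (trace θ)) ((seq θ).dimSeq k) :=
  (isFaithfulTrace_trace hθ).isExpectationSeq (dimSeq_pos hθ)
    (fun _ hε => (exists_dimSeq_le hk hθ hε).imp' (· + 1) fun _ h => h) (exists_eq_smul_one θ)

theorem isLipNorm_lip (hk : 0 < k) (hθ : θ ∈ irrationals) : IsLipNorm 2 0 (lip k θ) :=
  (isExpectationSeq_expect hk hθ).isLipNorm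

end EffrosShen

/-! ### Short bridges between sequences with common initial algebras -/

namespace QuantumMetric

namespace InductiveSeq

variable {I I₀ : InductiveSeq.{u}} [hfin : ∀ n, FiniteDimensional ℂ (I.obj n)]
  [Nontrivial (I.obj 0)] [hfin₀ : ∀ n, FiniteDimensional ℂ (I₀.obj n)] [Nontrivial (I₀.obj 0)]
  {μ : WeakDual ℂ I.Limit} {μ₀ : WeakDual ℂ I₀.Limit}

/-- If the first `N` algebras of two inductive sequences agree and the traces are close on the
`N`-th algebra, then there is a short bridge from the first limit to the `N`-th algebra with the
Lip-norm of the second limit. -/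
theorem exists_bridge_length_le (hμ : I.IsFaithfulTrace μ) (hμ₀ : I₀.IsFaithfulTrace μ₀) {N : ℕ}
    (Φ : ∀ n, n ≤ N → I₀.obj n ≃⋆ₐ[ℂ] I.obj n)
    (hΦ : ∀ n (h : n + 1 ≤ N) x,
      Φ (n + 1) h (I₀.map n x) = I.map n (Φ n (n.le_succ.trans h) x))
    {β β₀ : ℕ → ℝ} (hE : IsExpectationSeq (I.expect μ) β)
    (hE₀ : IsExpectationSeq (hμ₀.restrictExpect N) β₀) (hββ₀ : ∀ n ≤ N, β n = β₀ n)
    {κ η c : ℝ} (hκ : 0 ≤ κ) (hη : 0 ≤ η) (hc : 0 < c)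
    (hcx : ∀ x : I₀.obj N, c * ‖x‖ ^ 2 ≤ ‖μ₀ (I₀.ι N (x * star x))‖)
    (htt : ∀ y : I₀.obj N, ‖μ₀ (I₀.ι N y) - μ (I.ι N (Φ N le_rfl y))‖ ≤ κ * ‖y‖)
    (hκη : ∀ n ≤ N, 2 * κ / c ≤ η * β n) :
    ∃ γ : Bridge I.Limit (I₀.obj N),
      γ.length (lipSup (I.expect μ) β) (lipSup (hμ₀.restrictExpect N) β₀) ≤
        ENNReal.ofReal (β N + η * β 0 * β 0) := by
  have hΦt : ∀ {n m : ℕ} (h : n ≤ m) (hm : m ≤ N) x,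
      Φ m hm (I₀.trans h x) = I.trans h (Φ n (h.trans hm) x) := by
    intro n m h
    induction m, h using Nat.le_induction with
    | base => intro hm x; rw [trans_self, trans_self]
    | succ m h ih => intro hm x; rw [I₀.trans_succ h, hΦ, ih, I.trans_succ h]
  let j : I₀.obj N →⋆ₐ[ℂ] I.Limit :=
    (I.ι N).comp (Φ N le_rfl : I₀.obj N →⋆ₐ[ℂ] I.obj N)
  have hj : ∀ x, j x = I.ι N (Φ N le_rfl x) := fun x => rfl
  have hjinj : Function.Injective j := fun x y hxy =>
    (Φ N le_rfl).injective (I.ι_injective N hxy)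
  have hjt : ∀ {n} (h : n ≤ N) x, j (I₀.trans h x) = I.ι n (Φ n h x) := fun h x => by
    rw [hj, hΦt, I.ι_trans]
  let P : I.Limit →L[ℂ] I₀.obj N :=
    (homCLM ((Φ N le_rfl).symm : I.obj N →⋆ₐ[ℂ] I₀.obj N)).comp (hμ.proj N)
  have hPa : ∀ a, P a = (Φ N le_rfl).symm (hμ.proj N a) := fun a => rfl
  have hjP : ∀ a, j (P a) = I.expect μ N a := fun a => by
    rw [hj, hPa, StarAlgEquiv.apply_symm_apply, hμ.expect_apply]
  have hP : IsExpectation μ j P :=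
    { left_inv := fun x => by
        rw [hPa, hj, (hμ.isExpectation N).left_inv, StarAlgEquiv.symm_apply_apply]
      bimodule := fun x a y => by
        rw [hPa, hPa, hj, hj, (hμ.isExpectation N).bimodule, map_mul, map_mul,
          StarAlgEquiv.symm_apply_apply, StarAlgEquiv.symm_apply_apply]
      pos := fun a => by
        obtain ⟨b, hb⟩ := (hμ.isExpectation N).pos a
        exact ⟨(Φ N le_rfl).symm b, by rw [hPa, hb, map_mul, map_star]⟩
      norm_le := fun a => by
        rw [← NonUnitalStarAlgHom.norm_map j hjinj, hjP]
        exact hμ.norm_expect_le N a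
      preserving := fun a => by
        rw [hjP, hμ.expect_apply, (hμ.isExpectation N).preserving] }
  refine ⟨Bridge.ofInjective j hjinj, Bridge.length_ofInjective_le hE hE₀ hjinj hP hη hββ₀ hjP
    (fun n hn a => hμ.expect_expect hn a) (fun n hn a => hμ.expect_expect_of_ge hn a)
    (fun n hn x => hμ.expect_ι hn _) (fun n hn x => hμ₀.restrictExpect_of_le hn x)
    fun n hn x => ?_⟩
  -- Both expectations onto level `n` are read in the same algebra `I₀.obj n`, so that
  -- `norm_sub_le_of_trace_mul` compares them. The faithfulness constant `c` of level `N` serves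
  -- every `n ≤ N` because the connecting maps are isometric.
  let p : I₀.obj N → I₀.obj n := fun y => (Φ n hn).symm (hμ.proj n (j y))
  let p₀ : I₀.obj N → I₀.obj n := fun y => hμ₀.proj n (I₀.ι N y)
  have h1 : I.expect μ n (j x) = j (I₀.trans hn (p x)) := by
    rw [hjt, hμ.expect_apply]
    change _ = I.ι n (Φ n hn ((Φ n hn).symm _))
    rw [StarAlgEquiv.apply_symm_apply]
  have h2 : hμ₀.restrictExpect N n x = I₀.trans hn (p₀ x) := I₀.ι_injective N (by
    rw [hμ₀.ι_restrictExpect, hμ₀.expect_apply, I₀.ι_trans])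
  rw [h1, h2, ← map_sub, ← map_sub, NonUnitalStarAlgHom.norm_map j hjinj,
    NonUnitalStarAlgHom.norm_map (I₀.trans hn) (I₀.trans_injective hn)]
  have key := norm_sub_le_of_trace_mul (T := I₀.trans hn) (t := fun y => μ (j y))
    (t₀ := fun y => μ₀ (I₀.ι N y)) (P := p) (P₀ := p₀) (κ := κ)
    (fun x y => by rw [map_sub, map_sub]) (fun x y => by rw [map_sub, map_sub]) hc
    (fun z => by
      have := hcx (I₀.trans hn z)
      rwa [NonUnitalStarAlgHom.norm_map (I₀.trans hn) (I₀.trans_injective hn), ← map_star,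
        ← map_mul] at this) hκ htt
    (fun y z => by
      rw [hjt, map_mul (Φ n hn), map_mul j, hjt]
      change μ (I.ι n (Φ n hn ((Φ n hn).symm _) * _)) = _
      rw [StarAlgEquiv.apply_symm_apply, (hμ.isExpectation n).trace_mul])
    (fun y z => by
      rw [I₀.ι_trans, (hμ₀.isExpectation n).trace_mul, map_mul (I₀.ι N), I₀.ι_trans])
    (fun y => by
      have h3 : ‖p y‖ = ‖I.ι n (hμ.proj n (j y))‖ := by
        rw [I.norm_ι]
        exact NonUnitalStarAlgHom.norm_map (Φ n hn).symm (Φ n hn).symm.injective _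
      rw [h3, ← hμ.expect_apply]
      exact (hμ.norm_expect_le n _).trans (NonUnitalStarAlgHom.norm_apply_le j y))
    x
  exact key.trans (by gcongr; exact hκη n hn)

end InductiveSeq

theorem edist_le_length {C D : ℝ≥0} (X Y : QQCMS.{u} C D) (γ : Bridge X.carrier Y.carrier) :
    edist X Y ≤ γ.length X.lip Y.lip :=
  iInf_le _ (Trek.single γ)

end QuantumMetric

/-! ## Continuity of the Effros-Shen algebras -/

namespace EffrosShen

open QuantumMetric Filter

/-- The identification of pairs of matrices of equal sizes. -/
noncomputable def pairCast {m m' n n' : ℕ} (hm : m = m') (hn : n = n') :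
    Mat m × Mat n ≃⋆ₐ[ℂ] Mat m' × Mat n' := by
  subst hm hn
  exact StarAlgEquiv.refl ℂ _

/-- All sizes are free variables here, so the equalities can be substituted; this is not possible
for the values `q θ n`. -/
theorem pairCast_embed {r r' m m' n n' N N' : ℕ} (hr : r = r') (hm : m = m') (hn : n = n')
    (hN : N = N') (h : N = r * m + n) (h' : N' = r' * m' + n') (x : Mat m × Mat n) :
    pairCast hN hm (embed h x) = embed h' (pairCast hm hn x) := by
  subst hr hm hn hN
  rfl

theorem pairTrace_pairCast {m m' n n' : ℕ} (hm : m = m') (hn : n = n') (c d : ℂ)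
    (x : Mat m × Mat n) : pairTrace m' n' c d (pairCast hm hn x) = pairTrace m n c d x := by
  subst hm hn
  rfl

theorem pairTrace_sub {m n : ℕ} (c d c' d' : ℂ) (x : Mat m × Mat n) :
    pairTrace m n c d x - pairTrace m n c' d' x = pairTrace m n (c - c') (d - d') x := by
  rw [pairTrace_apply, pairTrace_apply, pairTrace_apply]
  ring

variable {θ₀ θ : ℝ} {N : ℕ}

theorem q_eq_of_coeff_eq (h : ∀ i < N, coeff θ₀ (i + 1) = coeff θ (i + 1)) (n : ℕ) :
    n ≤ N → q θ₀ n = q θ n := by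
  induction n using Nat.twoStepInduction with
  | zero => exact fun _ => rfl
  | one => exact fun hn => h 0 hn
  | more n h1 h2 =>
    intro hn
    change coeff θ₀ (n + 2) * q θ₀ (n + 1) + q θ₀ n = coeff θ (n + 2) * q θ (n + 1) + q θ n
    rw [h (n + 1) hn, h1 (by omega), h2 (by omega)]

/-- The identification of the first algebras of the inductive sequences of two numbers whose first
coefficients agree. -/
noncomputable def objEquiv (h : ∀ i < N, coeff θ₀ (i + 1) = coeff θ (i + 1)) :
    ∀ n, n ≤ N → (seq θ₀).obj n ≃⋆ₐ[ℂ] (seq θ).obj n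
  | 0, _ => StarAlgEquiv.refl ℂ ℂ
  | n + 1, hn => pairCast (q_eq_of_coeff_eq h (n + 1) hn)
      (q_eq_of_coeff_eq h n (n.le_succ.trans hn))

theorem objEquiv_map (h : ∀ i < N, coeff θ₀ (i + 1) = coeff θ (i + 1)) :
    ∀ n (hn : n + 1 ≤ N) x, objEquiv h (n + 1) hn ((seq θ₀).map n x) =
      (seq θ).map n (objEquiv h n (n.le_succ.trans hn) x)
  | 0, hn, x => by
    have h0 : ∀ θ', (seq θ').map 0 x = (show ℂ from x) • (1 : (seq θ').obj 1) := fun θ' =>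
      Algebra.algebraMap_eq_smul_one (A := obj θ' 1) (show ℂ from x)
    change objEquiv h 1 hn ((seq θ₀).map 0 x) = (seq θ).map 0 x
    rw [h0 θ, h0 θ₀, map_smul, map_one]
  | n + 1, hn, x => pairCast_embed (r := coeff θ₀ (n + 2)) (r' := coeff θ (n + 2))
      (N := q θ₀ (n + 2)) (N' := q θ (n + 2)) (h (n + 1) hn) _ _ _ rfl rfl x

theorem norm_objTrace_sub_le (h : ∀ i < N + 1, coeff θ₀ (i + 1) = coeff θ (i + 1))
    (y : (seq θ₀).obj (N + 1)) :
    ‖objTrace θ₀ (N + 1) y - objTrace θ (N + 1) (objEquiv h (N + 1) le_rfl y)‖ ≤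
      (|weight θ₀ (N + 1) - weight θ (N + 1)| * q θ₀ (N + 1) +
        |weight θ₀ (N + 2) - weight θ (N + 2)| * q θ₀ N) * ‖y‖ := by
  have h1 : objTrace θ (N + 1) (objEquiv h (N + 1) le_rfl y) =
      pairTrace (q θ₀ (N + 1)) (q θ₀ N) (weight θ (N + 1)) (weight θ (N + 2)) y :=
    pairTrace_pairCast (q_eq_of_coeff_eq h (N + 1) le_rfl) (q_eq_of_coeff_eq h N N.le_succ) _ _ y
  have h2 : objTrace θ₀ (N + 1) y - objTrace θ (N + 1) (objEquiv h (N + 1) le_rfl y) =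
      pairTrace (q θ₀ (N + 1)) (q θ₀ N) ((weight θ₀ (N + 1) - weight θ (N + 1) : ℝ) : ℂ)
        ((weight θ₀ (N + 2) - weight θ (N + 2) : ℝ) : ℂ) y := by
    rw [h1, Complex.ofReal_sub, Complex.ofReal_sub]
    exact pairTrace_sub _ _ _ _ y
  rw [h2]
  refine (norm_pairTrace_le (m := q θ₀ (N + 1)) (n := q θ₀ N) _ _ y).trans (le_of_eq ?_)
  rw [Complex.norm_real, Complex.norm_real, Real.norm_eq_abs, Real.norm_eq_abs]
  rfl

theorem dimSeq_eq_of_coeff_eq (h : ∀ i < N, coeff θ₀ (i + 1) = coeff θ (i + 1)) (k : ℝ) {n : ℕ}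
    (hn : n ≤ N) : (seq θ).dimSeq k n = (seq θ₀).dimSeq k n := by
  have : Module.finrank ℂ ((seq θ).obj n) = Module.finrank ℂ ((seq θ₀).obj n) := by
    cases n with
    | zero => rfl
    | succ n =>
      rw [finrank_obj_succ, finrank_obj_succ, q_eq_of_coeff_eq h (n + 1) hn,
        q_eq_of_coeff_eq h n (n.le_succ.trans hn)]
  rw [InductiveSeq.dimSeq, InductiveSeq.dimSeq, this]

theorem exists_pos_le (β : ℕ → ℝ) (hβ : ∀ n, 0 < β n) (N : ℕ) : ∃ b, 0 < b ∧ ∀ n ≤ N, b ≤ β n := by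
  obtain ⟨m, -, hm⟩ := Finset.exists_min_image (Finset.range (N + 1)) β ⟨0, by simp⟩
  exact ⟨β m, hβ m, fun n hn => hm n (Finset.mem_range.2 (Nat.lt_succ_of_le hn))⟩

variable {k : ℝ}

/-- Near an irrational number, the spaces are close to one finite dimensional space. -/
theorem exists_eventually_edist_le (hk : 0 < k) (hθ₀ : θ₀ ∈ irrationals) {ε : ℝ} (hε : 0 < ε) :
    ∃ X : QQCMS.{0} 2 0, ∀ᶠ θ in 𝓝 θ₀, ∀ (_ : θ ∈ irrationals) (h : IsLipNorm 2 0 (lip k θ)),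
      edist (space k θ h) X ≤ ENNReal.ofReal ε := by
  -- Half of `ε` pays for the tail beyond level `N + 1`, the other half for the difference of the
  -- traces. The level, and hence `X`, depends on `θ₀` and `ε` but not on `θ`.
  obtain ⟨N, hN⟩ := exists_dimSeq_le hk hθ₀ (half_pos hε)
  have hμ₀ := isFaithfulTrace_trace hθ₀
  have hE₀ := hμ₀.isExpectationSeq_restrictExpect (β := (seq θ₀).dimSeq k) (dimSeq_pos hθ₀)
    (exists_eq_smul_one θ₀) (N + 1)
  have : Nontrivial ((seq θ₀).obj (N + 1)) := (seq θ₀).obj_nontrivial (N + 1)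
  obtain ⟨c, hc, hcx⟩ := exists_mul_norm_sq_le (objTrace θ₀ (N + 1)) (fun x hx => by
    have := eq_zero_of_objTrace hθ₀ (N + 1) (star x) (by rwa [star_star])
    rwa [star_eq_zero] at this)
  -- A common lower bound for the finitely many `β n` lets one `η = 2 κ / c / b` serve all levels up
  -- to `N + 1`.
  obtain ⟨b, hb, hbβ⟩ := exists_pos_le _ (dimSeq_pos (k := k) hθ₀) (N + 1)
  set β₀ := (seq θ₀).dimSeq k
  let κ : ℝ → ℝ := fun θ => |weight θ₀ (N + 1) - weight θ (N + 1)| * q θ₀ (N + 1) +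
    |weight θ₀ (N + 2) - weight θ (N + 2)| * q θ₀ N
  have hκ : Tendsto (fun θ => 2 * κ θ / c / b * β₀ 0 * β₀ 0) (𝓝 θ₀) (𝓝 0) := by
    have h1 : ∀ n, Tendsto (fun θ => |weight θ₀ n - weight θ n|) (𝓝 θ₀) (𝓝 0) := fun n => by
      have := ((tendsto_weight hθ₀.2.2 n).const_sub (weight θ₀ n)).abs
      rwa [sub_self, abs_zero] at this
    have h2 := ((h1 (N + 1)).mul_const (q θ₀ (N + 1) : ℝ)).add ((h1 (N + 2)).mul_const (q θ₀ N : ℝ))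
    have h3 := (((((h2.const_mul 2).div_const c).div_const b).mul_const (β₀ 0)).mul_const (β₀ 0))
    simpa using h3
  let X : QQCMS.{0} 2 0 :=
    { carrier := (seq θ₀).obj (N + 1)
      lip := lipSup (hμ₀.restrictExpect (N + 1)) β₀
      isLipNorm := hE₀.isLipNorm }
  refine ⟨X, ?_⟩
  have hcoeff : ∀ᶠ θ in 𝓝 θ₀, ∀ i < N + 1, coeff θ₀ (i + 1) = coeff θ (i + 1) := by
    have := (Filter.eventually_all_finite (Set.finite_lt_nat (N + 1))).2
      fun i _ => eventually_coeff_succ_eq i hθ₀.2.2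
    exact this.mono fun θ h i hi => (h i hi).symm
  filter_upwards [hcoeff, hκ.eventually (ge_mem_nhds (half_pos hε))] with θ h hκε hθ hL
  have hκ0 : 0 ≤ κ θ := by positivity
  have hββ₀ : ∀ n ≤ N + 1, (seq θ).dimSeq k n = β₀ n := fun n hn => dimSeq_eq_of_coeff_eq h k hn
  obtain ⟨γ, hγ⟩ := InductiveSeq.exists_bridge_length_le (isFaithfulTrace_trace hθ) hμ₀
    (objEquiv h) (objEquiv_map h) (isExpectationSeq_expect hk hθ) hE₀ hββ₀ hκ0
    (η := 2 * κ θ / c / b) (by positivity) hc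
    (fun x => by rw [trace_ι hθ₀]; exact hcx x)
    (fun y => by rw [trace_ι hθ₀, trace_ι hθ]; exact norm_objTrace_sub_le h y)
    (fun n hn => by
      rw [hββ₀ n hn, div_mul_eq_mul_div, le_div_iff₀ hb]
      exact mul_le_mul_of_nonneg_left (hbβ n hn) (by positivity))
  refine (edist_le_length (space k θ hL) X γ).trans (hγ.trans (ENNReal.ofReal_le_ofReal ?_))
  rw [hββ₀ 0 (Nat.zero_le _), hββ₀ (N + 1) le_rfl]
  linarith

theorem continuous_space (hk : 0 < k) (h : ∀ θ : irrationals, IsLipNorm 2 0 (lip k θ)) :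
    Continuous fun θ : irrationals => space k θ (h θ) := by
  rw [continuous_iff_continuousAt]
  intro θ₀
  rw [ContinuousAt, EMetric.tendsto_nhds]
  intro ε hε
  obtain ⟨r, hr0, hr⟩ := ENNReal.lt_iff_exists_nnreal_btwn.1 hε
  have hr0' : (0 : ℝ) < r := by exact_mod_cast hr0
  obtain ⟨X, hX⟩ := exists_eventually_edist_le hk θ₀.2 (half_pos hr0')
  -- The eventual estimate holds at `θ₀` itself, so `X` is an intermediate point between `θ` and
  -- `θ₀`.
  have h0 := hX.self_of_nhds θ₀.2 (h θ₀)
  filter_upwards [continuous_subtype_val.continuousAt.eventually hX] with θ hθ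
  refine lt_of_le_of_lt ((edist_triangle _ X _).trans (add_le_add (hθ θ.2 (h θ))
    ((edist_comm _ _).trans_le h0))) ?_
  rw [← ENNReal.ofReal_add (by positivity) (by positivity), add_halves]
  simpa using hr

end EffrosShen

theorem mainTheorem3 (k : ℝ) (hk : 0 < k) :
    (∀ θ ∈ EffrosShen.irrationals,
      ¬ FiniteDimensional ℂ (EffrosShen.AF θ) ∧
      (∃! τ : WeakDual ℂ (EffrosShen.AF θ), QuantumMetric.IsTracialState τ) ∧
      QuantumMetric.IsFaithful (EffrosShen.trace θ) ∧
      ∀ n : ℕ, ∃! E : EffrosShen.AF θ →L[ℂ] EffrosShen.AF θ,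
        QuantumMetric.IsPreservingCondExp (EffrosShen.trace θ)
          ((EffrosShen.seq θ).ι n).range E) ∧
    ∃ h : ∀ θ : EffrosShen.irrationals, QuantumMetric.IsLipNorm 2 0 (EffrosShen.lip k θ),
      Continuous fun θ : EffrosShen.irrationals => EffrosShen.space k θ (h θ) :=
  ⟨fun _ hθ => ⟨EffrosShen.not_finiteDimensional hθ, EffrosShen.existsUnique_isTracialState hθ,
      (EffrosShen.isFaithfulTrace_trace hθ).isFaithful,
      (EffrosShen.isFaithfulTrace_trace hθ).existsUnique_isPreservingCondExp⟩,
    fun θ => EffrosShen.isLipNorm_lip hk θ.2, EffrosShen.continuous_space hk _⟩
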